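/- Let $\tilde{\mathfrak g}=\mathfrak g_{\bar 0}\oplus\mathfrak g_{\bar 1}$ be a finite-dimensional complex Lie superalgebra of type I with reductive even part: $\mathfrak g:=\mathfrak g_{\bar 0}$ is a reductive Lie algebra, and $\mathfrak g_{\bar 1}=\mathfrak g_{-1}\oplus\mathfrak g_{1}$ for two $\mathfrak g$-submodules $\mathfrak g_{\pm1}$ with $[\mathfrak g_{1},\mathfrak g_{1}]=0=[\mathfrak g_{-1},\mathfrak g_{-1}]$. Let $\tilde{\mathfrak b}=\mathfrak b\oplus\mathfrak g_{1}$ be a distinguished Borel subalgebra, where $\mathfrak b=\mathfrak h\oplus\mathfrak n^+$ is a Borel subalgebra of $\mathfrak g$ (that is, $\mathfrak h$ is a Cartan subalgebra of $\mathfrak g$ and $\mathfrak n^+$ is the sum of the root spaces for some system of positive roots). Let $\mathbb C_\lambda$ be a one-dimensional $\tilde{\mathfrak b}$-supermodule, of either parity; equivalently, $\mathfrak h$ acts on it through some $\lambda\in\mathfrak h^*$, while $\mathfrak n^+$ and $\mathfrak g_1$ act by zero. Then the Verma supermodule $$\tilde\Delta_\lambda=U(\tilde{\mathfrak g})\otimes_{U(\tilde{\mathfrak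 b})}\mathbb C_\lambda$$ has simple socle: the sum of all its simple sub-supermodules (that is, of its $\mathbb Z/2$-graded $U(\tilde{\mathfrak g})$-submodules that are nonzero and contain no graded submodule other than zero and themselves) is itself a simple $\tilde{\mathfrak g}$-supermodule. -/

import Mathlib

open scoped TensorProduct

noncomputable section

/-- A complex Lie superalgebra `𝔤₀ ⊕ 𝔤₁`, given by its homogeneous components.  The even part is a
Lie algebra, the odd part is a module over it (`⁅x, v⁆ = -⁅v, x⁆` is the bracket of an even and an
odd element), and `bracket` is the super-symmetric bracket of two odd elements.  The last two
fields are the super Jacobi identity for one even and two odd elements, and for three odd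
elements; for at least two even elements it is the Lie algebra and the Lie module axiom. -/
structure LieSuperalgebra (𝔤₀ 𝔤₁ : Type*) [LieRing 𝔤₀] [LieAlgebra ℂ 𝔤₀]
    [AddCommGroup 𝔤₁] [Module ℂ 𝔤₁] [LieRingModule 𝔤₀ 𝔤₁] [LieModule ℂ 𝔤₀ 𝔤₁] where
  bracket : 𝔤₁ →ₗ[ℂ] 𝔤₁ →ₗ[ℂ] 𝔤₀
  bracket_comm : ∀ v w, bracket v w = bracket w v
  lie_bracket : ∀ (x : 𝔤₀) (v w : 𝔤₁),
    ⁅x, bracket v w⁆ = bracket ⁅x, v⁆ w + bracket v ⁅x, w⁆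
  jacobi : ∀ u v w : 𝔤₁,
    ⁅bracket u v, w⁆ + ⁅bracket v w, u⁆ + ⁅bracket w u, v⁆ = 0

namespace LieSuperalgebra

section Enveloping

variable {𝔤₀ 𝔤₁ : Type*} [LieRing 𝔤₀] [LieAlgebra ℂ 𝔤₀]
  [AddCommGroup 𝔤₁] [Module ℂ 𝔤₁] [LieRingModule 𝔤₀ 𝔤₁] [LieModule ℂ 𝔤₀ 𝔤₁]
  (G : LieSuperalgebra 𝔤₀ 𝔤₁)

/-- The inclusion of the even part in the tensor algebra. -/
def tensorEven : 𝔤₀ →ₗ[ℂ] TensorAlgebra ℂ (𝔤₀ × 𝔤₁) :=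
  TensorAlgebra.ι ℂ ∘ₗ LinearMap.inl ℂ 𝔤₀ 𝔤₁

/-- The inclusion of the odd part in the tensor algebra. -/
def tensorOdd : 𝔤₁ →ₗ[ℂ] TensorAlgebra ℂ (𝔤₀ × 𝔤₁) :=
  TensorAlgebra.ι ℂ ∘ₗ LinearMap.inr ℂ 𝔤₀ 𝔤₁

/-- The relations `x y - (-1)^{|x||y|} y x = [x, y]` for homogeneous `x`, `y`. -/
inductive EnvelopingRel : TensorAlgebra ℂ (𝔤₀ × 𝔤₁) → TensorAlgebra ℂ (𝔤₀ × 𝔤₁) → Prop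
  | even_even (x y : 𝔤₀) : EnvelopingRel
      (tensorEven x * tensorEven y - tensorEven y * tensorEven x) (tensorEven ⁅x, y⁆)
  | even_odd (x : 𝔤₀) (v : 𝔤₁) : EnvelopingRel
      (tensorEven x * tensorOdd v - tensorOdd v * tensorEven x) (tensorOdd ⁅x, v⁆)
  | odd_odd (v w : 𝔤₁) : EnvelopingRel
      (tensorOdd v * tensorOdd w + tensorOdd w * tensorOdd v) (tensorEven (G.bracket v w))

/-- The universal enveloping algebra of a Lie superalgebra. -/
def Enveloping : Type _ := RingQuot G.EnvelopingRel

instance : Ring G.Enveloping := inferInstanceAs (Ring (RingQuot G.EnvelopingRel))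

instance : Algebra ℂ G.Enveloping := inferInstanceAs (Algebra ℂ (RingQuot G.EnvelopingRel))

/-- The quotient map from the tensor algebra. -/
def mkEnveloping : TensorAlgebra ℂ (𝔤₀ × 𝔤₁) →ₐ[ℂ] G.Enveloping :=
  RingQuot.mkAlgHom ℂ G.EnvelopingRel

/-- The canonical map from the even part to the enveloping algebra. -/
def ιEven : 𝔤₀ →ₗ[ℂ] G.Enveloping := G.mkEnveloping.toLinearMap ∘ₗ tensorEven

/-- The canonical map from the odd part to the enveloping algebra. -/
def ιOdd : 𝔤₁ →ₗ[ℂ] G.Enveloping := G.mkEnveloping.toLinearMap ∘ₗ tensorOdd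

theorem ιEven_mul (x y : 𝔤₀) :
    G.ιEven x * G.ιEven y - G.ιEven y * G.ιEven x = G.ιEven ⁅x, y⁆ := by
  have h := RingQuot.mkAlgHom_rel ℂ (EnvelopingRel.even_even (G := G) x y)
  rw [map_sub, map_mul, map_mul] at h
  exact h

theorem ιEven_mul_ιOdd (x : 𝔤₀) (v : 𝔤₁) :
    G.ιEven x * G.ιOdd v - G.ιOdd v * G.ιEven x = G.ιOdd ⁅x, v⁆ := by
  have h := RingQuot.mkAlgHom_rel ℂ (EnvelopingRel.even_odd (G := G) x v)
  rw [map_sub, map_mul, map_mul] at h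
  exact h

theorem ιOdd_mul (v w : 𝔤₁) :
    G.ιOdd v * G.ιOdd w + G.ιOdd w * G.ιOdd v = G.ιEven (G.bracket v w) := by
  have h := RingQuot.mkAlgHom_rel ℂ (EnvelopingRel.odd_odd (G := G) v w)
  rw [map_add, map_mul, map_mul] at h
  exact h

/-- The universal property of the enveloping algebra. -/
def liftEnveloping {A : Type*} [Ring A] [Algebra ℂ A] (f : 𝔤₀ →ₗ[ℂ] A) (g : 𝔤₁ →ₗ[ℂ] A)
    (h₀₀ : ∀ x y, f x * f y - f y * f x = f ⁅x, y⁆)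
    (h₀₁ : ∀ x v, f x * g v - g v * f x = g ⁅x, v⁆)
    (h₁₁ : ∀ v w, g v * g w + g w * g v = f (G.bracket v w)) : G.Enveloping →ₐ[ℂ] A :=
  RingQuot.liftAlgHom ℂ ⟨TensorAlgebra.lift ℂ (f.coprod g), by
    intro a b hab
    cases hab <;> simp [tensorEven, tensorOdd, h₀₀, h₀₁, h₁₁]⟩

@[simp]
theorem liftEnveloping_ιEven {A : Type*} [Ring A] [Algebra ℂ A] (f : 𝔤₀ →ₗ[ℂ] A)
    (g : 𝔤₁ →ₗ[ℂ] A) (h₀₀ h₀₁ h₁₁) (x : 𝔤₀) :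
    G.liftEnveloping f g h₀₀ h₀₁ h₁₁ (G.ιEven x) = f x := by
  have h : G.liftEnveloping f g h₀₀ h₀₁ h₁₁ (G.ιEven x) =
    TensorAlgebra.lift ℂ (f.coprod g) (tensorEven x) :=
      RingQuot.liftAlgHom_mkAlgHom_apply ℂ _ _ _
  simp [h, tensorEven]

@[simp]
theorem liftEnveloping_ιOdd {A : Type*} [Ring A] [Algebra ℂ A] (f : 𝔤₀ →ₗ[ℂ] A)
    (g : 𝔤₁ →ₗ[ℂ] A) (h₀₀ h₀₁ h₁₁) (v : 𝔤₁) :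
    G.liftEnveloping f g h₀₀ h₀₁ h₁₁ (G.ιOdd v) = g v := by
  have h : G.liftEnveloping f g h₀₀ h₀₁ h₁₁ (G.ιOdd v) =
    TensorAlgebra.lift ℂ (f.coprod g) (tensorOdd v) :=
      RingQuot.liftAlgHom_mkAlgHom_apply ℂ _ _ _
  simp [h, tensorOdd]

theorem enveloping_induction {p : G.Enveloping → Prop} (u : G.Enveloping)
    (hc : ∀ c : ℂ, p (algebraMap ℂ _ c)) (he : ∀ x, p (G.ιEven x)) (ho : ∀ v, p (G.ιOdd v))
    (hmul : ∀ a b, p a → p b → p (a * b)) (hadd : ∀ a b, p a → p b → p (a + b)) : p u := by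
  obtain ⟨t, rfl⟩ : ∃ t, G.mkEnveloping t = u := RingQuot.mkAlgHom_surjective ℂ _ u
  induction t using TensorAlgebra.induction with
  | algebraMap c => simpa using hc c
  | ι z =>
    have hz : TensorAlgebra.ι ℂ z = tensorEven z.1 + tensorOdd z.2 := by
      simp [tensorEven, tensorOdd, ← map_add]
    rw [hz, map_add]
    exact hadd _ _ (he _) (ho _)
  | mul a b ha hb => rw [map_mul]; exact hmul _ _ ha hb
  | add a b ha hb => rw [map_add]; exact hadd _ _ ha hb

/-- A homogeneous element of the Lie superalgebra, seen in the enveloping algebra. -/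
def letter : 𝔤₀ ⊕ 𝔤₁ → G.Enveloping := Sum.elim G.ιEven G.ιOdd

/-- The homogeneous component of parity `i` of the enveloping algebra: the span of the products
of homogeneous elements whose number of odd factors is congruent to `i` modulo `2`. -/
def envelopingPart (i : ZMod 2) : Submodule ℂ G.Enveloping :=
  Submodule.span ℂ {u | ∃ l : List (𝔤₀ ⊕ 𝔤₁),
    ((l.countP Sum.isRight : ℕ) : ZMod 2) = i ∧ u = (l.map G.letter).prod}

theorem one_mem_envelopingPart : (1 : G.Enveloping) ∈ G.envelopingPart 0 :=
  Submodule.subset_span ⟨[], by simp, by simp⟩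

theorem ιEven_mem_envelopingPart (x : 𝔤₀) : G.ιEven x ∈ G.envelopingPart 0 :=
  Submodule.subset_span ⟨[Sum.inl x], by simp, by simp [letter]⟩

theorem ιOdd_mem_envelopingPart (v : 𝔤₁) : G.ιOdd v ∈ G.envelopingPart 1 :=
  Submodule.subset_span ⟨[Sum.inr v], by simp, by simp [letter]⟩

theorem mul_mem_envelopingPart {i j : ZMod 2} {a b : G.Enveloping}
    (ha : a ∈ G.envelopingPart i) (hb : b ∈ G.envelopingPart j) :
    a * b ∈ G.envelopingPart (i + j) := by
  have h := Submodule.mul_mem_mul ha hb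
  rw [envelopingPart, envelopingPart, Submodule.span_mul_span] at h
  refine Submodule.span_mono ?_ h
  rintro _ ⟨_, ⟨l, hl, rfl⟩, _, ⟨m, hm, rfl⟩, rfl⟩
  exact ⟨l ++ m, by simp [← hl, ← hm], by simp⟩

theorem envelopingPart_sup : G.envelopingPart 0 ⊔ G.envelopingPart 1 = ⊤ := by
  rw [eq_top_iff]
  rintro u -
  refine G.enveloping_induction (p := fun u => u ∈ G.envelopingPart 0 ⊔ G.envelopingPart 1) u
    (fun c => ?_) (fun x => ?_) (fun v => ?_) (fun a b ha hb => ?_) (fun a b ha hb => ?_)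
  · rw [Algebra.algebraMap_eq_smul_one]
    exact Submodule.smul_mem _ _ (Submodule.mem_sup_left G.one_mem_envelopingPart)
  · exact Submodule.mem_sup_left (G.ιEven_mem_envelopingPart x)
  · exact Submodule.mem_sup_right (G.ιOdd_mem_envelopingPart v)
  · obtain ⟨a₀, ha₀, a₁, ha₁, rfl⟩ := Submodule.mem_sup.1 ha
    obtain ⟨b₀, hb₀, b₁, hb₁, rfl⟩ := Submodule.mem_sup.1 hb
    have h₀₀ := G.mul_mem_envelopingPart ha₀ hb₀
    have h₀₁ := G.mul_mem_envelopingPart ha₀ hb₁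
    have h₁₀ := G.mul_mem_envelopingPart ha₁ hb₀
    have h₁₁ := G.mul_mem_envelopingPart ha₁ hb₁
    rw [add_mul, mul_add, mul_add]
    exact add_mem (add_mem (Submodule.mem_sup_left h₀₀) (Submodule.mem_sup_right h₀₁))
      (add_mem (Submodule.mem_sup_right h₁₀) (Submodule.mem_sup_left h₁₁))
  · exact add_mem ha hb

/-- The parity automorphism of the enveloping algebra, `(-1)^i` in parity `i`. -/
def parityAut : G.Enveloping →ₐ[ℂ] G.Enveloping :=
  G.liftEnveloping G.ιEven (-G.ιOdd) (fun x y => G.ιEven_mul x y)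
    (fun x v => by simp [← G.ιEven_mul_ιOdd x v]; abel)
    (fun v w => by simp [← G.ιOdd_mul v w])

theorem parityAut_of_mem {i : ZMod 2} {u : G.Enveloping} (hu : u ∈ G.envelopingPart i) :
    G.parityAut u = (-1 : ℂ) ^ i.val • u := by
  induction hu using Submodule.span_induction with
  | mem u hu =>
    obtain ⟨l, rfl, rfl⟩ := hu
    rw [ZMod.val_natCast, ← neg_one_pow_eq_pow_mod_two]
    induction l with
    | nil => simp
    | cons a l ih =>
      rcases a with x | v
      · have hx : G.parityAut (G.ιEven x) = G.ιEven x := by simp [parityAut]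
        simp only [List.map_cons, List.prod_cons, map_mul, ih]
        simp [letter, hx]
      · have hv : G.parityAut (G.ιOdd v) = -G.ιOdd v := by simp [parityAut]
        simp only [List.map_cons, List.prod_cons, map_mul, ih]
        simp [letter, hv, List.countP_cons, pow_succ]
  | zero => simp
  | add a b _ _ ha hb => rw [map_add, ha, hb, smul_add]
  | smul c a _ ha => rw [map_smul, ha, smul_comm]

end Enveloping

section Supermodules

variable {𝔤₀ 𝔤₁ : Type*} [LieRing 𝔤₀] [LieAlgebra ℂ 𝔤₀]
  [AddCommGroup 𝔤₁] [Module ℂ 𝔤₁] [LieRingModule 𝔤₀ 𝔤₁] [LieModule ℂ 𝔤₀ 𝔤₁]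
  (G : LieSuperalgebra 𝔤₀ 𝔤₁)

/-- A structure of supermodule on a module `M` over the enveloping algebra: a `ℤ/2`-grading of `M`
that is compatible with the parity of the elements of the Lie superalgebra. -/
structure SuperGrading (M : Type*) [AddCommGroup M] [Module ℂ M] [Module G.Enveloping M]
    [IsScalarTower ℂ G.Enveloping M] where
  part : ZMod 2 → Submodule ℂ M
  isInternal : DirectSum.IsInternal part
  even_smul_mem : ∀ (x : 𝔤₀) (i : ZMod 2), ∀ m ∈ part i, G.ιEven x • m ∈ part i
  odd_smul_mem : ∀ (v : 𝔤₁) (i : ZMod 2), ∀ m ∈ part i, G.ιOdd v • m ∈ part (i + 1)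

namespace SuperGrading

variable {G} {M : Type*} [AddCommGroup M] [Module ℂ M] [Module G.Enveloping M]
  [IsScalarTower ℂ G.Enveloping M] (gr : G.SuperGrading M)

/-- A submodule is a sub-supermodule if it contains the homogeneous components of each of its
elements. -/
def IsSubsupermodule (N : Submodule G.Enveloping M) : Prop :=
  ∀ m ∈ N, ∃ m₀ ∈ gr.part 0, ∃ m₁ ∈ gr.part 1, m₀ ∈ N ∧ m₁ ∈ N ∧ m = m₀ + m₁

/-- A sub-supermodule is simple if it is nonzero and has no sub-supermodule other than zero
and itself. -/
def IsSimpleSub (N : Submodule G.Enveloping M) : Prop :=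
  gr.IsSubsupermodule N ∧ N ≠ ⊥ ∧
    ∀ K : Submodule G.Enveloping M, gr.IsSubsupermodule K → K ≤ N → K = ⊥ ∨ K = N

/-- The socle: the sum of all simple sub-supermodules (zero if there are none). -/
def socle : Submodule G.Enveloping M := sSup {N | gr.IsSimpleSub N}

end SuperGrading

/-- A sub-superalgebra: a graded subspace which is closed under the bracket. -/
structure Sub where
  even : LieSubalgebra ℂ 𝔤₀
  odd : Submodule ℂ 𝔤₁
  lie_mem : ∀ x ∈ even, ∀ v ∈ odd, ⁅x, v⁆ ∈ odd
  bracket_mem : ∀ v ∈ odd, ∀ w ∈ odd, G.bracket v w ∈ even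

namespace Sub

variable {G} (B : G.Sub)

instance : LieRingModule B.even B.odd where
  bracket x v := ⟨⁅(x : 𝔤₀), (v : 𝔤₁)⁆, B.lie_mem x x.2 v v.2⟩
  add_lie x y v := Subtype.ext (add_lie (x : 𝔤₀) (y : 𝔤₀) (v : 𝔤₁))
  lie_add x v w := Subtype.ext (lie_add (x : 𝔤₀) (v : 𝔤₁) (w : 𝔤₁))
  leibniz_lie x y v := Subtype.ext (leibniz_lie (x : 𝔤₀) (y : 𝔤₀) (v : 𝔤₁))

@[simp]
theorem coe_lie (x : B.even) (v : B.odd) : ((⁅x, v⁆ : B.odd) : 𝔤₁) = ⁅(x : 𝔤₀), (v : 𝔤₁)⁆ := rfl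

instance : LieModule ℂ B.even B.odd where
  smul_lie c x v := Subtype.ext (smul_lie c (x : 𝔤₀) (v : 𝔤₁))
  lie_smul c x v := Subtype.ext (lie_smul c (x : 𝔤₀) (v : 𝔤₁))

/-- A sub-superalgebra as a Lie superalgebra. -/
def toLieSuperalgebra : LieSuperalgebra B.even B.odd where
  bracket := LinearMap.mk₂ ℂ
    (fun v w => ⟨G.bracket v w, B.bracket_mem v v.2 w w.2⟩)
    (fun v v' w => Subtype.ext (by simp)) (fun c v w => Subtype.ext (by simp))
    (fun v w w' => Subtype.ext (by simp)) (fun c v w => Subtype.ext (by simp))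
  bracket_comm v w := Subtype.ext (G.bracket_comm v w)
  lie_bracket x v w := Subtype.ext (G.lie_bracket x v w)
  jacobi u v w := Subtype.ext (G.jacobi u v w)

/-- The algebra homomorphism `U(B) → U(G)` induced by the inclusion. -/
def envelopingMap : B.toLieSuperalgebra.Enveloping →ₐ[ℂ] G.Enveloping :=
  B.toLieSuperalgebra.liftEnveloping (G.ιEven ∘ₗ B.even.toSubmodule.subtype)
    (G.ιOdd ∘ₗ B.odd.subtype)
    (fun x y => G.ιEven_mul x y) (fun x v => G.ιEven_mul_ιOdd x v) (fun v w => G.ιOdd_mul v w)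

@[simp]
theorem envelopingMap_ιEven (x : B.even) :
    B.envelopingMap (B.toLieSuperalgebra.ιEven x) = G.ιEven x :=
  liftEnveloping_ιEven ..

@[simp]
theorem envelopingMap_ιOdd (v : B.odd) :
    B.envelopingMap (B.toLieSuperalgebra.ιOdd v) = G.ιOdd v :=
  liftEnveloping_ιOdd ..

/-- The datum of a one-dimensional supermodule over `B`, up to parity: the even part acts by a
linear functional, the odd part necessarily acts by zero, so the functional has to vanish on all
brackets of two even or two odd elements. -/
structure Character where
  toFun : B.even →ₗ[ℂ] ℂ
  map_lie : ∀ x y : B.even, toFun ⁅x, y⁆ = 0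
  map_bracket : ∀ v w : B.odd, toFun (B.toLieSuperalgebra.bracket v w) = 0

variable {B} in
/-- The one-dimensional representation `ℂ_χ` of `U(B)` on the space `ℂ`. -/
def Character.rep (χ : B.Character) :
    B.toLieSuperalgebra.Enveloping →ₐ[ℂ] Module.End ℂ ℂ :=
  B.toLieSuperalgebra.liftEnveloping
    ((LinearMap.toSpanSingleton ℂ (Module.End ℂ ℂ) 1) ∘ₗ χ.toFun) 0
    (fun x y => by simp [χ.map_lie, smul_comm (χ.toFun y)]) (fun x v => by simp)
    (fun v w => by simp [χ.map_bracket])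

variable {B} in
@[simp]
theorem Character.rep_ιEven (χ : B.Character) (x : B.even) :
    χ.rep (B.toLieSuperalgebra.ιEven x) = χ.toFun x • 1 := by
  simp [Character.rep]

variable {B} in
@[simp]
theorem Character.rep_ιOdd (χ : B.Character) (v : B.odd) :
    χ.rep (B.toLieSuperalgebra.ιOdd v) = 0 := by
  simp [Character.rep]

end Sub

end Supermodules

section Induction

variable {A B M : Type*} [Ring A] [Algebra ℂ A] [Ring B] [Algebra ℂ B] [AddCommGroup M]
  [Module ℂ M] (φ : B →ₐ[ℂ] A) (ρ : B →ₐ[ℂ] Module.End ℂ M)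

/-- The relations `a φ(b) ⊗ m = a ⊗ b m`. -/
def inducedRelations : Submodule A (A ⊗[ℂ] M) :=
  Submodule.span A {t | ∃ (a : A) (b : B) (m : M), t = (a * φ b) ⊗ₜ[ℂ] m - a ⊗ₜ[ℂ] (ρ b m)}

/-- The induced `A`-module `A ⊗_B M`, where `A` is a right `B`-module through `φ` and `M` is a left
`B`-module through `ρ`. -/
def Induced : Type _ := (A ⊗[ℂ] M) ⧸ inducedRelations φ ρ

instance : AddCommGroup (Induced φ ρ) :=
  inferInstanceAs (AddCommGroup ((A ⊗[ℂ] M) ⧸ inducedRelations φ ρ))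

instance : Module A (Induced φ ρ) :=
  inferInstanceAs (Module A ((A ⊗[ℂ] M) ⧸ inducedRelations φ ρ))

instance : Module ℂ (Induced φ ρ) :=
  inferInstanceAs (Module ℂ ((A ⊗[ℂ] M) ⧸ inducedRelations φ ρ))

instance : IsScalarTower ℂ A (Induced φ ρ) :=
  inferInstanceAs (IsScalarTower ℂ A ((A ⊗[ℂ] M) ⧸ inducedRelations φ ρ))

/-- The quotient map `A ⊗ M → A ⊗_B M`. -/
def mkInduced : (A ⊗[ℂ] M) →ₗ[A] Induced φ ρ := (inducedRelations φ ρ).mkQ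

theorem mkInduced_surjective : Function.Surjective (mkInduced φ ρ) :=
  Submodule.mkQ_surjective _

end Induction

section Verma

variable {𝔤₀ 𝔤₁ : Type*} [LieRing 𝔤₀] [LieAlgebra ℂ 𝔤₀]
  [AddCommGroup 𝔤₁] [Module ℂ 𝔤₁] [LieRingModule 𝔤₀ 𝔤₁] [LieModule ℂ 𝔤₀ 𝔤₁]
  {G : LieSuperalgebra 𝔤₀ 𝔤₁} {B : G.Sub} (χ : B.Character)

/-- The Verma supermodule `U(G) ⊗_{U(B)} ℂ_χ` (for a Borel sub-superalgebra `B`). -/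
abbrev Verma : Type _ := Induced B.envelopingMap χ.rep

/-- The linear map `u ↦ u ⊗ 1` from `U(G)` to the Verma supermodule. -/
def toVerma : G.Enveloping →ₗ[ℂ] Verma χ :=
  (mkInduced B.envelopingMap χ.rep).restrictScalars ℂ ∘ₗ
    (TensorProduct.mk ℂ G.Enveloping ℂ).flip 1

theorem toVerma_mul (a u : G.Enveloping) : toVerma χ (a * u) = a • toVerma χ u := by
  simp [toVerma, ← map_smul, TensorProduct.smul_tmul']

theorem toVerma_surjective : Function.Surjective (toVerma χ) := by
  intro m
  obtain ⟨t, rfl⟩ := mkInduced_surjective _ _ m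
  induction t using TensorProduct.induction_on with
  | zero => exact ⟨0, by simp⟩
  | tmul u z =>
    refine ⟨z • u, ?_⟩
    change mkInduced _ _ ((z • u) ⊗ₜ[ℂ] (1 : ℂ)) = _
    rw [TensorProduct.smul_tmul, smul_eq_mul, mul_one]
  | add a b ha hb =>
    obtain ⟨u, hu⟩ := ha
    obtain ⟨v, hv⟩ := hb
    exact ⟨u + v, by rw [map_add, map_add, hu, hv]⟩

/-- The component of parity `i` of the Verma supermodule whose generator `1 ⊗ 1` has
parity `ε`. -/
def vermaPart (ε i : ZMod 2) : Submodule ℂ (Verma χ) :=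
  (G.envelopingPart (i - ε)).map (toVerma χ)

theorem parityAut_envelopingMap (b : B.toLieSuperalgebra.Enveloping) :
    G.parityAut (B.envelopingMap b) = B.envelopingMap (B.toLieSuperalgebra.parityAut b) := by
  refine enveloping_induction _
    (p := fun b => G.parityAut (B.envelopingMap b) =
      B.envelopingMap (B.toLieSuperalgebra.parityAut b)) b
    (fun c => ?_) (fun x => ?_) (fun v => ?_) (fun a b ha hb => ?_) (fun a b ha hb => ?_)
  · simp only [AlgHom.commutes]
  · simp [parityAut]
  · simp [parityAut]
  · simp only [map_mul, ha, hb]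
  · simp only [map_add, ha, hb]

theorem rep_parityAut (b : B.toLieSuperalgebra.Enveloping) :
    χ.rep (B.toLieSuperalgebra.parityAut b) = χ.rep b := by
  refine enveloping_induction _
    (p := fun b => χ.rep (B.toLieSuperalgebra.parityAut b) = χ.rep b) b
    (fun c => ?_) (fun x => ?_) (fun v => ?_) (fun a b ha hb => ?_) (fun a b ha hb => ?_)
  · simp only [AlgHom.commutes]
  · simp [parityAut]
  · simp [parityAut]
  · simp only [map_mul, ha, hb]
  · simp only [map_add, ha, hb]

/-- The parity involution of the Verma supermodule (for a generator of even parity). -/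
def vermaParity : Verma χ →ₛₗ[(G.parityAut : G.Enveloping →+* G.Enveloping)] Verma χ :=
  (inducedRelations B.envelopingMap χ.rep).liftQ
    { toFun := fun t => mkInduced B.envelopingMap χ.rep
        (TensorProduct.map G.parityAut.toLinearMap LinearMap.id t)
      map_add' := fun s t => by simp
      map_smul' := fun a t => by
        rw [← map_smul]
        congr 1
        induction t using TensorProduct.induction_on with
        | zero => simp
        | tmul u z => simp [TensorProduct.smul_tmul']
        | add s t hs ht => simp only [smul_add, map_add, hs, ht] }
    (by
      rw [inducedRelations, Submodule.span_le]
      rintro _ ⟨a, b, m, rfl⟩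
      change mkInduced B.envelopingMap χ.rep _ = 0
      rw [map_sub, TensorProduct.map_tmul, TensorProduct.map_tmul]
      refine (Submodule.Quotient.mk_eq_zero _).2 (Submodule.subset_span
        ⟨G.parityAut a, B.toLieSuperalgebra.parityAut b, m, ?_⟩)
      simp [parityAut_envelopingMap, rep_parityAut])

theorem vermaParity_toVerma (u : G.Enveloping) :
    vermaParity χ (toVerma χ u) = toVerma χ (G.parityAut u) := rfl

theorem vermaParity_of_mem {ε i : ZMod 2} {m : Verma χ} (hm : m ∈ vermaPart χ ε i) :
    vermaParity χ m = (-1 : ℂ) ^ (i - ε).val • m := by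
  obtain ⟨u, hu, rfl⟩ := hm
  rw [vermaParity_toVerma, G.parityAut_of_mem hu, map_smul]

theorem vermaPart_isCompl (ε : ZMod 2) : IsCompl (vermaPart χ ε 0) (vermaPart χ ε 1) := by
  have key : IsCompl (vermaPart χ 0 0) (vermaPart χ 0 1) := by
    constructor
    · rw [Submodule.disjoint_def]
      intro m h₀ h₁
      have h := (vermaParity_of_mem χ h₀).symm.trans (vermaParity_of_mem χ h₁)
      have h' : (2 : ℂ) • m = 0 := by
        have h2 : m = -m := by simpa [ZMod.val_one] using h
        rw [two_smul]
        nth_rewrite 2 [h2]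
        exact add_neg_cancel m
      exact (smul_eq_zero.1 h').resolve_left two_ne_zero
    · rw [codisjoint_iff, vermaPart, vermaPart, ← Submodule.map_sup]
      simp only [sub_zero, envelopingPart_sup, Submodule.map_top]
      exact LinearMap.range_eq_top.2 (toVerma_surjective χ)
  have hε : ε = 0 ∨ ε = 1 := by revert ε; decide
  rcases hε with rfl | rfl
  · exact key
  · have h : ∀ i : ZMod 2, vermaPart χ 1 i = vermaPart χ 0 (i - 1) := fun i => by
      simp [vermaPart]
    rw [h, h]
    exact key.symm

/-- The Verma supermodule as a supermodule, with generator `1 ⊗ 1` of parity `ε`; the two choices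
of `ε` differ by the parity change functor. -/
def vermaGrading (ε : ZMod 2) : G.SuperGrading (Verma χ) where
  part := vermaPart χ ε
  isInternal := (DirectSum.isInternal_submodule_iff_isCompl _ (zero_ne_one (α := ZMod 2))
    (by ext i; revert i; decide)).2 (vermaPart_isCompl χ ε)
  even_smul_mem := by
    rintro x i _ ⟨u, hu, rfl⟩
    rw [← toVerma_mul]
    have h := G.mul_mem_envelopingPart (G.ιEven_mem_envelopingPart x) hu
    rw [zero_add] at h
    exact ⟨_, h, rfl⟩
  odd_smul_mem := by
    rintro v i _ ⟨u, hu, rfl⟩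
    rw [← toVerma_mul]
    have h := G.mul_mem_envelopingPart (G.ιOdd_mem_envelopingPart v) hu
    rw [show (1 : ZMod 2) + (i - ε) = i + 1 - ε by ring] at h
    exact ⟨_, h, rfl⟩

end Verma

section TypeI

variable {𝔤₀ 𝔤₁ : Type*} [LieRing 𝔤₀] [LieAlgebra ℂ 𝔤₀]
  [AddCommGroup 𝔤₁] [Module ℂ 𝔤₁] [LieRingModule 𝔤₀ 𝔤₁] [LieModule ℂ 𝔤₀ 𝔤₁]

/-- A type I structure: a `ℤ`-grading `𝔤₋₁ ⊕ 𝔤₀ ⊕ 𝔤₊₁` of the Lie superalgebra whose component of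
degree `0` is the even part, that is, a decomposition of the odd part into two submodules on each
of which the bracket vanishes. -/
structure TypeI (G : LieSuperalgebra 𝔤₀ 𝔤₁) where
  minus : LieSubmodule ℂ 𝔤₀ 𝔤₁
  plus : LieSubmodule ℂ 𝔤₀ 𝔤₁
  isCompl : IsCompl minus plus
  bracket_minus : ∀ v ∈ minus, ∀ w ∈ minus, G.bracket v w = 0
  bracket_plus : ∀ v ∈ plus, ∀ w ∈ plus, G.bracket v w = 0

/-- A Borel subalgebra of a reductive Lie algebra: `𝔥 ⊕ 𝔫⁺`, where `𝔥` is a Cartan subalgebra and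
`𝔫⁺` is the sum of the root spaces of the positive roots, for the system of positive roots cut out
by a real linear functional `ω` on `𝔥*` which does not vanish on any root. -/
def IsBorel [FiniteDimensional ℂ 𝔤₀] (𝔟 : LieSubalgebra ℂ 𝔤₀) : Prop :=
  ∃ (𝔥 : LieSubalgebra ℂ 𝔤₀) (_ : 𝔥.IsCartanSubalgebra) (ω : Module.Dual ℂ 𝔥 →ₗ[ℝ] ℝ),
    (∀ α : LieModule.Weight ℂ 𝔥 𝔤₀, α.IsNonZero → ω α.toLinear ≠ 0) ∧
    𝔟.toSubmodule = 𝔥.toSubmodule ⊔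
      ⨆ (α : LieModule.Weight ℂ 𝔥 𝔤₀) (_ : 0 < ω α.toLinear),
        (LieAlgebra.rootSpace 𝔥 α).toSubmodule

/-- A distinguished Borel subalgebra: one of the form `𝔟 ⊕ 𝔤₊₁`, with `𝔟` a Borel subalgebra of
the even part. -/
def TypeI.IsDistinguishedBorel [FiniteDimensional ℂ 𝔤₀] {G : LieSuperalgebra 𝔤₀ 𝔤₁} (T : G.TypeI)
    (B : G.Sub) : Prop :=
  IsBorel B.even ∧ B.odd = T.plus.toSubmodule

end TypeI

end LieSuperalgebra

end

/-! It is enough to find a smallest nonzero submodule `S` of the Verma supermodule, among all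
submodules, graded or not. The preimage of `S` under the parity involution is then a nonzero
submodule, so it contains `S`; hence `S` is graded (`isSubsupermodule_of_least`). It is simple by
minimality, and every simple sub-supermodule contains it and therefore equals it.

Reduction to the even part. By its universal property, the Verma supermodule is the Kac module
Λ(𝔤₋₁) ⊗ M, where M is the Verma module of 𝔤₀ with the same character (`Kac.exists_verma_equiv`).
Given a nonzero submodule N, multiplying a nonzero vector by elements of 𝔤₋₁ for as long as the
result is nonzero leads to a nonzero vector of N killed by 𝔤₋₁. Such a vector is t ⊗ m with t a top
form. On t ⊗ M the even part acts as on M, up to a scalar for each element, so {m | t ⊗ m ∈ N} is a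
nonzero 𝔤₀-submodule of M. If M has a smallest nonzero submodule, every N therefore contains the
same nonzero vectors (`Kac.exists_least_submodule`).

From reductive to semisimple. The quotient L of 𝔤₀ by its center is semisimple, and a Casimir
operator provides an equivariant splitting L → 𝔤₀. The Verma module of 𝔤₀ is that of L, with each
element of 𝔤₀ acting by an additional scalar (`exists_isVerma_of_section`).

The semisimple case (`Semisimple.exists_least_submodule`). The Verma module lives on U(𝔫⁻), and its
submodules are in particular left ideals there. Two facts are combined. (1) Two nonzero left ideals
of U(𝔫⁻) intersect nontrivially. For 𝔫⁻ solvable, U(𝔫⁻) is an iterated Ore extension, hence has no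
zero divisors and grows polynomially, whereas disjoint left ideals would make it grow exponentially
(`exists_ne_zero_mem_of_left_ideals`). (2) All nonzero submodules meet one fixed finite-dimensional
step F of the filtration. By Lie's theorem each contains a highest weight vector. The Casimir
element acts on the whole module by one scalar, which gives a quadratic equation for the weight;
positivity of the Killing form on the real span of the roots bounds the solutions, and with them the
length of the vector (`exists_filt_inf_ne_bot`). Choose a nonzero submodule N₀ with dim (N₀ ∩ F)
minimal. For every nonzero N the submodule N₀ ∩ N is nonzero by (1), so minimality gives N₀ ∩ F ⊆ N.
By (2) N₀ ∩ F is nonzero, so the intersection of all nonzero submodules is nonzero. -/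

noncomputable section
namespace UEnv

/-! ### The enveloping algebra of a Lie algebra and its standard filtration. -/

section Basic

attribute [local instance 100] LieRing.ofAssociativeRing

variable {K : Type*} [Field K] {n : Type*} [LieRing n] [LieAlgebra K n]

variable (K n) in
/-- The universal enveloping algebra of a Lie algebra. -/
abbrev U : Type _ := UniversalEnvelopingAlgebra K n

variable (K) in
/-- The canonical map of a Lie algebra to its enveloping algebra, as a linear map. -/
def emb : n →ₗ[K] U K n := (UniversalEnvelopingAlgebra.ι K : n →ₗ⁅K⁆ U K n)

theorem emb_lie (x y : n) : emb K ⁅x, y⁆ = emb K x * emb K y - emb K y * emb K x := by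
  change UniversalEnvelopingAlgebra.ι K ⁅x, y⁆ = _
  rw [LieHom.map_lie, LieRing.of_associative_ring_bracket]
  rfl

/-- The universal property of the enveloping algebra, for linear maps which send brackets to
commutators. -/
def lift {A : Type*} [Ring A] [Algebra K A] (f : n →ₗ[K] A)
    (hf : ∀ x y, f ⁅x, y⁆ = f x * f y - f y * f x) : U K n →ₐ[K] A :=
  UniversalEnvelopingAlgebra.lift K
    { f with map_lie' := fun {x y} => by
              simpa [LieRing.of_associative_ring_bracket] using hf x y }

@[simp]
theorem lift_emb {A : Type*} [Ring A] [Algebra K A] (f : n →ₗ[K] A)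
    (hf : ∀ x y, f ⁅x, y⁆ = f x * f y - f y * f x) (x : n) : lift f hf (emb K x) = f x :=
  UniversalEnvelopingAlgebra.lift_ι_apply K _ x

theorem algHom_ext {A : Type*} [Ring A] [Algebra K A] {f g : U K n →ₐ[K] A}
    (h : ∀ x, f (emb K x) = g (emb K x)) : f = g := by
  apply UniversalEnvelopingAlgebra.hom_ext
  ext x
  exact h x

/-- The universal property maps the enveloping algebra into the generated subalgebra; followed by
the inclusion, this map is the identity, since it is so on generators. -/
theorem adjoin_range_emb : Algebra.adjoin K (Set.range (emb K (n := n))) = ⊤ := by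
  set S := Algebra.adjoin K (Set.range (emb K (n := n)))
  let f : n →ₗ[K] S := (emb K).codRestrict S.toSubmodule
    (fun x => Algebra.subset_adjoin ⟨x, rfl⟩)
  let g : U K n →ₐ[K] S := lift f (fun x y => Subtype.ext (emb_lie x y))
  have h : S.val.comp g = AlgHom.id K _ := algHom_ext fun x => by
    change (g (emb K x) : U K n) = emb K x
    rw [lift_emb]; rfl
  rw [eq_top_iff]
  rintro u -
  have := DFunLike.congr_fun h u
  rw [AlgHom.id_apply] at this
  rw [← this]
  exact (g u).2

/-- Induction on the enveloping algebra by left multiplication with elements of the Lie algebra. -/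
theorem submodule_eq_top {S : Submodule K (U K n)} (h1 : 1 ∈ S)
    (hmul : ∀ x, ∀ u ∈ S, emb K x * u ∈ S) : S = ⊤ := by
  rw [eq_top_iff]
  rintro u -
  suffices h : ∀ w ∈ S, u * w ∈ S by simpa using h 1 h1
  have hu : u ∈ Algebra.adjoin K (Set.range (emb K (n := n))) := by
    rw [adjoin_range_emb]; trivial
  induction hu using Algebra.adjoin_induction with
  | mem x hx => obtain ⟨y, rfl⟩ := hx; exact hmul y
  | algebraMap r => intro w hw; rw [← Algebra.smul_def]; exact S.smul_mem r hw
  | add a b _ _ ha hb => intro w hw; rw [add_mul]; exact add_mem (ha w hw) (hb w hw)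
  | mul a b _ _ ha hb => intro w hw; rw [mul_assoc]; exact ha _ (hb w hw)

theorem induction_left {p : U K n → Prop} (h1 : p 1) (hadd : ∀ u w, p u → p w → p (u + w))
    (hsmul : ∀ (c : K) u, p u → p (c • u)) (hmul : ∀ x u, p u → p (emb K x * u)) (u : U K n) :
    p u := by
  let S : Submodule K (U K n) :=
    { carrier := {u | p u}
      add_mem' := fun ha hb => hadd _ _ ha hb
      zero_mem' := by simpa using hsmul 0 1 h1
      smul_mem' := fun c u hu => hsmul c u hu }
  have hS : S = ⊤ := submodule_eq_top h1 (fun x u hu => hmul x u hu)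
  have : u ∈ S := by rw [hS]; trivial
  exact this

/-- Two linear maps on the enveloping algebra agree if they agree at `1` and if agreement is
inherited by left multiples. -/
theorem linearMap_ext {M : Type*} [AddCommGroup M] [Module K M] {f g : U K n →ₗ[K] M}
    (h1 : f 1 = g 1) (hmul : ∀ x u, f u = g u → f (emb K x * u) = g (emb K x * u)) : f = g := by
  ext u
  induction u using induction_left with
  | h1 => exact h1
  | hadd u w hu hw => rw [map_add, map_add, hu, hw]
  | hsmul c u hu => rw [map_smul, map_smul, hu]
  | hmul x u hu => exact hmul x u hu

variable (K n) in
/-- The standard filtration of the enveloping algebra. -/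
def filt (k : ℕ) : Submodule K (U K n) := (1 ⊔ LinearMap.range (emb K (n := n))) ^ k

theorem filt_zero : filt K n 0 = 1 := pow_zero _

theorem one_mem_filt (k : ℕ) : (1 : U K n) ∈ filt K n k := by
  have h : (1 : Submodule K (U K n)) ≤ 1 ⊔ LinearMap.range (emb K (n := n)) := le_sup_left
  have := Submodule.pow_mem_pow (1 ⊔ LinearMap.range (emb K (n := n)))
    (h (Submodule.one_le.1 le_rfl)) k
  simpa [filt] using this

theorem filt_mul (k l : ℕ) : filt K n k * filt K n l = filt K n (k + l) := (pow_add _ _ _).symm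

theorem mul_mem_filt {k l : ℕ} {a b : U K n} (ha : a ∈ filt K n k) (hb : b ∈ filt K n l) :
    a * b ∈ filt K n (k + l) := filt_mul (K := K) (n := n) k l ▸ Submodule.mul_mem_mul ha hb

theorem filt_mono {k l : ℕ} (h : k ≤ l) : filt K n k ≤ filt K n l := by
  obtain ⟨j, rfl⟩ := Nat.exists_eq_add_of_le h
  intro a ha
  simpa using mul_mem_filt ha (one_mem_filt j)

theorem emb_mem_filt (x : n) : emb K x ∈ filt K n 1 := by
  rw [filt, pow_one]; exact Submodule.mem_sup_right ⟨x, rfl⟩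

theorem emb_mul_mem_filt (x : n) {k : ℕ} {u : U K n} (hu : u ∈ filt K n k) :
    emb K x * u ∈ filt K n (k + 1) := by
  rw [add_comm]; exact mul_mem_filt (emb_mem_filt x) hu

/-- Induction along the standard filtration. -/
theorem filt_le {P : ℕ → Submodule K (U K n)} (h1 : 1 ∈ P 0) (hmono : ∀ k, P k ≤ P (k + 1))
    (hmul : ∀ k x, ∀ u ∈ P k, emb K x * u ∈ P (k + 1)) (k : ℕ) : filt K n k ≤ P k := by
  induction k with
  | zero => rw [filt_zero, Submodule.one_le]; exact h1
  | succ k ih =>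
    rw [add_comm, ← filt_mul, Submodule.mul_le]
    intro a ha b hb
    rw [filt, pow_one] at ha
    obtain ⟨c, hc, _, ⟨x, rfl⟩, rfl⟩ := Submodule.mem_sup.1 ha
    obtain ⟨r, rfl⟩ := Submodule.mem_one.1 hc
    rw [add_mul, ← Algebra.smul_def, add_comm 1 k]
    exact add_mem (Submodule.smul_mem _ _ (hmono k (ih hb))) (hmul k x b (ih hb))

theorem exists_mem_filt (u : U K n) : ∃ k, u ∈ filt K n k := by
  induction u using induction_left with
  | h1 => exact ⟨0, one_mem_filt 0⟩
  | hadd u w hu hw =>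
    obtain ⟨k, hk⟩ := hu
    obtain ⟨l, hl⟩ := hw
    exact ⟨max k l, add_mem (filt_mono (le_max_left _ _) hk) (filt_mono (le_max_right _ _) hl)⟩
  | hsmul c u hu =>
    obtain ⟨k, hk⟩ := hu
    exact ⟨k, Submodule.smul_mem _ c hk⟩
  | hmul x u hu =>
    obtain ⟨k, hk⟩ := hu
    exact ⟨k + 1, emb_mul_mem_filt x hk⟩

instance [FiniteDimensional K n] (k : ℕ) : FiniteDimensional K (filt K n k) := by
  refine Module.Finite.iff_fg.2 (Submodule.FG.pow (Submodule.FG.sup ?_ ?_) k)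
  · rw [Submodule.one_eq_span]; exact Submodule.fg_span_singleton 1
  · exact Module.Finite.iff_fg.1 inferInstance

end Basic

/-! ### The module induced from a character of 𝔟, realized on U(𝔫) when 𝔤 = 𝔫 ⊕ 𝔟. -/

section Induced

variable {K : Type*} [Field K] {g : Type*} [LieRing g] [LieAlgebra K g]
  {n b : LieSubalgebra K g}

/-- The action of `n` on `Hom(g, U(n))`. -/
def homAction (n : LieSubalgebra K g) : n →ₗ[K] Module.End K (g →ₗ[K] U K n) :=
  LinearMap.mk₂ K
    (fun y f => (LinearMap.mulLeft K (emb K y)) ∘ₗ f - f ∘ₗ (LieAlgebra.ad K g y : g →ₗ[K] g))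
    (fun y y' f => by ext x; simp [add_mul]; abel)
    (fun c y f => by ext x; simp [smul_sub])
    (fun y f f' => by ext x; simp [mul_add]; abel)
    (fun c y f => by ext x; simp [smul_sub])

theorem homAction_apply (y : n) (f : g →ₗ[K] U K n) (x : g) :
    homAction n y f x = emb K y * f x + f ⁅x, (y : g)⁆ := by
  simp only [homAction, LinearMap.mk₂_apply, LinearMap.sub_apply, LinearMap.comp_apply,
    LinearMap.mulLeft_apply, LieAlgebra.ad_apply]
  rw [← lie_skew x, map_neg, sub_eq_add_neg]

/-- `homAction` combines left multiplication on the values with the adjoint action on the argument,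
two commuting actions. The resulting representation of U(𝔫) realizes the recursion x·(yu) = y(x·u) +
[x, y]·u for all x at once, which makes the operators x· well defined on U(𝔫). -/
theorem homAction_lie (y z : n) :
    homAction n ⁅y, z⁆ = homAction n y * homAction n z - homAction n z * homAction n y := by
  ext f x
  simp only [Module.End.mul_apply, LinearMap.sub_apply, homAction_apply, emb_lie,
    sub_mul, mul_add, mul_assoc]
  have h : ⁅x, ⁅(y : g), (z : g)⁆⁆ = ⁅⁅x, (y : g)⁆, (z : g)⁆ - ⁅⁅x, (z : g)⁆, (y : g)⁆ := by
    rw [leibniz_lie, sub_eq_add_neg, lie_skew]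
  rw [LieSubalgebra.coe_bracket, h, map_sub]
  abel

/-- The representation of `U(n)` on `Hom(g, U(n))`. -/
def homRep (n : LieSubalgebra K g) : U K n →ₐ[K] Module.End K (g →ₗ[K] U K n) :=
  lift (A := Module.End K (g →ₗ[K] U K n)) (homAction n) (homAction_lie (n := n))

@[simp]
theorem homRep_emb (y : n) : homRep n (emb K y) = homAction n y := lift_emb _ _ y

/-- The action of `g` on `U(n)` determined by its values `s` at `1`. -/
def act (s : g →ₗ[K] U K n) : g →ₗ[K] Module.End K (U K n) :=
  LinearMap.flip ((LinearMap.applyₗ s).comp (homRep n).toLinearMap)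

theorem act_apply (s : g →ₗ[K] U K n) (x : g) (u : U K n) :
    act s x u = homRep n u s x := rfl

@[simp]
theorem act_one (s : g →ₗ[K] U K n) (x : g) : act s x 1 = s x := by simp [act_apply]

theorem act_emb_mul (s : g →ₗ[K] U K n) (x : g) (y : n) (u : U K n) :
    act s x (emb K y * u) = emb K y * act s x u + act s ⁅x, (y : g)⁆ u := by
  simp only [act_apply, map_mul, homRep_emb, Module.End.mul_apply, homAction_apply]

theorem act_coe (s : g →ₗ[K] U K n) (hs : ∀ y : n, s y = emb K y) (y : n) (u : U K n) :
    act s y u = emb K y * u := by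
  induction u using induction_left generalizing y with
  | h1 => rw [act_one, hs, mul_one]
  | hadd u w hu hw => rw [map_add, hu, hw, mul_add]
  | hsmul c u hu => rw [map_smul, hu, mul_smul_comm]
  | hmul x u hu =>
    rw [act_emb_mul, hu, ← LieSubalgebra.coe_bracket, hu, emb_lie, sub_mul, mul_assoc, mul_assoc]
    abel

/-- If one of the two elements lies in 𝔫, the identity is the recursion itself. At `1` this leaves
two elements of 𝔟, which act there by commuting scalars while their bracket acts by zero. The Jacobi
identity passes from `u` to `y u`; for this the induction must quantify over both elements. -/
theorem act_lie {s : g →ₗ[K] U K n} (hs : ∀ y : n, s y = emb K y) {b : LieSubalgebra K g}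
    (hc : Codisjoint n.toSubmodule b.toSubmodule) {l : b →ₗ[K] K}
    (hl : ∀ x y : b, l ⁅x, y⁆ = 0) (hb : ∀ x : b, s x = algebraMap K _ (l x)) (x x' : g)
    (u : U K n) : act s ⁅x, x'⁆ u = act s x (act s x' u) - act s x' (act s x u) := by
  have hn : ∀ (y : n) (x : g) (u : U K n),
      act s ⁅x, (y : g)⁆ u = act s x (act s y u) - act s y (act s x u) := fun y x u => by
    rw [act_coe s hs, act_coe s hs, act_emb_mul, add_sub_cancel_left]
  have hsplit : ∀ x : g, ∃ (y : n) (z : b), x = y + z := fun x => by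
    have hx : x ∈ n.toSubmodule ⊔ b.toSubmodule := by rw [hc.eq_top]; trivial
    obtain ⟨y, hy, z, hz, rfl⟩ := Submodule.mem_sup.1 hx
    exact ⟨⟨y, hy⟩, ⟨z, hz⟩, rfl⟩
  induction u using induction_left generalizing x x' with
  | h1 =>
    obtain ⟨y, z, rfl⟩ := hsplit x
    obtain ⟨y', z', rfl⟩ := hsplit x'
    have hbb : act s ⁅(z : g), (z' : g)⁆ 1 =
        act s z (act s z' 1) - act s z' (act s z 1) := by
      have h1 : act s ⁅(z : g), (z' : g)⁆ 1 = 0 := by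
        rw [act_one, ← LieSubalgebra.coe_bracket, hb, hl, map_zero]
      simp only [h1, act_one, hb, Algebra.algebraMap_eq_smul_one, map_smul]
      rw [smul_comm, sub_self]
    have h1 := hn y' y 1
    have h2 := hn y' z 1
    have h3 := hn y z' 1
    simp only [lie_add, add_lie, map_add, LinearMap.add_apply]
    rw [← lie_skew (y : g) (z' : g), map_neg, LinearMap.neg_apply, h1, h2, h3, hbb]
    abel
  | hadd u w hu hw => simp only [map_add, hu, hw]; abel
  | hsmul c u hu => simp only [map_smul, hu, smul_sub]
  | hmul y u hu =>
    simp only [act_emb_mul, map_add]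
    rw [lie_lie, map_sub, LinearMap.sub_apply, hu x x', hu x ⁅x', (y : g)⁆, hu x' ⁅x, (y : g)⁆,
      mul_sub]
    abel

/-- The functional of the induced module: `emb` on `n` and `l` on `b`. -/
def seed (hc : IsCompl n.toSubmodule b.toSubmodule) (l : b →ₗ[K] K) : g →ₗ[K] U K n :=
  LinearMap.ofIsCompl hc (emb K (n := n)) ((Algebra.linearMap K (U K n)) ∘ₗ l)

theorem seed_left (hc : IsCompl n.toSubmodule b.toSubmodule) (l : b →ₗ[K] K) (y : n) :
    seed hc l y = emb K y := LinearMap.ofIsCompl_apply_left hc y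

theorem seed_right (hc : IsCompl n.toSubmodule b.toSubmodule) (l : b →ₗ[K] K) (x : b) :
    seed hc l x = algebraMap K _ (l x) := LinearMap.ofIsCompl_apply_right hc x

theorem act_mem_filt {s : g →ₗ[K] U K n} (hs : ∀ y : n, s y = emb K y) {b : LieSubalgebra K g}
    (hc : Codisjoint n.toSubmodule b.toSubmodule) {l : b →ₗ[K] K}
    (hb : ∀ x : b, s x = algebraMap K _ (l x)) (x : b) {k : ℕ} {u : U K n}
    (hu : u ∈ filt K n k) : act s x u ∈ filt K n k := by
  -- The induction treats all of 𝔟 simultaneously, because the 𝔟-component of `[x, y]` is another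
  -- element of 𝔟.
  suffices h : filt K n k ≤ ⨅ x : b, (filt K n k).comap (act s x) by
    have := h hu
    rw [Submodule.mem_iInf] at this
    exact this x
  refine (filt_le (P := fun k => filt K n k ⊓ ⨅ x : b, (filt K n k).comap (act s x))
    ?_ ?_ ?_ k).trans inf_le_right
  · refine ⟨one_mem_filt 0, ?_⟩
    simp only [SetLike.mem_coe, Submodule.mem_iInf, Submodule.mem_comap]
    intro x
    rw [act_one, hb, Algebra.algebraMap_eq_smul_one]
    exact Submodule.smul_mem _ _ (one_mem_filt 0)
  · intro k
    refine inf_le_inf (filt_mono k.le_succ) (iInf_mono fun x => Submodule.comap_mono ?_)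
    exact filt_mono k.le_succ
  · rintro k y u ⟨hu, hu'⟩
    simp only [SetLike.mem_coe, Submodule.mem_iInf, Submodule.mem_comap] at hu'
    refine ⟨emb_mul_mem_filt y hu, ?_⟩
    simp only [SetLike.mem_coe, Submodule.mem_iInf, Submodule.mem_comap]
    intro x
    rw [act_emb_mul]
    refine add_mem (emb_mul_mem_filt y (hu' x)) ?_
    have hx : ⁅(x : g), (y : g)⁆ ∈ n.toSubmodule ⊔ b.toSubmodule := by rw [hc.eq_top]; trivial
    obtain ⟨y', hy', z, hz, h⟩ := Submodule.mem_sup.1 hx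
    rw [← h, map_add, LinearMap.add_apply, act_coe s hs ⟨y', hy'⟩]
    exact add_mem (emb_mul_mem_filt _ hu) (filt_mono k.le_succ (hu' ⟨z, hz⟩))

end Induced
end UEnv

end

noncomputable section
namespace UEnv

/-! ### U(𝔫) as an Ore extension of the enveloping algebra of the kernel of a character. -/

section OreExtension

variable {K : Type*} [Field K] {n : Type*} [LieRing n] [LieAlgebra K n]

/-- The kernel of a character, as a subalgebra. -/
def kerSubalgebra (φ : n →ₗ[K] K) (hφ : ∀ x z : n, φ ⁅x, z⁆ = 0) : LieSubalgebra K n :=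
  { LinearMap.ker φ with lie_mem' := fun {x y} _ _ => hφ x y }

variable {φ : n →ₗ[K] K} {hφ : ∀ x z : n, φ ⁅x, z⁆ = 0} {y : n} (hy : φ y = 1)

theorem mem_kerSubalgebra {x : n} : x ∈ kerSubalgebra φ hφ ↔ φ x = 0 := Iff.rfl

/-- The projection to the kernel of `φ` along `y`. -/
def projKer (hφ : ∀ x z : n, φ ⁅x, z⁆ = 0) (hy : φ y = 1) : n →ₗ[K] kerSubalgebra φ hφ :=
  LinearMap.codRestrict (kerSubalgebra φ hφ).toSubmodule (LinearMap.id - φ.smulRight y)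
    (fun x => by
      change φ _ = 0
      simp [hy])

theorem coe_projKer (x : n) : (projKer hφ hy x : n) = x - φ x • y := rfl

theorem projKer_coe (z : kerSubalgebra φ hφ) : projKer hφ hy z = z :=
  Subtype.ext (by rw [coe_projKer, mem_kerSubalgebra.1 z.2, zero_smul, sub_zero])

theorem projKer_self : projKer hφ hy y = 0 :=
  Subtype.ext (by rw [coe_projKer, hy, one_smul, sub_self]; rfl)

/-- The bracket with `y`, as a map of the kernel of `φ` to itself. -/
def bracketKer (hφ : ∀ x z : n, φ ⁅x, z⁆ = 0) (y : n) (z : kerSubalgebra φ hφ) :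
    kerSubalgebra φ hφ := ⟨⁅y, (z : n)⁆, hφ _ _⟩

theorem coe_bracketKer (z : kerSubalgebra φ hφ) : (bracketKer hφ y z : n) = ⁅y, (z : n)⁆ := rfl

/-- The derivation `[y, ·]` of the enveloping algebra of `ker φ`. -/
def der (hφ : ∀ x z : n, φ ⁅x, z⁆ = 0) (hy : φ y = 1) :
    Module.End K (U K (kerSubalgebra φ hφ)) :=
  act (emb K ∘ₗ projKer hφ hy) y

theorem der_one : der hφ hy 1 = 0 := by
  rw [der, act_one, LinearMap.comp_apply, projKer_self, map_zero]

/-- This is the recursion of the induced module for 𝔫 = ker φ ⊕ K y, with trivial character on the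
line of `y`; since [y, z] lies in ker φ, it acts by left multiplication. -/
theorem der_emb_mul (z : kerSubalgebra φ hφ) (u : U K (kerSubalgebra φ hφ)) :
    der hφ hy (emb K z * u) =
      emb K z * der hφ hy u + emb K (bracketKer hφ y z) * u := by
  rw [der, act_emb_mul]
  congr 1
  exact act_coe (emb K ∘ₗ projKer hφ hy)
    (fun w => by rw [LinearMap.comp_apply, projKer_coe]) (bracketKer hφ y z) u

theorem der_mem_filt {k : ℕ} {u : U K (kerSubalgebra φ hφ)} (hu : u ∈ filt K _ k) :
    der hφ hy u ∈ filt K _ k := by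
  refine (filt_le (P := fun k => filt K _ k ⊓ (filt K _ k).comap (der hφ hy)) ?_ ?_ ?_ k hu).2
  · exact ⟨one_mem_filt 0, by simp [der_one]⟩
  · exact fun k => inf_le_inf (filt_mono k.le_succ) (Submodule.comap_mono (filt_mono k.le_succ))
  · rintro k z u ⟨hu, hu'⟩
    refine ⟨emb_mul_mem_filt z hu, ?_⟩
    rw [SetLike.mem_coe, Submodule.mem_comap, der_emb_mul]
    exact add_mem (emb_mul_mem_filt _ hu') (emb_mul_mem_filt _ hu)

/-- Coefficientwise left multiplication on polynomials over `U(ker φ)`. -/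
def coeffMul (a : U K (kerSubalgebra φ hφ)) : Module.End K (ℕ →₀ U K (kerSubalgebra φ hφ)) :=
  Finsupp.mapRange.linearMap (LinearMap.mulLeft K a)

/-- The action of `y` on polynomials over `U(ker φ)`. -/
def shiftDer (hφ : ∀ x z : n, φ ⁅x, z⁆ = 0) (hy : φ y = 1) :
    Module.End K (ℕ →₀ U K (kerSubalgebra φ hφ)) :=
  Finsupp.lmapDomain _ K Nat.succ + Finsupp.mapRange.linearMap (der hφ hy)

@[simp]
theorem coeffMul_apply (a : U K (kerSubalgebra φ hφ)) (f : ℕ →₀ U K (kerSubalgebra φ hφ))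
    (i : ℕ) : coeffMul a f i = a * f i := by simp [coeffMul]

@[simp]
theorem coeffMul_single (a b : U K (kerSubalgebra φ hφ)) (i : ℕ) :
    coeffMul a (Finsupp.single i b) = Finsupp.single i (a * b) := by simp [coeffMul]

@[simp]
theorem shiftDer_single (b : U K (kerSubalgebra φ hφ)) (i : ℕ) :
    shiftDer hφ hy (Finsupp.single i b) =
      Finsupp.single (i + 1) b + Finsupp.single i (der hφ hy b) := by simp [shiftDer]

theorem shiftDer_apply_zero (f : ℕ →₀ U K (kerSubalgebra φ hφ)) :
    shiftDer hφ hy f 0 = der hφ hy (f 0) := by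
  have h : Finsupp.mapDomain Nat.succ f 0 = 0 := Finsupp.mapDomain_of_notMem_range f 0 (by simp)
  simp [shiftDer, h]

theorem shiftDer_apply_succ (f : ℕ →₀ U K (kerSubalgebra φ hφ)) (i : ℕ) :
    shiftDer hφ hy f (i + 1) = f i + der hφ hy (f (i + 1)) := by
  have h : Finsupp.mapDomain Nat.succ f (i + 1) = f i :=
    Finsupp.mapDomain_apply Nat.succ_injective f i
  simp [shiftDer, h]

/-- The action of `n` on polynomials over `U(ker φ)`. -/
def polyAction (hφ : ∀ x z : n, φ ⁅x, z⁆ = 0) (hy : φ y = 1) :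
    n →ₗ[K] Module.End K (ℕ →₀ U K (kerSubalgebra φ hφ)) where
  toFun x := coeffMul (emb K (projKer hφ hy x)) + φ x • shiftDer hφ hy
  map_add' x x' := by ext i a : 2; simp [add_mul, add_smul]; abel
  map_smul' c x := by ext i a : 2; simp [-Finsupp.single_mul, mul_smul]

theorem shiftDer_coeffMul (z : kerSubalgebra φ hφ) :
    shiftDer hφ hy * coeffMul (emb K z) = coeffMul (emb K z) * shiftDer hφ hy +
      coeffMul (emb K (bracketKer hφ y z)) := by
  ext i a : 2
  simp [-Finsupp.single_mul, der_emb_mul, Finsupp.single_add, add_assoc]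

theorem coeffMul_mul (a b : U K (kerSubalgebra φ hφ)) :
    coeffMul (a * b) = coeffMul a * coeffMul b := by
  ext i c : 2
  simp [-Finsupp.single_mul, mul_assoc]

theorem coeffMul_sub (a b : U K (kerSubalgebra φ hφ)) :
    coeffMul (a - b) = coeffMul a - coeffMul b := by
  ext i c : 2
  simp [sub_mul]

theorem coeffMul_add (a b : U K (kerSubalgebra φ hφ)) :
    coeffMul (a + b) = coeffMul a + coeffMul b := by
  ext i c : 2
  simp [add_mul]

theorem coeffMul_smul (c : K) (a : U K (kerSubalgebra φ hφ)) :
    coeffMul (c • a) = c • coeffMul a := by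
  ext i c : 2
  simp [-Finsupp.single_mul]

theorem coeffMul_one : coeffMul (1 : U K (kerSubalgebra φ hφ)) = 1 := by
  ext i c : 2
  simp [-Finsupp.single_mul]

/-- Polynomials Σ aᵢ yⁱ carry their coefficients on the left, and `y` acts by a yⁱ ↦ a yⁱ⁺¹ + [y, a]
yⁱ. The only commutator to check is that of `y` with a coefficient, which is `shiftDer_coeffMul`. -/
theorem polyAction_lie (x x' : n) : polyAction hφ hy ⁅x, x'⁆ =
    polyAction hφ hy x * polyAction hφ hy x' - polyAction hφ hy x' * polyAction hφ hy x := by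
  have h : projKer hφ hy ⁅x, x'⁆ = ⁅projKer hφ hy x, projKer hφ hy x'⁆ +
      φ x • bracketKer hφ y (projKer hφ hy x') -
      φ x' • bracketKer hφ y (projKer hφ hy x) := by
    apply Subtype.ext
    change ⁅x, x'⁆ - φ ⁅x, x'⁆ • y = ⁅x - φ x • y, x' - φ x' • y⁆ + φ x • ⁅y, x' - φ x' • y⁆ -
      φ x' • ⁅y, x - φ x • y⁆
    simp only [hφ, sub_lie, lie_sub, lie_smul, smul_lie, lie_self]
    rw [← lie_skew x y]
    module
  change coeffMul (emb K (projKer hφ hy ⁅x, x'⁆)) + φ ⁅x, x'⁆ • shiftDer hφ hy =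
    (coeffMul (emb K (projKer hφ hy x)) + φ x • shiftDer hφ hy) *
    (coeffMul (emb K (projKer hφ hy x')) + φ x' • shiftDer hφ hy) -
    (coeffMul (emb K (projKer hφ hy x')) + φ x' • shiftDer hφ hy) *
    (coeffMul (emb K (projKer hφ hy x)) + φ x • shiftDer hφ hy)
  rw [h, hφ, zero_smul, add_zero, map_sub, map_add, emb_lie, map_smul, map_smul, coeffMul_sub,
    coeffMul_add, coeffMul_sub, coeffMul_mul, coeffMul_mul, coeffMul_smul, coeffMul_smul]
  simp only [add_mul, mul_add, smul_mul_assoc, mul_smul_comm, shiftDer_coeffMul]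
  module

/-- The representation of `U(n)` on polynomials over `U(ker φ)`. -/
def polyRep (hφ : ∀ x z : n, φ ⁅x, z⁆ = 0) (hy : φ y = 1) :
    U K n →ₐ[K] Module.End K (ℕ →₀ U K (kerSubalgebra φ hφ)) :=
  lift (A := Module.End K (ℕ →₀ U K (kerSubalgebra φ hφ))) (polyAction hφ hy)
    (polyAction_lie hy)

theorem polyRep_emb (x : n) : polyRep hφ hy (emb K x) =
    coeffMul (emb K (projKer hφ hy x)) + φ x • shiftDer hφ hy := lift_emb _ _ x

/-- The map `U(ker φ) → U(n)`. -/
def inclKer (hφ : ∀ x z : n, φ ⁅x, z⁆ = 0) : U K (kerSubalgebra φ hφ) →ₐ[K] U K n :=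
  lift (emb K ∘ₗ (kerSubalgebra φ hφ).toSubmodule.subtype) (fun x y => emb_lie (x : n) (y : n))

theorem inclKer_emb (z : kerSubalgebra φ hφ) : inclKer hφ (emb K z) = emb K (z : n) :=
  lift_emb _ _ z

theorem polyRep_inclKer (a : U K (kerSubalgebra φ hφ)) :
    polyRep hφ hy (inclKer hφ a) = coeffMul a := by
  induction a using induction_left with
  | h1 => rw [map_one, map_one, coeffMul_one]
  | hadd u w hu hw => rw [map_add, map_add, hu, hw, coeffMul_add]
  | hsmul c u hu => rw [map_smul, map_smul, hu, coeffMul_smul]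
  | hmul z u hu =>
    rw [map_mul, map_mul, hu, inclKer_emb, polyRep_emb, projKer_coe, mem_kerSubalgebra.1 z.2,
      zero_smul, add_zero, coeffMul_mul]

/-- Evaluation of polynomials over `U(ker φ)` at `y`. -/
def evalPoly (y : n) : (ℕ →₀ U K (kerSubalgebra φ hφ)) →ₗ[K] U K n :=
  Finsupp.lsum K fun i => LinearMap.mulRight K (emb K y ^ i) ∘ₗ (inclKer hφ).toLinearMap

@[simp]
theorem evalPoly_single (i : ℕ) (a : U K (kerSubalgebra φ hφ)) :
    evalPoly y (Finsupp.single i a) = inclKer hφ a * emb K y ^ i := by simp [evalPoly]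

theorem inclKer_der (a : U K (kerSubalgebra φ hφ)) : inclKer hφ (der hφ hy a) =
    emb K y * inclKer hφ a - inclKer hφ a * emb K y := by
  induction a using induction_left with
  | h1 => simp [der_one]
  | hadd u w hu hw => simp only [map_add, hu, hw, mul_add, add_mul]; abel
  | hsmul c u hu => simp only [map_smul, hu, mul_smul_comm, smul_mul_assoc, smul_sub]
  | hmul z u hu =>
    simp only [der_emb_mul, map_add, map_mul, hu, inclKer_emb, coe_bracketKer, emb_lie, mul_sub, sub_mul,
      mul_assoc]
    abel

theorem evalPoly_polyRep_emb (x : n) (f : ℕ →₀ U K (kerSubalgebra φ hφ)) :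
    evalPoly y (polyRep hφ hy (emb K x) f) = emb K x * evalPoly y f := by
  induction f using Finsupp.induction_linear with
  | zero => simp
  | add f g hf hg => rw [map_add, map_add, map_add, hf, hg, mul_add]
  | single i a =>
    have hx : emb K x = emb K (projKer hφ hy x : n) + φ x • emb K y := by
      rw [coe_projKer, map_sub, map_smul, sub_add_cancel]
    rw [polyRep_emb, LinearMap.add_apply, LinearMap.smul_apply, coeffMul_single, shiftDer_single,
      map_add, map_smul, map_add, evalPoly_single, evalPoly_single, evalPoly_single,
      evalPoly_single, map_mul, inclKer_emb, inclKer_der, hx, add_mul, pow_succ', smul_mul_assoc,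
      sub_mul, mul_assoc, mul_assoc, mul_assoc, add_sub_cancel]

theorem evalPoly_polyRep (u : U K n) (f : ℕ →₀ U K (kerSubalgebra φ hφ)) :
    evalPoly y (polyRep hφ hy u f) = u * evalPoly y f := by
  induction u using induction_left with
  | h1 => simp
  | hadd u w hu hw => simp only [map_add, LinearMap.add_apply, hu, hw, add_mul]
  | hsmul c u hu => simp only [map_smul, LinearMap.smul_apply, hu, smul_mul_assoc]
  | hmul x u hu => rw [map_mul, Module.End.mul_apply, evalPoly_polyRep_emb, hu, mul_assoc]

/-- The expansion of an element of `U(n)` in powers of `y`. -/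
def expand (hφ : ∀ x z : n, φ ⁅x, z⁆ = 0) (hy : φ y = 1) :
    U K n →ₗ[K] (ℕ →₀ U K (kerSubalgebra φ hφ)) :=
  (LinearMap.applyₗ (Finsupp.single 0 1)).comp (polyRep hφ hy).toLinearMap

theorem expand_apply (u : U K n) : expand hφ hy u = polyRep hφ hy u (Finsupp.single 0 1) := rfl

theorem evalPoly_expand (u : U K n) : evalPoly y (expand hφ hy u) = u := by
  rw [expand_apply, evalPoly_polyRep]
  simp

/-- Evaluation at `y` recovers an element from its expansion. Questions about U(𝔫) thus become
questions about coefficients in U(ker φ). -/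
theorem expand_injective : Function.Injective (expand hφ hy) :=
  Function.LeftInverse.injective (evalPoly_expand hy)

theorem expand_mul (u w : U K n) : expand hφ hy (u * w) = polyRep hφ hy u (expand hφ hy w) := by
  rw [expand_apply, expand_apply, map_mul, Module.End.mul_apply]

/-- Multiplication by `y` raises the degree by one and keeps the leading coefficient, since the
derivation does not raise the degree. -/
theorem shiftDer_pow_apply {q : ℕ →₀ U K (kerSubalgebra φ hφ)} {e : ℕ}
    (he : ∀ j, e < j → q j = 0) (i : ℕ) :
    ((shiftDer hφ hy) ^ i) q (e + i) = q e ∧ ∀ j, e + i < j → ((shiftDer hφ hy) ^ i) q j = 0 := by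
  induction i with
  | zero => exact ⟨rfl, he⟩
  | succ i ih =>
    rw [pow_succ', Module.End.mul_apply]
    constructor
    · rw [← add_assoc, shiftDer_apply_succ, ih.1, ih.2 _ (Nat.lt_succ_self _), map_zero, add_zero]
    · intro j hj
      obtain ⟨j, rfl⟩ : ∃ k, j = k + 1 := ⟨j - 1, by omega⟩
      rw [shiftDer_apply_succ, ih.2 j (by omega), ih.2 (j + 1) (by omega), map_zero, add_zero]

theorem exists_leading {R : Type*} [Zero R] {q : ℕ →₀ R} (hq : q ≠ 0) :
    ∃ e, q e ≠ 0 ∧ ∀ j, e < j → q j = 0 := by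
  have hs : q.support.Nonempty := Finsupp.support_nonempty_iff.2 hq
  refine ⟨q.support.max' hs, Finsupp.mem_support_iff.1 (q.support.max'_mem hs), fun j hj => ?_⟩
  by_contra h
  exact absurd (q.support.le_max' j (Finsupp.mem_support_iff.2 h)) (not_le.2 hj)

theorem polyRep_apply (u : U K n) (q : ℕ →₀ U K (kerSubalgebra φ hφ)) :
    polyRep hφ hy u q = (expand hφ hy u).sum fun i a => coeffMul a (((shiftDer hφ hy) ^ i) q) := by
  have hy' : polyRep hφ hy (emb K y) = shiftDer hφ hy := by
    rw [polyRep_emb, projKer_self, map_zero, hy, one_smul]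
    ext i a : 2
    simp
  conv_lhs => rw [← evalPoly_expand (hφ := hφ) hy u]
  rw [evalPoly, Finsupp.lsum_apply, Finsupp.sum, map_sum, LinearMap.sum_apply, Finsupp.sum]
  refine Finset.sum_congr rfl fun i _ => ?_
  simp [polyRep_inclKer, hy']

/-- The leading coefficient of a product is the product of the leading coefficients, which lie in
U(ker φ). -/
theorem noZeroDivisors_of_ker (hy : φ y = 1) (h : NoZeroDivisors (U K (kerSubalgebra φ hφ))) :
    NoZeroDivisors (U K n) where
  eq_zero_or_eq_zero_of_mul_eq_zero := by
    intro u w huw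
    by_contra! hne
    have hu : expand hφ hy u ≠ 0 := fun h => hne.1 (expand_injective hy (by rw [h, map_zero]))
    have hw : expand hφ hy w ≠ 0 := fun h => hne.2 (expand_injective hy (by rw [h, map_zero]))
    obtain ⟨d, hd, hd'⟩ := exists_leading hu
    obtain ⟨e, he, he'⟩ := exists_leading hw
    have h0 := expand_mul (hφ := hφ) hy u w
    rw [huw, map_zero, polyRep_apply, Finsupp.sum] at h0
    have h1 := DFunLike.congr_fun h0 (e + d)
    rw [Finsupp.finsetSum_apply, Finset.sum_eq_single d] at h1
    · rw [coeffMul_apply, (shiftDer_pow_apply hy he' d).1, Finsupp.zero_apply] at h1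
      exact (mul_ne_zero hd he) h1.symm
    · intro i hi hid
      rw [coeffMul_apply]
      rcases lt_or_gt_of_ne hid with hlt | hgt
      · rw [(shiftDer_pow_apply hy he' i).2 _ (by omega), mul_zero]
      · rw [hd' i hgt, zero_mul]
    · intro hd0
      rw [coeffMul_apply, Finsupp.notMem_support_iff.1 hd0, zero_mul]

theorem expand_mem {k : ℕ} {u : U K n} (hu : u ∈ filt K n k) :
    (∀ i, expand hφ hy u i ∈ filt K (kerSubalgebra φ hφ) k) ∧ ∀ i, k < i → expand hφ hy u i = 0 := by
  let D : ℕ → Submodule K (ℕ →₀ U K (kerSubalgebra φ hφ)) := fun k =>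
    { carrier := {f | (∀ i, f i ∈ filt K (kerSubalgebra φ hφ) k) ∧ ∀ i, k < i → f i = 0}
      add_mem' := fun ha hb => ⟨fun i => add_mem (ha.1 i) (hb.1 i), fun i hi => by
        rw [Finsupp.add_apply, ha.2 i hi, hb.2 i hi, add_zero]⟩
      zero_mem' := ⟨fun i => zero_mem _, fun i _ => rfl⟩
      smul_mem' := fun c f hf => ⟨fun i => Submodule.smul_mem _ c (hf.1 i), fun i hi => by
        rw [Finsupp.smul_apply, hf.2 i hi, smul_zero]⟩ }
  have hmono : ∀ k, D k ≤ D (k + 1) := fun k f hf =>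
    ⟨fun i => filt_mono k.le_succ (hf.1 i), fun i hi => hf.2 i (by omega)⟩
  refine filt_le (P := fun k => (D k).comap (expand hφ hy)) ?_ ?_ ?_ k hu
  · refine ⟨fun i => ?_, fun i hi => ?_⟩
    · rw [expand_apply, map_one, Module.End.one_apply, Finsupp.single_apply]
      split_ifs
      · exact one_mem_filt 0
      · exact zero_mem _
    · rw [expand_apply, map_one, Module.End.one_apply, Finsupp.single_apply, if_neg (by omega)]
  · exact fun k => Submodule.comap_mono (hmono k)
  · intro k x u hu
    rw [Submodule.mem_comap, expand_mul, polyRep_emb, LinearMap.add_apply, LinearMap.smul_apply]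
    refine add_mem ⟨fun i => ?_, fun i hi => ?_⟩ (Submodule.smul_mem _ _ ⟨fun i => ?_, fun i hi => ?_⟩)
    · rw [coeffMul_apply]; exact emb_mul_mem_filt _ (hu.1 i)
    · rw [coeffMul_apply, hu.2 i (by omega), mul_zero]
    · cases i with
      | zero => rw [shiftDer_apply_zero]; exact filt_mono k.le_succ (der_mem_filt hy (hu.1 0))
      | succ i =>
        rw [shiftDer_apply_succ]
        exact filt_mono k.le_succ (add_mem (hu.1 i) (der_mem_filt hy (hu.1 (i + 1))))
    · obtain ⟨i, rfl⟩ : ∃ j, i = j + 1 := ⟨i - 1, by omega⟩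
      rw [shiftDer_apply_succ, hu.2 i (by omega), hu.2 (i + 1) (by omega), map_zero, add_zero]

/-- By `expand_mem`, an element of filtration degree `k` expands into `k + 1` coefficients, each of
filtration degree `k`. -/
theorem finrank_filt_le_of_ker [FiniteDimensional K n] (hy : φ y = 1) (k : ℕ) :
    Module.finrank K (filt K n k) ≤
      (k + 1) * Module.finrank K (filt K (kerSubalgebra φ hφ) k) := by
  let f : filt K n k →ₗ[K] (Fin (k + 1) → filt K (kerSubalgebra φ hφ) k) :=
    LinearMap.pi fun i => LinearMap.codRestrict _
      ((Finsupp.lapply (i : ℕ)).comp ((expand hφ hy).comp (filt K n k).subtype))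
      (fun u => (expand_mem hy u.2).1 i)
  have hf : Function.Injective f := by
    intro u w huw
    apply Subtype.ext
    apply expand_injective hy
    ext i
    by_cases hi : i < k + 1
    · exact congrArg Subtype.val (congrFun huw ⟨i, hi⟩)
    · rw [(expand_mem hy u.2).2 i (by omega), (expand_mem hy w.2).2 i (by omega)]
  have := LinearMap.finrank_le_finrank_of_injective hf
  rwa [Module.finrank_pi_fintype, Finset.sum_const, Finset.card_univ, Fintype.card_fin,
    smul_eq_mul] at this

end OreExtension

/-! ### Domains, polynomial growth and the Ore condition for solvable Lie algebras. -/

section Solvable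

variable {K : Type*} [Field K]

/-- A nonzero solvable Lie algebra differs from its derived algebra, so some nonzero functional
vanishes on all brackets. -/
theorem exists_character {n : Type*} [LieRing n] [LieAlgebra K n] [LieAlgebra.IsSolvable n]
    [Nontrivial n] : ∃ φ : n →ₗ[K] K, (∀ x z : n, φ ⁅x, z⁆ = 0) ∧ ∃ y, φ y = 1 := by
  have h := LieAlgebra.derivedSeries_lt_top_of_solvable K n
  have h' : (LieAlgebra.derivedSeries K n 1).toSubmodule < ⊤ := by
    rw [← LieSubmodule.top_toSubmodule (R := K) (L := n)]
    exact h
  obtain ⟨f, hf, hle⟩ := Submodule.exists_le_ker_of_lt_top _ h'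
  obtain ⟨x, hx⟩ : ∃ x, f x ≠ 0 := by
    by_contra! hx
    exact hf (LinearMap.ext hx)
  refine ⟨f, fun x z => ?_, (f x)⁻¹ • x, by simp [hx]⟩
  refine hle ?_
  have : ⁅x, z⁆ ∈ LieAlgebra.derivedSeries K n 1 := by
    rw [LieAlgebra.derivedSeries_def, LieAlgebra.derivedSeriesOfIdeal_succ,
      LieAlgebra.derivedSeriesOfIdeal_zero]
    exact LieSubmodule.lie_mem_lie (LieSubmodule.mem_top x) (LieSubmodule.mem_top z)
  exact this

/-- Induction on the dimension: the kernel of a nonzero character is solvable of dimension one less,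
and the enveloping algebra is an Ore extension of that of the kernel. -/
theorem noZeroDivisors_and_growth (d : ℕ) : ∀ (n : Type*) [LieRing n] [LieAlgebra K n]
    [FiniteDimensional K n] [LieAlgebra.IsSolvable n], Module.finrank K n = d →
    NoZeroDivisors (U K n) ∧ Nontrivial (U K n) ∧
      ∀ k, Module.finrank K (filt K n k) ≤ (k + 1) ^ d := by
  induction d with
  | zero =>
    intro n _ _ _ _ hn
    have hsub : Subsingleton n := Module.finrank_zero_iff.1 hn
    let aug : U K n →ₐ[K] K := lift 0 (fun x y => by simp)
    have hbot : ∀ u : U K n, ∃ c : K, u = algebraMap K _ c := by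
      intro u
      induction u using induction_left with
      | h1 => exact ⟨1, by simp⟩
      | hadd u w hu hw =>
        obtain ⟨a, rfl⟩ := hu
        obtain ⟨b, rfl⟩ := hw
        exact ⟨a + b, by simp⟩
      | hsmul c u hu =>
        obtain ⟨a, rfl⟩ := hu
        exact ⟨c * a, by simp [Algebra.smul_def]⟩
      | hmul x u hu => exact ⟨0, by simp [Subsingleton.elim x 0]⟩
    have haug : Function.Injective aug := by
      intro u w h
      obtain ⟨a, rfl⟩ := hbot u
      obtain ⟨b, rfl⟩ := hbot w
      rw [AlgHom.commutes, AlgHom.commutes] at h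
      rw [show a = b from h]
    refine ⟨haug.noZeroDivisors aug (map_zero _) (map_mul _),
      aug.toRingHom.domain_nontrivial, fun k => ?_⟩
    have := LinearMap.finrank_le_finrank_of_injective
      (f := aug.toLinearMap.comp (filt K n k).subtype)
      (haug.comp Subtype.val_injective)
    simpa using this
  | succ d ih =>
    intro n _ _ _ _ hn
    have : Nontrivial n := Module.nontrivial_of_finrank_pos (R := K) (by omega)
    obtain ⟨φ, hφ, y, hy⟩ := exists_character (K := K) (n := n)
    have hker : Module.finrank K (kerSubalgebra φ hφ) = d := by
      have h := LinearMap.finrank_range_add_finrank_ker φ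
      have hs : LinearMap.range φ = ⊤ := LinearMap.range_eq_top.2 fun c => ⟨c • y, by simp [hy]⟩
      rw [hs, finrank_top, Module.finrank_self, hn] at h
      change Module.finrank K (LinearMap.ker φ) = d
      omega
    have hsol : LieAlgebra.IsSolvable (kerSubalgebra φ hφ) :=
      Function.Injective.lieAlgebra_isSolvable (f := (kerSubalgebra φ hφ).incl)
        Subtype.val_injective
    obtain ⟨h1, h2, h3⟩ := ih (kerSubalgebra φ hφ) hker
    refine ⟨noZeroDivisors_of_ker hy h1, ?_, fun k => ?_⟩
    · have : Function.Injective (inclKer hφ) := by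
        intro a b hab
        have h := congrArg (polyRep hφ hy) hab
        rw [polyRep_inclKer, polyRep_inclKer] at h
        have h' := DFunLike.congr_fun (LinearMap.congr_fun h (Finsupp.single 0 1)) 0
        simpa [-coeffMul_single] using h'
      exact this.nontrivial
    · refine (finrank_filt_le_of_ker (hφ := hφ) hy k).trans ?_
      rw [pow_succ']
      exact Nat.mul_le_mul_left _ (h3 k)

variable {n : Type*} [LieRing n] [LieAlgebra K n] [FiniteDimensional K n]
  [LieAlgebra.IsSolvable n]

instance : NoZeroDivisors (U K n) := (noZeroDivisors_and_growth (K := K) _ n rfl).1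

instance : Nontrivial (U K n) := (noZeroDivisors_and_growth (K := K) _ n rfl).2.1

theorem exists_pow_lt_two_pow (s r : ℕ) : ∃ j : ℕ, (j * s + 1) ^ r < 2 ^ j := by
  have h : Filter.Tendsto (fun j : ℕ => (j : ℝ) ^ r / (2 : ℝ) ^ j) Filter.atTop (nhds 0) :=
    tendsto_pow_const_div_const_pow_of_one_lt r one_lt_two
  have hpos : (0 : ℝ) < 1 / ((s : ℝ) + 1) ^ r := by positivity
  obtain ⟨j, hj, hj1⟩ := ((h.eventually_lt_const hpos).and (Filter.eventually_ge_atTop 1)).exists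
  refine ⟨j, ?_⟩
  rw [div_lt_div_iff₀ (by positivity) (by positivity), one_mul, ← mul_pow] at hj
  have h1 : (j * s + 1) ^ r ≤ (j * (s + 1)) ^ r := Nat.pow_le_pow_left (by
    rw [mul_add, mul_one]; omega) r
  refine lt_of_le_of_lt h1 ?_
  exact_mod_cast hj

/-- The left Ore condition: nonzero left ideals of the enveloping algebra of a solvable Lie algebra
intersect. -/
theorem exists_ne_zero_mem_of_left_ideals {I J : Submodule K (U K n)}
    (hI : ∀ x, ∀ u ∈ I, emb K x * u ∈ I) (hJ : ∀ x, ∀ u ∈ J, emb K x * u ∈ J)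
    (hI0 : I ≠ ⊥) (hJ0 : J ≠ ⊥) : I ⊓ J ≠ ⊥ := by
  intro hIJ
  obtain ⟨a, haI, ha⟩ := Submodule.exists_mem_ne_zero_of_ne_bot hI0
  obtain ⟨b, hbJ, hb⟩ := Submodule.exists_mem_ne_zero_of_ne_bot hJ0
  obtain ⟨s, has, hbs⟩ : ∃ s, a ∈ filt K n s ∧ b ∈ filt K n s := by
    obtain ⟨k, hk⟩ := exists_mem_filt (K := K) a
    obtain ⟨l, hl⟩ := exists_mem_filt (K := K) b
    exact ⟨max k l, filt_mono (le_max_left _ _) hk, filt_mono (le_max_right _ _) hl⟩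
  have hmul : ∀ {P : Submodule K (U K n)}, (∀ x, ∀ u ∈ P, emb K x * u ∈ P) →
      ∀ w, ∀ u ∈ P, w * u ∈ P := by
    intro P hP w
    induction w using induction_left with
    | h1 => intro u hu; rwa [one_mul]
    | hadd v w hv hw => intro u hu; rw [add_mul]; exact add_mem (hv u hu) (hw u hu)
    | hsmul c w hw => intro u hu; rw [smul_mul_assoc]; exact P.smul_mem c (hw u hu)
    | hmul x w hw => intro u hu; rw [mul_assoc]; exact hP x _ (hw u hu)
  -- If the two ideals met only in zero, (u, w) ↦ u a + w b would be injective, because u a = -w b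
  -- lies in both and there are no zero divisors. Each increase of the degree by `s` then at least
  -- doubles the dimension.
  have hstep : ∀ k, 2 * Module.finrank K (filt K n k) ≤ Module.finrank K (filt K n (k + s)) := by
    intro k
    let f : (filt K n k × filt K n k) →ₗ[K] filt K n (k + s) := LinearMap.codRestrict _
      (((LinearMap.mulRight K a).comp (filt K n k).subtype).coprod
        ((LinearMap.mulRight K b).comp (filt K n k).subtype))
      (fun p => add_mem (mul_mem_filt p.1.2 has) (mul_mem_filt p.2.2 hbs))
    have hf : Function.Injective f := by
      rw [injective_iff_map_eq_zero]
      rintro ⟨⟨u, hu⟩, ⟨w, hw⟩⟩ h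
      have h0 : u * a + w * b = 0 := congrArg Subtype.val h
      have h1 : u * a ∈ I ⊓ J := by
        refine ⟨hmul hI u a haI, ?_⟩
        rw [eq_neg_of_add_eq_zero_left h0]
        exact J.neg_mem (hmul hJ w b hbJ)
      rw [hIJ, Submodule.mem_bot] at h1
      rw [h1, zero_add] at h0
      have hu0 := (mul_eq_zero.1 h1).resolve_right ha
      have hw0 := (mul_eq_zero.1 h0).resolve_right hb
      subst hu0 hw0
      rfl
    have := LinearMap.finrank_le_finrank_of_injective hf
    rw [Module.finrank_prod] at this
    omega
  have hexp : ∀ j, 2 ^ j ≤ Module.finrank K (filt K n (j * s)) := by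
    intro j
    induction j with
    | zero =>
      rw [pow_zero, Nat.one_le_iff_ne_zero, Ne, zero_mul]
      intro h
      have := Module.finrank_zero_iff.1 h
      have h1 : (⟨1, one_mem_filt 0⟩ : filt K n 0) = 0 := Subsingleton.elim _ _
      exact one_ne_zero (congrArg Subtype.val h1)
    | succ j ih =>
      rw [pow_succ', show (j + 1) * s = j * s + s by ring]
      exact (Nat.mul_le_mul_left 2 ih).trans (hstep _)
  -- Exponential growth contradicts the polynomial bound (j s + 1) ^ dim 𝔫.
  obtain ⟨j, hj⟩ := exists_pow_lt_two_pow s (Module.finrank K n)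
  exact absurd ((hexp j).trans ((noZeroDivisors_and_growth (K := K) _ n rfl).2.2 _)) (not_le.2 hj)

end Solvable

end UEnv

end

noncomputable section
set_option linter.unusedSectionVars false

/-! ### The Casimir element of the Killing form. -/

namespace Casimir

open LieAlgebra

variable {K : Type*} [Field K] {L : Type*} [LieRing L] [LieAlgebra K L] [FiniteDimensional K L]
  [IsKilling K L] {ι : Type*} [Fintype ι] [DecidableEq ι] (x : Module.Basis ι K L)

/-- The basis which is dual to a given one for the Killing form. -/
def dual : Module.Basis ι K L :=
  LinearMap.BilinForm.dualBasis (killingForm K L) (IsKilling.killingForm_nondegenerate K L) x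

theorem killingForm_dual (i j : ι) : killingForm K L (x i) (dual x j) = if i = j then 1 else 0 :=
  LinearMap.BilinForm.apply_dualBasis_right _
    ⟨fun a b => LieModule.traceForm_comm K L L a b⟩ x i j

theorem repr_eq (v : L) (i : ι) : x.repr v i = killingForm K L v (dual x i) := by
  conv_rhs => rw [← x.sum_repr v]
  simp only [map_sum, map_smul, LinearMap.sum_apply, LinearMap.smul_apply, killingForm_dual]
  simp

theorem sum_eq (v : L) : ∑ i, killingForm K L v (dual x i) • x i = v := by
  simp_rw [← repr_eq, x.sum_repr]

theorem sum_dual_eq (v : L) : ∑ i, killingForm K L v (x i) • dual x i = v := by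
  conv_rhs => rw [← (dual x).sum_repr v]
  refine Finset.sum_congr rfl fun i _ => ?_
  rw [dual, LinearMap.BilinForm.dualBasis_repr_apply]

theorem killingForm_lie (u v w : L) : killingForm K L ⁅u, v⁆ w = killingForm K L u ⁅v, w⁆ :=
  LieModule.traceForm_apply_lie_apply K L L u v w

/-- The Casimir element of the Killing form in a representation. -/
def casimir {A : Type*} [Ring A] [Algebra K A] (ρ : L →ₗ[K] A) : A := ∑ i, ρ (x i) * ρ (dual x i)

/-- By invariance of the Killing form, the matrices of ad `u` in the two dual bases are negative
transposes of each other, so the two halves of the commutator cancel. -/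
theorem commute_casimir {A : Type*} [Ring A] [Algebra K A] {ρ : L →ₗ[K] A}
    (hρ : ∀ u v, ρ ⁅u, v⁆ = ρ u * ρ v - ρ v * ρ u) (u : L) :
    ρ u * casimir x ρ = casimir x ρ * ρ u := by
  rw [← sub_eq_zero]
  have h1 : ∀ i, ρ ⁅u, x i⁆ = ∑ j, killingForm K L ⁅u, x i⁆ (dual x j) • ρ (x j) := fun i => by
    conv_lhs => rw [← sum_eq x ⁅u, x i⁆]
    simp
  have h2 : ∀ i, ρ ⁅u, dual x i⁆ =
      -∑ j, killingForm K L ⁅u, x j⁆ (dual x i) • ρ (dual x j) := fun i => by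
    conv_lhs => rw [← sum_dual_eq x ⁅u, dual x i⁆]
    rw [map_sum, ← Finset.sum_neg_distrib]
    refine Finset.sum_congr rfl fun j _ => ?_
    rw [map_smul, ← neg_smul, ← lie_skew, map_neg, LinearMap.neg_apply, killingForm_lie,
      LieModule.traceForm_comm]
  have h3 : ρ u * casimir x ρ - casimir x ρ * ρ u =
      ∑ i, (ρ ⁅u, x i⁆ * ρ (dual x i) + ρ (x i) * ρ ⁅u, dual x i⁆) := by
    rw [casimir, Finset.mul_sum, Finset.sum_mul, ← Finset.sum_sub_distrib]
    refine Finset.sum_congr rfl fun i _ => ?_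
    rw [hρ, hρ]
    noncomm_ring
  rw [h3, Finset.sum_add_distrib]
  simp_rw [h1, h2, mul_neg, Finset.sum_neg_distrib, Finset.sum_mul, Finset.mul_sum]
  rw [← sub_eq_add_neg, sub_eq_zero, Finset.sum_comm]
  refine Finset.sum_congr rfl fun i _ => Finset.sum_congr rfl fun j _ => ?_
  rw [smul_mul_assoc, mul_smul_comm]

/-- Pair with `w`: by invariance the result is the trace of ad z ∘ ad w written in dual bases, which
is the Killing form of z and w. Nondegeneracy concludes. -/
theorem casimir_ad (z : L) : ∑ i, ⁅x i, ⁅dual x i, z⁆⁆ = z := by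
  have h : ∀ w, killingForm K L (∑ i, ⁅x i, ⁅dual x i, z⁆⁆) w = killingForm K L z w := by
    intro w
    have htr : killingForm K L z w = ∑ i, killingForm K L ⁅z, ⁅w, x i⁆⁆ (dual x i) := by
      rw [killingForm_apply_apply, LinearMap.trace_eq_matrix_trace K x, Matrix.trace]
      refine Finset.sum_congr rfl fun i _ => ?_
      rw [Matrix.diag_apply, LinearMap.toMatrix_apply, repr_eq]
      rfl
    rw [htr, map_sum, LinearMap.sum_apply]
    refine Finset.sum_congr rfl fun i _ => ?_
    rw [← lie_skew, map_neg, LinearMap.neg_apply, killingForm_lie, killingForm_lie,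
      LieModule.traceForm_comm, ← lie_skew w (x i), lie_neg, map_neg, LinearMap.neg_apply]
  have h0 : killingForm K L (∑ i, ⁅x i, ⁅dual x i, z⁆⁆ - z) = 0 := by
    ext w
    rw [map_sub, LinearMap.sub_apply, h w, sub_self, LinearMap.zero_apply]
  rw [← sub_eq_zero, ← Submodule.mem_bot K, ← LinearMap.ker_eq_bot.2
    ((LinearMap.BilinForm.toDual _ (IsKilling.killingForm_nondegenerate K L)).injective)]
  exact h0

end Casimir

/-! ### Weight vectors and the Casimir scalar on highest weight vectors. -/

namespace Semisimple

open LieAlgebra Casimir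

variable {L : Type*} [LieRing L] [LieAlgebra ℂ L] {H : LieSubalgebra ℂ L}

/-- Weight vectors for the adjoint action of a subalgebra. -/
def IsWt (H : LieSubalgebra ℂ L) (β : Module.Dual ℂ H) (x : L) : Prop :=
  ∀ h : H, ⁅(h : L), x⁆ = β h • x

theorem IsWt.lie {β γ : Module.Dual ℂ H} {x y : L} (hx : IsWt H β x) (hy : IsWt H γ y) :
    IsWt H (β + γ) ⁅x, y⁆ := fun h => by
  rw [leibniz_lie, hx h, hy h, smul_lie, lie_smul, LinearMap.add_apply, add_smul]

variable [FiniteDimensional ℂ L] [IsKilling ℂ L] [H.IsCartanSubalgebra]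

open LieModule

theorem isWt_of_mem_rootSpace {β : Weight ℂ H L} {x : L} (hx : x ∈ rootSpace H β) :
    IsWt H β.toLinear x := fun h => IsKilling.lie_eq_smul_of_mem_rootSpace hx h

variable (H) in
theorem exists_weight_basis : ∃ (ι : Type) (_ : Fintype ι) (_ : DecidableEq ι)
    (x : Module.Basis ι ℂ L) (α : ι → Module.Dual ℂ H), ∀ i, IsWt H (α i) (x i) := by
  classical
  have hint : DirectSum.IsInternal fun β : Weight ℂ H L => (rootSpace H β).toSubmodule :=
    DirectSum.isInternal_submodule_of_iSupIndep_of_iSup_eq_top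
      (LieSubmodule.iSupIndep_toSubmodule.2 (iSupIndep_genWeightSpace' ℂ H L))
      (by rw [← LieSubmodule.iSup_toSubmodule, iSup_genWeightSpace_eq_top' ℂ H L,
        LieSubmodule.top_toSubmodule])
  let x := hint.collectedBasis fun β => Module.finBasis ℂ (rootSpace H β)
  let e := Fintype.equivFin (Σ β : Weight ℂ H L, Fin (Module.finrank ℂ (rootSpace H β)))
  refine ⟨Fin _, inferInstance, inferInstance, x.reindex e, fun i => (e.symm i).1.toLinear,
    fun i => ?_⟩
  rw [Module.Basis.reindex_apply]
  exact isWt_of_mem_rootSpace (hint.collectedBasis_mem _ (e.symm i))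

/-- By invariance of the Killing form, pairing a dual vector with a basis vector of weight α gives
zero unless the weights add up to zero. -/
theorem isWt_dual {ι : Type*} [Fintype ι] [DecidableEq ι] {x : Module.Basis ι ℂ L}
    {α : ι → Module.Dual ℂ H} (hx : ∀ i, IsWt H (α i) (x i)) (i : ι) :
    IsWt H (-α i) (dual x i) := by
  intro h
  rw [← sum_dual_eq x ⁅(h : L), dual x i⁆]
  have : ∀ j, killingForm ℂ L ⁅(h : L), dual x i⁆ (x j) • dual x j =
      if j = i then (-α i) h • dual x i else 0 := by
    intro j
    rw [← lie_skew, map_neg, LinearMap.neg_apply, killingForm_lie, hx j h, map_smul,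
      LieModule.traceForm_comm, killingForm_dual]
    split_ifs with hij
    · subst hij; simp
    · simp
  simp [this]

/-- The element of the Cartan subalgebra representing a functional for the Killing form. -/
def rep (μ : Module.Dual ℂ H) : H := (IsKilling.cartanEquivDual H).symm μ

theorem killingForm_rep (μ : Module.Dual ℂ H) (h : H) :
    killingForm ℂ L (rep μ : L) (h : L) = μ h := by
  have := LinearMap.congr_fun ((IsKilling.cartanEquivDual H).apply_symm_apply μ) h
  rw [IsKilling.cartanEquivDual_apply_apply] at this
  exact this

theorem rep_sub (μ ν : Module.Dual ℂ H) : rep (μ - ν) = rep μ - rep ν := map_sub _ μ ν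

theorem apply_rep_comm (μ ν : Module.Dual ℂ H) : μ (rep ν) = ν (rep μ) := by
  rw [← killingForm_rep, ← killingForm_rep, LieModule.traceForm_comm]

theorem lie_coe_eq_zero (h h' : H) : ⁅(h : L), (h' : L)⁆ = 0 := by
  have : ⁅h, h'⁆ = 0 := trivial_lie_zero H H h h'
  exact congrArg Subtype.val this

theorem weight_eq_zero {β : Module.Dual ℂ H} {x : L} (hx : IsWt H β x) (hx0 : x ≠ 0)
    (hxH : x ∈ H) : β = 0 := by
  ext h
  have := hx h
  rw [lie_coe_eq_zero h ⟨x, hxH⟩] at this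
  exact (smul_eq_zero.1 this.symm).resolve_right hx0

/-- The Casimir element acts on highest weight vectors by a scalar which is quadratic in the
weight. -/
theorem exists_casimir_scalar {d : H}
    (hd : ∀ (β : Module.Dual ℂ H) (x : L), IsWt H β x → (β d).re = 0 → x ∈ H) {ι : Type*} [Fintype ι] [DecidableEq ι] {x : Module.Basis ι ℂ L}
    {α : ι → Module.Dual ℂ H} (hx : ∀ i, IsWt H (α i) (x i)) : ∃ a : H,
    ∀ {E : Type*} [AddCommGroup E] [Module ℂ E] (ρ : L →ₗ[ℂ] Module.End ℂ E)
      (_ : ∀ u v, ρ ⁅u, v⁆ = ρ u * ρ v - ρ v * ρ u) (μ : Module.Dual ℂ H) (m : E)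
      (_ : ∀ h : H, ρ h m = μ h • m)
      (_ : ∀ (β : Module.Dual ℂ H) (z : L), IsWt H β z → 0 < (β d).re → ρ z m = 0),
      casimir x ρ m = (μ (rep μ) + μ a) • m := by
  classical
  -- The element `d` selects the positive system: weights are sorted by the sign of Re α(d), and by
  -- `hd` only weight zero has real part zero.
  have hα0 : ∀ i, (α i d).re = 0 → α i = 0 := fun i hi =>
    weight_eq_zero (hx i) (x.ne_zero i) (hd _ _ (hx i) hi)
  have hmem0 : ∀ z, IsWt H 0 z → z ∈ H := fun z hz => hd 0 z hz (by simp)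
  have hlie : ∀ i, ⁅x i, dual x i⁆ ∈ H := fun i => hmem0 _ (by
    have := (hx i).lie (isWt_dual hx i)
    rwa [add_neg_cancel] at this)
  -- The linear term comes from reordering: for positive `α i`, the vector `x i` kills `m`, so only
  -- the commutator `[x i, dual x i]`, an element of the Cartan subalgebra, survives. Negative `α i`
  -- contribute zero, as then `dual x i` kills `m`.
  refine ⟨∑ i, if 0 < (α i d).re then (⟨⁅x i, dual x i⁆, hlie i⟩ : H) else 0, ?_⟩
  intro E _ _ ρ hρ μ m hm hm'
  have hxH : ∀ i, α i = 0 → x i ∈ H := fun i hi => hmem0 _ (hi ▸ hx i)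
  have hdH : ∀ i, α i = 0 → dual x i ∈ H := fun i hi => hmem0 _ (by
    have := isWt_dual hx i
    rwa [hi, neg_zero] at this)
  let c : ι → ℂ := fun i => if h : α i = 0 then μ ⟨x i, hxH i h⟩ * μ ⟨dual x i, hdH i h⟩ else 0
  -- The terms of weight zero expand `rep μ` in dual bases of the Cartan subalgebra; the other basis
  -- vectors are orthogonal to that subalgebra.
  have hc : ∑ i, c i = μ (rep μ) := by
    have h1 : rep μ = ∑ i, if h : α i = 0 then μ ⟨dual x i, hdH i h⟩ • (⟨x i, hxH i h⟩ : H)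
        else 0 := by
      apply Subtype.ext
      rw [AddSubmonoidClass.coe_finsetSum]
      conv_lhs => rw [← sum_eq x (rep μ : L)]
      refine Finset.sum_congr rfl fun i _ => ?_
      split_ifs with h
      · rw [← killingForm_rep]; rfl
      · obtain ⟨t, ht⟩ : ∃ t, α i t ≠ 0 := by
          by_contra! h'
          exact h (LinearMap.ext h')
        have h2 : killingForm ℂ L (rep μ : L) ⁅(t : L), dual x i⁆ = 0 := by
          rw [← killingForm_lie, lie_coe_eq_zero, map_zero, LinearMap.zero_apply]
        rw [isWt_dual hx i t, map_smul, smul_eq_mul, mul_eq_zero] at h2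
        rw [h2.resolve_left (by simpa using ht), zero_smul]
        rfl
    rw [h1, map_sum]
    refine Finset.sum_congr rfl fun i _ => ?_
    simp only [c]
    split_ifs with h
    · rw [map_smul, smul_eq_mul, mul_comm]
    · rw [map_zero]
  have hterm : ∀ i, ρ (x i) (ρ (dual x i) m) =
      (c i + μ (if 0 < (α i d).re then (⟨⁅x i, dual x i⁆, hlie i⟩ : H) else 0)) • m := by
    intro i
    rcases lt_trichotomy 0 (α i d).re with h | h | h
    · have hne : α i ≠ 0 := fun h0 => by simp [h0] at h
      have h1 := LinearMap.congr_fun (hρ (x i) (dual x i)) m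
      rw [LinearMap.sub_apply, Module.End.mul_apply, Module.End.mul_apply, hm' _ _ (hx i) h,
        map_zero, sub_zero] at h1
      rw [← h1, if_pos h]
      simp only [c, dif_neg hne, zero_add]
      exact hm ⟨_, hlie i⟩
    · have h0 := hα0 i h.symm
      have hn : ¬ 0 < (α i d).re := by rw [← h]; exact lt_irrefl _
      rw [if_neg hn, map_zero, add_zero]
      simp only [c, dif_pos h0]
      have h1 := hm ⟨dual x i, hdH i h0⟩
      have h2 := hm ⟨x i, hxH i h0⟩
      simp only at h1 h2
      rw [h1, map_smul, h2, smul_smul, mul_comm]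
    · have hne : α i ≠ 0 := fun h0 => by simp [h0] at h
      rw [hm' _ _ (isWt_dual hx i) (by simpa using h), map_zero, if_neg (not_lt.2 h.le), map_zero]
      simp only [c, dif_neg hne, zero_add, zero_smul]
  rw [casimir, LinearMap.sum_apply]
  simp only [Module.End.mul_apply, hterm]
  rw [← Finset.sum_smul, Finset.sum_add_distrib, hc, map_sum]

end Semisimple

end

noncomputable section
set_option linter.unusedSectionVars false

/-! ### Reality of the roots, the bound from the quadratic equation, and 𝔤 = 𝔫⁻ ⊕ 𝔟. -/

namespace Semisimple

open LieAlgebra Casimir LieModule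

variable {L : Type*} [LieRing L] [LieAlgebra ℂ L] {H : LieSubalgebra ℂ L}
  [FiniteDimensional ℂ L] [IsKilling ℂ L] [H.IsCartanSubalgebra]

/-- Functionals that take real values on the elements representing the roots. -/
def realWt (H : LieSubalgebra ℂ L) [H.IsCartanSubalgebra] : AddSubgroup (Module.Dual ℂ H) where
  carrier := {ν | ∀ γ : Weight ℂ H L, (γ (rep ν)).im = 0}
  add_mem' := fun {a b} ha hb γ => by
    rw [show rep (a + b) = rep a + rep b from map_add _ a b, ← Weight.toLinear_apply, map_add,
      Complex.add_im]
    rw [Weight.toLinear_apply, Weight.toLinear_apply, ha γ, hb γ, add_zero]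
  zero_mem' := fun γ => by
    rw [show rep (0 : Module.Dual ℂ H) = 0 from map_zero _, ← Weight.toLinear_apply, map_zero,
      Complex.zero_im]
  neg_mem' := fun {a} ha γ => by
    rw [show rep (-a) = -rep a from map_neg _ a, ← Weight.toLinear_apply, map_neg,
      Complex.neg_im, Weight.toLinear_apply, ha γ, neg_zero]

theorem trace_eq (h h' : H) : killingForm ℂ L (h : L) (h' : L) =
    ∑ γ : Weight ℂ H L, (Module.finrank ℂ (genWeightSpace L γ) : ℂ) * (γ h * γ h') := by
  have := traceForm_eq_sum_finrank_nsmul_mul ℂ H L h h'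
  simp only [nsmul_eq_mul] at this
  exact this

/-- Let c = (β, β). Each (γ, β) is c/2 times an integer, by the root string through γ. The trace
formula c = Σ dim · (γ, β)² then reads c S = 4 with S real, so c is real and every (γ, β) is real.
-/
theorem weight_mem_realWt (β : Weight ℂ H L) : β.toLinear ∈ realWt H := by
  intro γ
  by_cases hβ : β.IsZero
  · have : β.toLinear = 0 := by simpa using hβ
    rw [this]
    exact (realWt H).zero_mem γ
  have hc := IsKilling.root_apply_cartanEquivDual_symm_ne_zero hβ
  change β (rep β.toLinear) ≠ 0 at hc
  set c := β (rep β.toLinear) with hcdef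
  have hγ : ∀ γ : Weight ℂ H L, ∃ z : ℤ, γ (rep β.toLinear) = c / 2 * z := by
    intro γ
    refine ⟨(chainBotCoeff β γ : ℤ) - chainTopCoeff β γ, ?_⟩
    have h1 := IsKilling.apply_coroot_eq_cast β γ
    rw [← h1, IsKilling.coroot]
    change _ = c / 2 * γ (2 • c⁻¹ • rep β.toLinear)
    rw [← Weight.toLinear_apply, ← Weight.toLinear_apply, map_nsmul, map_smul, smul_eq_mul,
      nsmul_eq_mul]
    field_simp
    norm_num
  choose z hz using hγ
  have hsum : c = c ^ 2 / 4 * (∑ γ : Weight ℂ H L,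
      (Module.finrank ℂ (genWeightSpace L γ) : ℂ) * (z γ * z γ)) := by
    have h1 := trace_eq (rep β.toLinear) (rep β.toLinear)
    rw [killingForm_rep, Weight.toLinear_apply, ← hcdef] at h1
    conv_lhs => rw [h1]
    rw [Finset.mul_sum]
    refine Finset.sum_congr rfl fun γ _ => ?_
    rw [hz]
    ring
  have hreal : c.im = 0 := by
    set S : ℂ := ∑ γ : Weight ℂ H L,
      (Module.finrank ℂ (genWeightSpace L γ) : ℂ) * (z γ * z γ) with hS
    have hS' : S = ((∑ γ : Weight ℂ H L,
      (Module.finrank ℂ (genWeightSpace L γ) : ℝ) * (z γ * z γ) : ℝ) : ℂ) := by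
      rw [hS]; push_cast; rfl
    have hcS : c * S = 4 := by
      have : c * (c * S - 4) = 0 := by linear_combination (-4 : ℂ) * hsum
      exact sub_eq_zero.1 ((mul_eq_zero.1 this).resolve_left hc)
    have hS0 : S ≠ 0 := fun h => by simp [h] at hcS
    have : c = ((4 / (∑ γ : Weight ℂ H L,
      (Module.finrank ℂ (genWeightSpace L γ) : ℝ) * (z γ * z γ)) : ℝ) : ℂ) := by
      rw [Complex.ofReal_div, ← hS', eq_div_iff hS0, hcS]; norm_num
    rw [this, Complex.ofReal_im]
  rw [hz γ]
  simp [Complex.mul_im, hreal]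

theorem exists_weight {β : Module.Dual ℂ H} {x : L} (hx : IsWt H β x) (hx0 : x ≠ 0) :
    ∃ γ : Weight ℂ H L, γ.toLinear = β := by
  have hmem : x ∈ genWeightSpace L (β : H → ℂ) := by
    rw [mem_genWeightSpace]
    intro h
    refine ⟨1, ?_⟩
    have := hx h
    simpa [sub_eq_zero] using this
  refine ⟨⟨β, fun h => hx0 (by rw [h] at hmem; simpa using hmem)⟩, ?_⟩
  ext h; rfl

theorem isWt_mem_realWt {β : Module.Dual ℂ H} {x : L} (hx : IsWt H β x) (hx0 : x ≠ 0) :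
    β ∈ realWt H := by
  obtain ⟨γ, rfl⟩ := exists_weight hx hx0
  exact weight_mem_realWt γ

/-- The solutions of the quadratic equation of the Casimir element are bounded. -/
theorem exists_bound (a d : H) : ∃ B : ℝ, ∀ ν ∈ realWt H, ν (rep ν) = ν a → (ν d).re ≤ B := by
  let N : Weight ℂ H L → ℝ := fun γ => Module.finrank ℂ (genWeightSpace L γ)
  have hN : ∀ γ, 0 ≤ N γ := fun γ => Nat.cast_nonneg _
  refine ⟨∑ γ, N γ * ((γ a).re ^ 2 + (γ d).re ^ 2), fun ν hν h => ?_⟩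
  let r : Weight ℂ H L → ℝ := fun γ => (γ (rep ν)).re
  have hr : ∀ γ, γ (rep ν) = (r γ : ℂ) := fun γ => Complex.ext rfl (by simpa using hν γ)
  have hre : ∀ t : H, (ν t).re = ∑ γ, N γ * (r γ * (γ t).re) := by
    intro t
    rw [← killingForm_rep, trace_eq, Complex.re_sum]
    refine Finset.sum_congr rfl fun γ _ => ?_
    rw [hr, ← Complex.ofReal_natCast, Complex.re_ofReal_mul, Complex.re_ofReal_mul]
  -- The real numbers `r γ` are the coordinates of `ν`, and both sides of the hypothesis become sums
  -- over the weights: a weighted Σ r² equals a sum linear in r. Hence Σ r² is bounded in terms of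
  -- `a`, and so is Re ν(d), which is linear in r.
  have h1 : ∑ γ, N γ * (r γ * r γ) = ∑ γ, N γ * (r γ * (γ a).re) := by
    rw [← hre a, ← h, hre]
  have h2 : ∑ γ, N γ * (r γ * r γ) ≤ ∑ γ, N γ * (γ a).re ^ 2 := by
    have h3 : ∑ γ, N γ * (2 * (r γ * (γ a).re)) ≤ ∑ γ, N γ * (r γ * r γ + (γ a).re ^ 2) :=
      Finset.sum_le_sum fun γ _ => mul_le_mul_of_nonneg_left
        (by nlinarith [sq_nonneg (r γ - (γ a).re)]) (hN γ)
    have h4 : ∑ γ, N γ * (2 * (r γ * (γ a).re)) = 2 * ∑ γ, N γ * (r γ * (γ a).re) := by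
      rw [Finset.mul_sum]
      exact Finset.sum_congr rfl fun γ _ => by ring
    simp only [mul_add, Finset.sum_add_distrib] at h3
    rw [h4, ← h1] at h3
    linarith
  rw [hre d]
  simp only [mul_add, Finset.sum_add_distrib]
  refine le_trans (Finset.sum_le_sum fun γ _ => mul_le_mul_of_nonneg_left
    (show r γ * (γ d).re ≤ r γ * r γ + (γ d).re ^ 2 by
      nlinarith [sq_nonneg (r γ - (γ d).re), sq_nonneg (r γ), sq_nonneg (γ d).re]) (hN γ)) ?_
  simp only [mul_add, Finset.sum_add_distrib]
  linarith

/-- The subalgebra spanned by the weight vectors whose weights lie in a given additive set. -/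
def wtSubalgebra (H : LieSubalgebra ℂ L) (P : AddSubsemigroup ℂ) (d : H) : LieSubalgebra ℂ L where
  toSubmodule := Submodule.span ℂ {x | ∃ β, IsWt H β x ∧ β d ∈ P}
  lie_mem' := by
    intro x y hx hy
    change x ∈ Submodule.span ℂ _ at hx
    change y ∈ Submodule.span ℂ _ at hy
    change ⁅x, y⁆ ∈ Submodule.span ℂ _
    induction hx using Submodule.span_induction with
    | mem x hx =>
      induction hy using Submodule.span_induction with
      | mem y hy =>
        obtain ⟨β, hβ, hβ'⟩ := hx
        obtain ⟨γ, hγ, hγ'⟩ := hy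
        exact Submodule.subset_span ⟨β + γ, hβ.lie hγ, add_mem hβ' hγ'⟩
      | zero => rw [lie_zero]; exact zero_mem _
      | add y y' _ _ hy hy' => rw [lie_add]; exact add_mem hy hy'
      | smul c y _ hy => rw [lie_smul]; exact Submodule.smul_mem _ c hy
    | zero => rw [zero_lie]; exact zero_mem _
    | add x x' _ _ hx hx' => rw [add_lie]; exact add_mem hx hx'
    | smul c x _ hx => rw [smul_lie]; exact Submodule.smul_mem _ c hx

theorem mem_wtSubalgebra {P : AddSubsemigroup ℂ} {d : H} {β : Module.Dual ℂ H} {x : L}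
    (hx : IsWt H β x) (hβ : β d ∈ P) : x ∈ wtSubalgebra H P d :=
  Submodule.subset_span ⟨β, hx, hβ⟩

theorem wtSubalgebra_induction {P : AddSubsemigroup ℂ} {d : H} {N : Submodule ℂ L}
    (h : ∀ β x, IsWt H β x → β d ∈ P → x ∈ N) {x : L} (hx : x ∈ wtSubalgebra H P d) : x ∈ N := by
  have : Submodule.span ℂ {x | ∃ β, IsWt H β x ∧ β d ∈ P} ≤ N := by
    rw [Submodule.span_le]
    rintro x ⟨β, hx, hβ⟩
    exact h β x hx hβ
  exact this hx

/-- Complex numbers with negative real part. -/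
def negPart : AddSubsemigroup ℂ where
  carrier := {z | z.re < 0}
  add_mem' := fun {a b} ha hb => by
    change (a + b).re < 0
    rw [Complex.add_re]; exact add_neg ha hb

/-- Complex numbers with nonnegative real part. -/
def nonnegPart : AddSubsemigroup ℂ where
  carrier := {z | 0 ≤ z.re}
  add_mem' := fun {a b} ha hb => by
    change 0 ≤ (a + b).re
    rw [Complex.add_re]; exact add_nonneg ha hb

/-- The span of the negative root spaces. -/
abbrev nilNeg (d : H) : LieSubalgebra ℂ L := wtSubalgebra H negPart d

/-- The span of the Cartan subalgebra and the positive root spaces. -/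
abbrev borel (d : H) : LieSubalgebra ℂ L := wtSubalgebra H nonnegPart d

/-- The two subspaces lie in sums of eigenspaces of ad d with eigenvalues of negative and of
nonnegative real part, which are independent. A basis of weight vectors shows that they span. -/
theorem isCompl_nilNeg_borel (d : H) :
    IsCompl (nilNeg d).toSubmodule (borel d).toSubmodule := by
  obtain ⟨ι, _, _, x, α, hx⟩ := exists_weight_basis H
  constructor
  · have hind := Module.End.eigenspaces_iSupIndep (LieAlgebra.ad ℂ L (d : L))
    have hle : ∀ (P : AddSubsemigroup ℂ), (wtSubalgebra H P d).toSubmodule ≤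
        ⨆ z ∈ (P : Set ℂ), Module.End.eigenspace (LieAlgebra.ad ℂ L (d : L)) z := by
      intro P y hy
      refine wtSubalgebra_induction (fun β y hy hβ => ?_) hy
      refine Submodule.mem_iSup_of_mem (β d) (Submodule.mem_iSup_of_mem hβ ?_)
      rw [Module.End.mem_eigenspace_iff]
      exact hy d
    refine Disjoint.mono (hle _) (hle _) (hind.disjoint_biSup_biSup ?_)
    rw [Set.disjoint_left]
    intro z hz hz'
    exact not_lt.2 (show 0 ≤ z.re from hz') (show z.re < 0 from hz)
  · rw [codisjoint_iff, eq_top_iff, ← x.span_eq, Submodule.span_le]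
    rintro _ ⟨i, rfl⟩
    rcases lt_or_ge (α i d).re 0 with h | h
    · exact Submodule.mem_sup_left (mem_wtSubalgebra (hx i) h)
    · exact Submodule.mem_sup_right (mem_wtSubalgebra (hx i) h)

end Semisimple

end

noncomputable section
set_option linter.unusedSectionVars false

/-! ### Solvability of 𝔟 and 𝔫⁻, and existence of common eigenvectors. -/

namespace Semisimple

open LieAlgebra Casimir LieModule UEnv

variable {L : Type*} [LieRing L] [LieAlgebra ℂ L] {H : LieSubalgebra ℂ L}
  [FiniteDimensional ℂ L] [IsKilling ℂ L] [H.IsCartanSubalgebra]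

/-- There are only finitely many weights. The gap `ε` makes each bracket or factor cost a definite
amount of weight. -/
theorem exists_gap (d : H) : ∃ ε : ℝ, 0 < ε ∧ ∀ (β : Module.Dual ℂ H) (x : L), IsWt H β x → x ≠ 0 →
    (β d).re ≠ 0 → ε ≤ |(β d).re| := by
  classical
  let S : Finset ℝ := (Finset.univ.image fun γ : Weight ℂ H L => |(γ d).re|).filter (0 < ·)
  have hS : ∃ ε : ℝ, 0 < ε ∧ ∀ s ∈ S, ε ≤ s := by
    by_cases hne : S.Nonempty
    · exact ⟨S.min' hne, (Finset.mem_filter.1 (S.min'_mem hne)).2, fun s hs => S.min'_le s hs⟩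
    · exact ⟨1, one_pos, fun s hs => absurd ⟨s, hs⟩ hne⟩
  obtain ⟨ε, hε, h⟩ := hS
  refine ⟨ε, hε, fun β x hx hx0 hβ => h _ ?_⟩
  obtain ⟨γ, rfl⟩ := exists_weight hx hx0
  exact Finset.mem_filter.2 ⟨Finset.mem_image.2 ⟨γ, Finset.mem_univ _, rfl⟩, abs_pos.2 hβ⟩

theorem exists_weight_bound (d : H) : ∃ C : ℝ, ∀ (β : Module.Dual ℂ H) (x : L), IsWt H β x → x ≠ 0 →
    (β d).re ≤ C := by
  refine ⟨∑ γ : Weight ℂ H L, |(γ d).re|, fun β x hx hx0 => ?_⟩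
  obtain ⟨γ, rfl⟩ := exists_weight hx hx0
  exact (le_abs_self _).trans (Finset.single_le_sum (f := fun γ : Weight ℂ H L => |(γ d).re|)
    (fun _ _ => abs_nonneg _) (Finset.mem_univ γ))

/-- The span of the weight vectors with weights at least `c`. -/
def level (d : H) (c : ℝ) : Submodule ℂ L := Submodule.span ℂ {x | ∃ β, IsWt H β x ∧ c ≤ (β d).re}

theorem lie_mem_of_span {S T : Set L} {N : Submodule ℂ L} (h : ∀ x ∈ S, ∀ y ∈ T, ⁅x, y⁆ ∈ N)
    {x y : L} (hx : x ∈ Submodule.span ℂ S) (hy : y ∈ Submodule.span ℂ T) : ⁅x, y⁆ ∈ N := by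
  induction hx using Submodule.span_induction with
  | mem x hx =>
    induction hy using Submodule.span_induction with
    | mem y hy => exact h x hx y hy
    | zero => rw [lie_zero]; exact zero_mem _
    | add y y' _ _ hy hy' => rw [lie_add]; exact add_mem hy hy'
    | smul c y _ hy => rw [lie_smul]; exact Submodule.smul_mem _ c hy
  | zero => rw [zero_lie]; exact zero_mem _
  | add x x' _ _ hx hx' => rw [add_lie]; exact add_mem hx hx'
  | smul c x _ hx => rw [smul_lie]; exact Submodule.smul_mem _ c hx

theorem lie_mem_level {d : H} {a b : ℝ} {x y : L} (hx : x ∈ level d a) (hy : y ∈ level d b) :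
    ⁅x, y⁆ ∈ level d (a + b) := by
  refine lie_mem_of_span ?_ hx hy
  rintro x ⟨β, hβ, hβ'⟩ y ⟨γ, hγ, hγ'⟩
  refine Submodule.subset_span ⟨β + γ, hβ.lie hγ, ?_⟩
  rw [LinearMap.add_apply, Complex.add_re]
  exact add_le_add hβ' hγ'

theorem level_anti {d : H} {a b : ℝ} (h : a ≤ b) : level d b ≤ level d a :=
  Submodule.span_mono fun _ ⟨β, hβ, hβ'⟩ => ⟨β, hβ, h.trans hβ'⟩

theorem derivedSeries_succ_le {b : LieSubalgebra ℂ L} {k : ℕ} {N N' : Submodule ℂ L}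
    (h : ∀ x ∈ derivedSeries ℂ b k, (x : L) ∈ N) (hN : ∀ x ∈ N, ∀ y ∈ N, ⁅x, y⁆ ∈ N') :
    ∀ x ∈ derivedSeries ℂ b (k + 1), (x : L) ∈ N' := by
  intro x hx
  rw [derivedSeries_def, derivedSeriesOfIdeal_succ] at hx
  change x ∈ (⁅derivedSeriesOfIdeal ℂ b k ⊤, derivedSeriesOfIdeal ℂ b k ⊤⁆ :
    LieIdeal ℂ b).toSubmodule at hx
  rw [LieSubmodule.lieIdeal_oper_eq_linear_span'] at hx
  have hle : Submodule.span ℂ {y : b | ∃ u ∈ derivedSeriesOfIdeal ℂ b k ⊤,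
      ∃ w ∈ derivedSeriesOfIdeal ℂ b k ⊤, ⁅u, w⁆ = y} ≤ N'.comap b.toSubmodule.subtype := by
    rw [Submodule.span_le]
    rintro _ ⟨u, hu, w, hw, rfl⟩
    exact hN _ (h u hu) _ (h w hw)
  exact hle hx

/-- The first bracket of two weight vectors is zero if both have real part zero, since both then lie
in the abelian Cartan subalgebra; otherwise its level is at least `ε`. Each further derived step
raises the level by at least `ε`, and levels above the largest weight are zero. -/
theorem isSolvable_borel {d : H}
    (hd : ∀ (β : Module.Dual ℂ H) (x : L), IsWt H β x → (β d).re = 0 → x ∈ H) :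
    IsSolvable (borel d) := by
  obtain ⟨ε, hε, hgap⟩ := exists_gap d
  obtain ⟨C, hC⟩ := exists_weight_bound d
  have hder : ∀ k : ℕ, ∀ x ∈ derivedSeries ℂ (borel d) (k + 1), (x : L) ∈ level d ((k + 1) * ε) := by
    intro k
    induction k with
    | zero =>
      refine derivedSeries_succ_le (k := 0) (N := (borel d).toSubmodule) (fun x _ => x.2) ?_
      intro x hx y hy
      refine lie_mem_of_span ?_ hx hy
      rintro x ⟨β, hβ, hβ' : 0 ≤ (β d).re⟩ y ⟨γ, hγ, hγ' : 0 ≤ (γ d).re⟩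
      by_cases h0 : ⁅x, y⁆ = 0
      · rw [h0]; exact zero_mem _
      refine Submodule.subset_span ⟨β + γ, hβ.lie hγ, ?_⟩
      have hre : ((β + γ) d).re = (β d).re + (γ d).re := by
        rw [LinearMap.add_apply, Complex.add_re]
      have hnn : 0 ≤ ((β + γ) d).re := by rw [hre]; exact add_nonneg hβ' hγ'
      have hne : ((β + γ) d).re ≠ 0 := by
        intro h
        rw [hre] at h
        have hx' := hd β x hβ (by linarith)
        have hy' := hd γ y hγ (by linarith)
        exact h0 (lie_coe_eq_zero (⟨x, hx'⟩ : H) ⟨y, hy'⟩)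
      have := hgap _ _ (hβ.lie hγ) h0 hne
      rw [abs_of_nonneg hnn] at this
      simpa using this
    | succ k ih =>
      refine derivedSeries_succ_le ih fun x hx y hy => level_anti ?_ (lie_mem_level hx hy)
      push_cast
      nlinarith [mul_nonneg (Nat.cast_nonneg (α := ℝ) k) hε.le]
  obtain ⟨k, hk⟩ := exists_nat_gt (C / ε)
  refine IsSolvable.mk (R := ℂ) (k := k + 1) ?_
  rw [eq_bot_iff]
  intro x hx
  have h1 := hder k x hx
  have hbot : level d ((k + 1) * ε) = ⊥ := by
    rw [level, Submodule.span_eq_bot]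
    rintro y ⟨β, hβ, hβ'⟩
    by_contra hy
    have h2 := hC β y hβ hy
    rw [div_lt_iff₀ hε] at hk
    nlinarith
  rw [hbot, Submodule.mem_bot] at h1
  rw [LieSubmodule.mem_bot]
  exact Subtype.ext h1

/-- The negative part for `d` is contained in the Borel subalgebra for `-d`. -/
theorem isSolvable_nilNeg {d : H}
    (hd : ∀ (β : Module.Dual ℂ H) (x : L), IsWt H β x → (β d).re = 0 → x ∈ H) :
    IsSolvable (nilNeg d) := by
  have h1 : IsSolvable (borel (-d)) := isSolvable_borel (d := -d) fun β x hx h =>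
    hd β x hx (by simpa using h)
  have hle : nilNeg d ≤ borel (-d) := fun x hx =>
    wtSubalgebra_induction (N := (borel (-d)).toSubmodule)
      (fun β y hy hβ => mem_wtSubalgebra hy (by
        change 0 ≤ (β (-d)).re
        rw [map_neg, Complex.neg_re]
        exact (neg_pos.2 hβ).le)) hx
  exact Function.Injective.lieAlgebra_isSolvable (f := LieSubalgebra.inclusion hle)
    (LieSubalgebra.inclusion_injective hle)

/-- Simultaneous generalized eigenspaces of commuting operators are independent, so in an expansion
of `m` by elements of `S` the part with other eigenvalues vanishes. -/
theorem mem_span_of_simultaneous_eigenvector {ι E : Type*} [AddCommGroup E] [Module ℂ E]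
    {f : ι → Module.End ℂ E} (hf : ∀ i j, Commute (f i) (f j)) {S : Set E}
    (hS : ∀ s ∈ S, ∃ χ : ι → ℂ, ∀ i, f i s = χ i • s) {m : E} (hm : m ∈ Submodule.span ℂ S)
    {μ : ι → ℂ} (hμ : ∀ i, f i m = μ i • m) :
    m ∈ Submodule.span ℂ {s ∈ S | ∀ i, f i s = μ i • s} := by
  have hind := Module.End.independent_iInf_maxGenEigenspace_of_forall_mapsTo f
    (fun i j φ => Module.End.mapsTo_maxGenEigenspace_of_comm (hf j i) φ)
  have hmem : ∀ (χ : ι → ℂ) (s : E), (∀ i, f i s = χ i • s) →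
      s ∈ ⨅ i, (f i).maxGenEigenspace (χ i) := by
    intro χ s hs
    rw [Submodule.mem_iInf]
    intro i
    exact Module.End.mem_maxGenEigenspace _ _ _ |>.2 ⟨1, by simp [hs i]⟩
  have hsplit : S ⊆ {s ∈ S | ∀ i, f i s = μ i • s} ∪ {s ∈ S | ¬ ∀ i, f i s = μ i • s} := by
    intro s hs
    by_cases h : ∀ i, f i s = μ i • s
    · exact Or.inl ⟨hs, h⟩
    · exact Or.inr ⟨hs, h⟩
  have h1 := Submodule.span_mono hsplit hm
  rw [Submodule.span_union] at h1
  obtain ⟨w, hw, r, hr, rfl⟩ := Submodule.mem_sup.1 h1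
  have hw' : w ∈ ⨅ i, (f i).maxGenEigenspace (μ i) :=
    (Submodule.span_le.2 fun s hs => hmem μ s hs.2) hw
  have hr' : r ∈ ⨆ (χ : ι → ℂ) (_ : χ ≠ μ), ⨅ i, (f i).maxGenEigenspace (χ i) := by
    refine (Submodule.span_le.2 fun s hs => ?_) hr
    obtain ⟨χ, hχ⟩ := hS s hs.1
    refine Submodule.mem_iSup_of_mem χ (Submodule.mem_iSup_of_mem ?_ (hmem χ s hχ))
    rintro rfl
    exact hs.2 hχ
  have hr2 : r ∈ ⨅ i, (f i).maxGenEigenspace (μ i) := by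
    have := sub_mem (hmem μ _ hμ) hw'
    rwa [add_sub_cancel_left] at this
  have hr0 : r = 0 := by
    have := (hind μ)
    exact Submodule.disjoint_def.1 this r hr2 hr'
  rw [hr0, add_zero]
  exact hw

/-- Lie's theorem for a representation given by a family of operators. -/
theorem exists_common_eigenvector {b : Type*} [LieRing b] [LieAlgebra ℂ b] [IsSolvable b]
    {E : Type*} [AddCommGroup E] [Module ℂ E] {ρ : b →ₗ[ℂ] Module.End ℂ E}
    (hρ : ∀ x y, ρ ⁅x, y⁆ = ρ x * ρ y - ρ y * ρ x) {V : Submodule ℂ E} [FiniteDimensional ℂ V]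
    (hV0 : V ≠ ⊥) (hV : ∀ x, ∀ u ∈ V, ρ x u ∈ V) :
    ∃ χ : b → ℂ, ∃ m ∈ V, m ≠ 0 ∧ ∀ x, ρ x m = χ x • m := by
  let _ : LieRingModule b V :=
    { bracket := fun x v => ⟨ρ x v, hV x v v.2⟩
      add_lie := fun x y v => Subtype.ext (by
        change ρ (x + y) (v : E) = ρ x v + ρ y v
        rw [map_add, LinearMap.add_apply])
      lie_add := fun x v w => Subtype.ext (map_add (ρ x) (v : E) w)
      leibniz_lie := fun x y v => Subtype.ext (by
        change ρ x (ρ y v) = ρ ⁅x, y⁆ v + ρ y (ρ x v)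
        rw [hρ, LinearMap.sub_apply, Module.End.mul_apply, Module.End.mul_apply,
          sub_add_cancel]) }
  let _ : LieModule ℂ b V :=
    { smul_lie := fun c x v => Subtype.ext (by
        change ρ (c • x) (v : E) = c • ρ x v
        rw [map_smul, LinearMap.smul_apply])
      lie_smul := fun c x v => Subtype.ext (map_smul (ρ x) c (v : E)) }
  have : Nontrivial V := Submodule.nontrivial_iff_ne_bot.2 hV0
  obtain ⟨χ, hχ⟩ := exists_nontrivial_weightSpace_of_isSolvable ℂ b V
  obtain ⟨v, hv⟩ := exists_ne (0 : weightSpace V χ)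
  refine ⟨χ, v, (v : V).2, fun h => hv (Subtype.ext (Subtype.ext h)), fun x => ?_⟩
  exact congrArg Subtype.val ((mem_weightSpace (M := V) _ _).1 v.2 x)

end Semisimple

end

noncomputable section
set_option linter.unusedSectionVars false

/-! ### Verma modules of semisimple Lie algebras have a smallest nonzero submodule. -/

namespace Semisimple

open LieAlgebra Casimir LieModule UEnv

variable {L : Type*} [LieRing L] [LieAlgebra ℂ L] {H : LieSubalgebra ℂ L}
  [FiniteDimensional ℂ L] [IsKilling ℂ L] [H.IsCartanSubalgebra]

theorem isWt_coe (h : H) : IsWt H 0 (h : L) := fun h' => by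
  rw [lie_coe_eq_zero, LinearMap.zero_apply, zero_smul]

theorem coe_mem_borel (d h : H) : (h : L) ∈ borel d :=
  mem_wtSubalgebra (isWt_coe h) (by change 0 ≤ ((0 : Module.Dual ℂ H) d).re; simp)

section VermaModule

variable {d : H} (l : borel d →ₗ[ℂ] ℂ)

/-- The action of a semisimple Lie algebra on its Verma module `U(𝔫⁻)`. -/
def vermaAct : L →ₗ[ℂ] Module.End ℂ (U ℂ (nilNeg d)) := act (seed (isCompl_nilNeg_borel d) l)

variable {l}

theorem vermaAct_coe (y : nilNeg d) (u : U ℂ (nilNeg d)) :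
    vermaAct l y u = emb ℂ y * u := act_coe _ (seed_left _ l) y u

theorem vermaAct_one (x : borel d) : vermaAct l x 1 = l x • 1 := by
  rw [vermaAct, act_one, seed_right, Algebra.algebraMap_eq_smul_one]

theorem vermaAct_emb_mul (x : L) (y : nilNeg d) (u : U ℂ (nilNeg d)) :
    vermaAct l x (emb ℂ y * u) = emb ℂ y * vermaAct l x u + vermaAct l ⁅x, (y : L)⁆ u :=
  act_emb_mul _ x y u

theorem vermaAct_lie (hl : ∀ x y : borel d, l ⁅x, y⁆ = 0) (x y : L) :
    vermaAct l ⁅x, y⁆ = vermaAct l x * vermaAct l y - vermaAct l y * vermaAct l x :=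
  LinearMap.ext fun u => act_lie (seed_left _ l) (isCompl_nilNeg_borel d).codisjoint hl
    (seed_right _ l) x y u

theorem vermaAct_mem_filt (x : borel d) {k : ℕ} {u : U ℂ (nilNeg d)} (hu : u ∈ filt ℂ _ k) :
    vermaAct l x u ∈ filt ℂ _ k :=
  act_mem_filt (seed_left _ l) (isCompl_nilNeg_borel d).codisjoint (seed_right _ l) x hu

variable (l) in
/-- The restriction of a character of the Borel subalgebra to the Cartan subalgebra. -/
def highestWeight : Module.Dual ℂ H :=
  l ∘ₗ H.toSubmodule.subtype.codRestrict (borel d).toSubmodule (fun h => coe_mem_borel d h)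

theorem highestWeight_apply (h : H) : highestWeight l h = l ⟨h, coe_mem_borel d h⟩ := rfl

theorem vermaAct_one_cartan (h : H) : vermaAct l (h : L) 1 = highestWeight l h • 1 := by
  have h1 := vermaAct_one (l := l) ⟨(h : L), coe_mem_borel d h⟩
  rw [highestWeight_apply, ← h1]

/-- An eigenvector of the Borel subalgebra is killed by the positive root vectors. -/
theorem eq_zero_of_eigenvector (hl : ∀ x y : borel d, l ⁅x, y⁆ = 0) {χ : borel d → ℂ}
    {m : U ℂ (nilNeg d)} (hm : ∀ x : borel d, vermaAct l x m = χ x • m) {β : Module.Dual ℂ H} {z : L}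
    (hz : IsWt H β z) (hβ : 0 < (β d).re) : vermaAct l z m = 0 := by
  -- Both `d` and `z` act on `m` by scalars, so their commutator kills `m`; this commutator is β(d)
  -- z with β(d) nonzero.
  have h1 := LinearMap.congr_fun (vermaAct_lie hl (d : L) z) m
  have hzb : z ∈ borel d := mem_wtSubalgebra hz (show 0 ≤ (β d).re from hβ.le)
  have hzm := hm ⟨z, hzb⟩
  have hdm := hm ⟨d, coe_mem_borel d d⟩
  simp only at hzm hdm
  rw [hz d, map_smul, LinearMap.smul_apply, LinearMap.sub_apply, Module.End.mul_apply,
    Module.End.mul_apply, hzm, hdm, map_smul, map_smul, hzm, hdm,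
    smul_comm (χ ⟨z, hzb⟩) (χ ⟨d, coe_mem_borel d d⟩), sub_self, ← hzm, smul_eq_zero] at h1
  exact h1.resolve_left fun h => by simp [h] at hβ

variable (l) in
/-- Weight vectors of the Verma module with bounded length and weight. -/
def monomials (ε : ℝ) : Set (U ℂ (nilNeg d)) :=
  {u | ∃ (k : ℕ) (ν : Module.Dual ℂ H), u ∈ filt ℂ (nilNeg d) k ∧ ν ∈ realWt H ∧
    k * ε ≤ (ν d).re ∧ ∀ h : H, vermaAct l h u = (highestWeight l - ν) h • u}

/-- Left multiplication by a negative root vector raises the length by one and lowers the weight by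
at least `ε` at `d`. For weight vectors, the depth below the highest weight therefore bounds the
length. -/
theorem span_monomials {ε : ℝ}
    (hε : ∀ (β : Module.Dual ℂ H) (x : L), IsWt H β x → x ≠ 0 → (β d).re ≠ 0 → ε ≤ |(β d).re|) :
    Submodule.span ℂ (monomials l ε) = ⊤ := by
  refine submodule_eq_top (Submodule.subset_span
    ⟨0, 0, one_mem_filt 0, zero_mem _, by simp, fun h => ?_⟩) ?_
  · rw [sub_zero]; exact vermaAct_one_cartan h
  · intro x u hu
    induction hu using Submodule.span_induction with
    | mem u hu =>
      obtain ⟨k, ν, huk, hν, hk, hw⟩ := hu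
      have hx : (x : L) ∈ (Submodule.comap ((LinearMap.applyₗ u).comp (vermaAct l))
          (Submodule.span ℂ (monomials l ε))) := by
        refine wtSubalgebra_induction (fun β y hy hβ => ?_) x.2
        change (β d).re < 0 at hβ
        rw [Submodule.mem_comap]
        change vermaAct l y u ∈ _
        by_cases hy0 : y = 0
        · rw [hy0, map_zero, LinearMap.zero_apply]; exact zero_mem _
        have hmul := vermaAct_coe (l := l) ⟨y, mem_wtSubalgebra hy hβ⟩ u
        simp only at hmul
        rw [hmul]
        refine Submodule.subset_span ⟨k + 1, ν - β, emb_mul_mem_filt _ huk,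
          sub_mem hν (isWt_mem_realWt hy hy0), ?_, fun h => ?_⟩
        · have := hε β y hy hy0 hβ.ne
          rw [abs_of_neg hβ] at this
          rw [LinearMap.sub_apply, Complex.sub_re]
          push_cast
          linarith
        · rw [vermaAct_emb_mul, hw, hy h, map_smul, LinearMap.smul_apply, hmul, mul_smul_comm,
            ← add_smul]
          congr 1
          simp only [LinearMap.sub_apply]
          ring
      rw [← vermaAct_coe (l := l)]
      exact hx
    | zero => rw [mul_zero]; exact zero_mem _
    | add u w _ _ hu hw => rw [mul_add]; exact add_mem hu hw
    | smul c u _ hu => rw [mul_smul_comm]; exact Submodule.smul_mem _ c hu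

/-- Every nonzero submodule of a Verma module has a nonzero element of bounded length. -/
theorem exists_filt_inf_ne_bot
    (hd : ∀ (β : Module.Dual ℂ H) (x : L), IsWt H β x → (β d).re = 0 → x ∈ H)
    (hl : ∀ x y : borel d, l ⁅x, y⁆ = 0) : ∃ k, ∀ N : Submodule ℂ (U ℂ (nilNeg d)),
      N ≠ ⊥ → (∀ x, ∀ u ∈ N, vermaAct l x u ∈ N) → N ⊓ filt ℂ _ k ≠ ⊥ := by
  obtain ⟨ι, _, _, x, α, hx⟩ := exists_weight_basis H
  obtain ⟨a, ha⟩ := exists_casimir_scalar hd hx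
  obtain ⟨ε, hε, hgap⟩ := exists_gap d
  -- With λ the highest weight, equality of the Casimir scalars at λ and λ - ν amounts to (ν, ν) =
  -- ν(2 rep λ + a).
  obtain ⟨B, hB⟩ := exists_bound ((2 : ℂ) • rep (highestWeight l) + a) d
  have hρ := vermaAct_lie hl
  have := isSolvable_borel hd
  set c : ℂ := highestWeight l (rep (highestWeight l)) + highestWeight l a with hc
  have h1 : casimir x (vermaAct l) 1 = c • 1 :=
    ha (vermaAct l) hρ _ _ vermaAct_one_cartan
      (fun β z hz hβ => eq_zero_of_eigenvector hl vermaAct_one hz hβ)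
  -- The Casimir element commutes with the action and the generator spans under 𝔫⁻, so its value at
  -- `1` decides.
  have hall : ∀ u, casimir x (vermaAct l) u = c • u := by
    have : casimir x (vermaAct l) = c • LinearMap.id := by
      refine linearMap_ext h1 fun y u hu => ?_
      have hcomm := LinearMap.congr_fun (commute_casimir x hρ (y : L)) u
      rw [Module.End.mul_apply, Module.End.mul_apply, vermaAct_coe, vermaAct_coe, hu] at hcomm
      rw [← hcomm]
      simp
    intro u
    rw [this]; rfl
  -- A vector of length `i` in `monomials` has depth at least `i ε`, and a highest weight vector has
  -- depth at most `B`; so `B / ε` bounds the length, independently of `N`.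
  obtain ⟨k, hk⟩ := exists_nat_ge (B / ε)
  refine ⟨k, fun N hN0 hN => ?_⟩
  obtain ⟨u, huN, hu0⟩ := Submodule.exists_mem_ne_zero_of_ne_bot hN0
  obtain ⟨j, hj⟩ := exists_mem_filt (K := ℂ) u
  have hfin : FiniteDimensional ℂ (N ⊓ filt ℂ (nilNeg d) j : Submodule ℂ _) :=
    Submodule.finiteDimensional_of_le inf_le_right
  -- Lie's theorem applies because the Borel subalgebra preserves the finite-dimensional filtration
  -- steps.
  obtain ⟨χ, m, hmN, hm0, hm⟩ := exists_common_eigenvector (b := borel d)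
    (ρ := vermaAct l ∘ₗ (borel d).toSubmodule.subtype) (fun x y => hρ x y)
    (V := N ⊓ filt ℂ (nilNeg d) j) (fun h => hu0 ((Submodule.eq_bot_iff _).1 h u ⟨huN, hj⟩))
    (fun y w hw => ⟨hN _ w hw.1, vermaAct_mem_filt y hw.2⟩)
  replace hm : ∀ y : borel d, vermaAct l y m = χ y • m := hm
  have hχ : ∃ μ : Module.Dual ℂ H, ∀ h : H, vermaAct l h m = μ h • m := by
    refine ⟨{ toFun := fun h => χ ⟨h, coe_mem_borel d h⟩, map_add' := fun h h' => ?_,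
              map_smul' := fun r h => ?_ }, fun h => hm ⟨h, coe_mem_borel d h⟩⟩
    · apply smul_left_injective ℂ hm0
      simp only [add_smul, ← hm]
      rw [← LinearMap.add_apply, ← map_add]; rfl
    · apply smul_left_injective ℂ hm0
      simp only [smul_eq_mul, mul_smul, ← hm, RingHom.id_apply]
      rw [← LinearMap.smul_apply, ← map_smul]; rfl
  obtain ⟨μ, hμ⟩ := hχ
  have hcas := ha (vermaAct l) hρ μ m hμ (fun β z hz hβ => eq_zero_of_eigenvector hl hm hz hβ)
  rw [hall] at hcas
  have hquad : c = μ (rep μ) + μ a := smul_left_injective ℂ hm0 hcas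
  refine fun h => hm0 ((Submodule.eq_bot_iff _).1 h m ⟨hmN.1, ?_⟩)
  have hspan : m ∈ Submodule.span ℂ (monomials l ε) := by rw [span_monomials hgap]; trivial
  -- Only elements of `monomials` of the same weight as `m` are needed to express `m`, and the bound
  -- applies to each of them.
  have hm2 := mem_span_of_simultaneous_eigenvector (f := fun h : H => vermaAct l h)
    (fun h h' => by
      have := hρ (h : L) h'
      rw [lie_coe_eq_zero, map_zero] at this
      exact (sub_eq_zero.1 this.symm))
    (S := monomials l ε) (by rintro s ⟨_, ν, _, _, _, hs⟩; exact ⟨_, hs⟩) hspan hμ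
  refine (Submodule.span_le.2 ?_) hm2
  rintro s ⟨⟨i, ν, hsi, hν, hi, hs⟩, hsμ⟩
  by_cases hs0 : s = 0
  · rw [hs0]; exact zero_mem _
  have hμν : μ = highestWeight l - ν := LinearMap.ext fun h =>
    smul_left_injective ℂ hs0 ((hsμ h).symm.trans (hs h))
  refine filt_mono ?_ hsi
  have hb := hB ν hν (by
    rw [hμν, hc, rep_sub] at hquad
    simp only [LinearMap.sub_apply, map_sub, apply_rep_comm (highestWeight l) ν] at hquad
    rw [map_add, map_smul, smul_eq_mul]
    linear_combination -hquad)
  have : (i : ℝ) ≤ k := by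
    refine le_trans ?_ hk
    rw [le_div_iff₀ hε]
    exact hi.trans hb
  exact_mod_cast this

/-- Verma modules of semisimple Lie algebras have a smallest nonzero submodule. -/
theorem exists_least_submodule
    (hd : ∀ (β : Module.Dual ℂ H) (x : L), IsWt H β x → (β d).re = 0 → x ∈ H)
    (hl : ∀ x y : borel d, l ⁅x, y⁆ = 0) : ∃ S : Submodule ℂ (U ℂ (nilNeg d)), S ≠ ⊥ ∧
      (∀ x, ∀ u ∈ S, vermaAct l x u ∈ S) ∧ ∀ N : Submodule ℂ (U ℂ (nilNeg d)),
        N ≠ ⊥ → (∀ x, ∀ u ∈ N, vermaAct l x u ∈ N) → S ≤ N := by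
  have := isSolvable_nilNeg hd
  obtain ⟨k, hk⟩ := exists_filt_inf_ne_bot hd hl
  let 𝒩 : Set (Submodule ℂ (U ℂ (nilNeg d))) :=
    {N | N ≠ ⊥ ∧ ∀ x, ∀ u ∈ N, vermaAct l x u ∈ N}
  have htop : (⊤ : Submodule ℂ (U ℂ (nilNeg d))) ∈ 𝒩 :=
    ⟨top_ne_bot, fun _ _ _ => Submodule.mem_top⟩
  let f : Submodule ℂ (U ℂ (nilNeg d)) → ℕ := fun N =>
    Module.finrank ℂ (N ⊓ filt ℂ (nilNeg d) k : Submodule ℂ (U ℂ (nilNeg d)))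
  -- `N₀` need not be the smallest submodule; only its part in `filt k` has minimal dimension.
  obtain ⟨N₀, hN₀, hmin⟩ := exists_minimalFor_of_wellFoundedLT (· ∈ 𝒩) f ⟨⊤, htop⟩
  have hle : ∀ N ∈ 𝒩, N₀ ⊓ filt ℂ (nilNeg d) k ≤ N := by
    intro N hN
    have hleft : ∀ {P : Submodule ℂ (U ℂ (nilNeg d))}, P ∈ 𝒩 → ∀ y, ∀ u ∈ P, emb ℂ y * u ∈ P := by
      intro P hP y u hu
      rw [← vermaAct_coe (l := l)]
      exact hP.2 _ u hu
    -- The intersection is nonzero by the Ore condition, so minimality makes its part in `filt k`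
    -- equal to that of `N₀`.
    have hinf : N₀ ⊓ N ∈ 𝒩 :=
      ⟨exists_ne_zero_mem_of_left_ideals (hleft hN₀) (hleft hN) hN₀.1 hN.1,
        fun x u hu => ⟨hN₀.2 x u hu.1, hN.2 x u hu.2⟩⟩
    have hle' : (N₀ ⊓ N) ⊓ filt ℂ (nilNeg d) k ≤ N₀ ⊓ filt ℂ (nilNeg d) k :=
      inf_le_inf_right _ inf_le_left
    have hfin : FiniteDimensional ℂ (N₀ ⊓ filt ℂ (nilNeg d) k : Submodule ℂ _) :=
      Submodule.finiteDimensional_of_le inf_le_right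
    have hrank : f N₀ ≤ f (N₀ ⊓ N) := hmin hinf (Submodule.finrank_mono hle')
    rw [← Submodule.eq_of_le_of_finrank_le hle' hrank]
    exact inf_le_left.trans inf_le_right
  refine ⟨sInf 𝒩, fun h => ?_, fun x u hu => ?_, fun N hN0 hN => sInf_le ⟨hN0, hN⟩⟩
  · exact hk N₀ hN₀.1 hN₀.2 (eq_bot_iff.2 (h ▸ le_sInf hle))
  · rw [Submodule.mem_sInf] at hu ⊢
    exact fun N hN => hN.2 x u (hu N hN)

end VermaModule

end Semisimple

end

noncomputable section
set_option linter.unusedSectionVars false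

namespace Reductive

open LieAlgebra Casimir LieModule UEnv Semisimple

/-! ### The semisimple quotient by the center and its equivariant splitting. -/

section Levi

variable {g L : Type*} [LieRing g] [LieAlgebra ℂ g] [LieRing L] [LieAlgebra ℂ L]
  [FiniteDimensional ℂ g] {π : g →ₗ⁅ℂ⁆ L}

/-- The preimage of an abelian ideal has its derived algebra in the center, so it is solvable, hence
contained in the radical, which is the center and thus the kernel. -/
theorem hasTrivialRadical_of_ker_eq_center [HasCentralRadical ℂ g] (hπ : Function.Surjective π)
    (hker : ∀ x, π x = 0 ↔ x ∈ center ℂ g) : HasTrivialRadical ℂ L := by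
  rw [hasTrivialRadical_iff_no_abelian_ideals]
  intro I hI
  have hJ1 : ⁅I.comap π, I.comap π⁆ ≤ center ℂ g := by
    rw [LieSubmodule.lieIdeal_oper_eq_span, LieSubmodule.lieSpan_le]
    rintro _ ⟨⟨x, hx⟩, ⟨y, hy⟩, rfl⟩
    rw [LieIdeal.mem_comap] at hx hy
    refine (hker _).1 ?_
    change π ⁅x, y⁆ = 0
    rw [LieHom.map_lie]
    exact congrArg Subtype.val (trivial_lie_zero I I ⟨π x, hx⟩ ⟨π y, hy⟩)
  have hJ2 : derivedSeriesOfIdeal ℂ g 2 (I.comap π) = ⊥ := by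
    rw [derivedSeriesOfIdeal_succ, derivedSeriesOfIdeal_succ, derivedSeriesOfIdeal_zero, eq_bot_iff,
      LieSubmodule.lieIdeal_oper_eq_span, LieSubmodule.lieSpan_le]
    rintro _ ⟨⟨x, hx⟩, ⟨y, hy⟩, rfl⟩
    exact (LieModule.mem_maxTrivSubmodule ℂ g g y).1 (hJ1 hy) x
  have hsol : IsSolvable (I.comap π) := IsSolvable.mk (R := ℂ) (k := 2)
    ((LieIdeal.derivedSeries_eq_bot_iff _ 2).2 hJ2)
  have hle := (LieIdeal.solvable_iff_le_radical ℂ g _).1 hsol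
  rw [radical_eq_center] at hle
  rw [LieSubmodule.eq_bot_iff]
  intro y hy
  obtain ⟨x, rfl⟩ := hπ y
  exact (hker x).2 (hle (LieIdeal.mem_comap.2 hy))

/-- A surjection to a semisimple Lie algebra with central kernel splits. -/
theorem exists_equivariant_section [FiniteDimensional ℂ L] [IsKilling ℂ L]
    (hπ : Function.Surjective π) (hker : ∀ x, π x = 0 → x ∈ center ℂ g) :
    ∃ σ : L →ₗ⁅ℂ⁆ g, (∀ y, π (σ y) = y) ∧ ∀ x y, ⁅x, σ y⁆ = σ ⁅π x, y⁆ := by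
  classical
  obtain ⟨s, hs⟩ := (π : g →ₗ[ℂ] L).exists_rightInverse_of_surjective (LinearMap.range_eq_top.2 hπ)
  replace hs : ∀ y, π (s y) = y := LinearMap.congr_fun hs
  -- The kernel is central, so ad x depends only on π x; through any linear section, `L` acts on
  -- `g`.
  have had : ∀ x y z : g, π x = π y → ⁅x, z⁆ = ⁅y, z⁆ := fun x y z h => by
    rw [← sub_eq_zero, ← sub_lie, ← lie_skew, neg_eq_zero]
    exact (LieModule.mem_maxTrivSubmodule ℂ g g _).1 (hker _ (by rw [map_sub, h, sub_self])) z
  let ρ : L →ₗ[ℂ] Module.End ℂ g := (ad ℂ g : g →ₗ[ℂ] Module.End ℂ g) ∘ₗ s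
  have hρs : ∀ y z, ρ y z = ⁅s y, z⁆ := fun y z => rfl
  have hρ : ∀ u v, ρ ⁅u, v⁆ = ρ u * ρ v - ρ v * ρ u := fun u v => by
    ext z
    rw [LinearMap.sub_apply, Module.End.mul_apply, Module.End.mul_apply]
    simp only [hρs]
    rw [← lie_lie]
    exact had _ _ _ (by rw [LieHom.map_lie, hs, hs, hs])
  let x := Module.finBasis ℂ L
  -- `C` commutes with the adjoint action, kills the central kernel, and induces the identity on
  -- `L`, because the Casimir operator of the adjoint representation is the identity. Hence `C ∘ s`
  -- is an equivariant section.
  set C := casimir x ρ with hC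
  have hCapp : ∀ z, C z = ∑ i, ⁅s (x i), ⁅s (dual x i), z⁆⁆ := fun z => by
    rw [hC, casimir, LinearMap.sum_apply]; rfl
  have hCπ : ∀ z, π (C z) = π z := fun z => by
    rw [hCapp, map_sum]
    simp only [LieHom.map_lie, hs]
    exact casimir_ad x (π z)
  have hC0 : ∀ z, π z = 0 → C z = 0 := fun z hz => by
    rw [hCapp]
    refine Finset.sum_eq_zero fun i _ => ?_
    rw [(LieModule.mem_maxTrivSubmodule ℂ g g _).1 (hker _ hz), lie_zero]
  have hCs : ∀ z, C (s (π z)) = C z := fun z => by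
    rw [← sub_eq_zero, ← map_sub, hC0]
    rw [map_sub, hs, sub_self]
  have hClie : ∀ u z, ⁅u, C z⁆ = C ⁅u, z⁆ := fun u z => by
    have h := LinearMap.congr_fun (commute_casimir x hρ (π u)) z
    rw [Module.End.mul_apply, Module.End.mul_apply, hρs, hρs, had _ u _ (hs _),
      had _ u _ (hs _)] at h
    exact h
  have hequi : ∀ u y, ⁅u, C (s y)⁆ = C (s ⁅π u, y⁆) := fun u y => by
    rw [hClie, ← hCs, LieHom.map_lie, hs]
  refine ⟨{ C ∘ₗ s with map_lie' := fun {u v} => ?_ }, fun y => ?_, hequi⟩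
  · change C (s ⁅u, v⁆) = ⁅C (s u), C (s v)⁆
    rw [hequi, hCπ, hs]
  · exact (hCπ _).trans (hs y)

end Levi

/-! ### Transfer of Cartan and Borel subalgebras along the splitting. -/

section Cartan

variable {g L : Type*} [LieRing g] [LieAlgebra ℂ g] [LieRing L] [LieAlgebra ℂ L]
  {π : g →ₗ⁅ℂ⁆ L} {σ : L →ₗ⁅ℂ⁆ g}

theorem mem_of_lie_mem {h : LieSubalgebra ℂ g} [h.IsCartanSubalgebra] {x : g}
    (hx : ∀ y ∈ h, ⁅x, y⁆ ∈ h) : x ∈ h := by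
  have h1 : x ∈ h.normalizer := (h.mem_normalizer_iff x).2 hx
  rwa [LieSubalgebra.IsCartanSubalgebra.self_normalizing] at h1

/-- Nilpotency is inherited through the injection `σ` into `h`. By equivariance, if `y` normalizes
the preimage then `σ y` normalizes `h`, hence lies in `h`. -/
theorem isCartanSubalgebra_comap (hσ : ∀ y, π (σ y) = y) (hequi : ∀ x y, ⁅x, σ y⁆ = σ ⁅π x, y⁆)
    (h : LieSubalgebra ℂ g) [h.IsCartanSubalgebra] (hh : ∀ x ∈ h, σ (π x) ∈ h) :
    (h.comap σ).IsCartanSubalgebra where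
  nilpotent := by
    let f : h.comap σ →ₗ⁅ℂ⁆ h :=
      { (σ : L →ₗ[ℂ] g).restrict (p := (h.comap σ).toSubmodule) (q := h.toSubmodule)
          (fun _ hx => hx) with
        map_lie' := fun {x y} => Subtype.ext (LieHom.map_lie σ (x : L) (y : L)) }
    have hf : Function.Injective f := fun x y hxy => by
      have := congrArg π (congrArg Subtype.val hxy)
      apply Subtype.ext
      rw [← hσ x, ← hσ y]
      exact this
    exact hf.lieAlgebra_isNilpotent
  self_normalizing := by
    refine le_antisymm (fun y hy => ?_) (LieSubalgebra.le_normalizer _)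
    rw [LieSubalgebra.mem_normalizer_iff] at hy
    refine mem_of_lie_mem (h := h) (x := σ y) fun x hx => ?_
    rw [← lie_skew, hequi, ← map_neg, lie_skew]
    exact hy (π x) (hh x hx)

/-- A real functional is the real part of the complex functional α ↦ ω(α) - i ω(iα), and in finite
dimension the latter is evaluation at a vector. A positive system given by `ω` is thus given by an
element `d` of the Cartan subalgebra. -/
theorem exists_re_apply_eq {V : Type*} [AddCommGroup V] [Module ℂ V] [FiniteDimensional ℂ V]
    (ω : Module.Dual ℂ V →ₗ[ℝ] ℝ) : ∃ d : V, ∀ α : Module.Dual ℂ V, (α d).re = ω α := by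
  let f : Module.Dual ℂ (Module.Dual ℂ V) :=
    { toFun := fun α => (ω α : ℂ) - (ω (Complex.I • α) : ℂ) * Complex.I
      map_add' := fun α β => by simp only [smul_add, map_add]; push_cast; ring
      map_smul' := fun c α => by
        have h1 : ∀ c : ℂ, ∀ α : Module.Dual ℂ V, ω (c • α) = c.re * ω α + c.im * ω (Complex.I • α) := by
          intro c α
          have : c • α = c.re • α + c.im • Complex.I • α := by
            ext v
            simp
            linear_combination (-(α v)) * Complex.re_add_im c
          rw [this, map_add, map_smul, map_smul, smul_eq_mul, smul_eq_mul]
        rw [smul_smul, h1 c, h1 (Complex.I * c)]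
        apply Complex.ext <;> simp }
  refine ⟨(Module.evalEquiv ℂ V).symm f, fun α => ?_⟩
  have h := LinearMap.congr_fun ((Module.evalEquiv ℂ V).apply_symm_apply f) α
  rw [Module.evalEquiv_apply, Module.Dual.eval_apply] at h
  rw [h]
  simp [f]

/-- Eigenvectors of an element of the Cartan subalgebra are sums of weight vectors. -/
theorem mem_wtSubalgebra_of_pow_eq_zero {L : Type*} [LieRing L] [LieAlgebra ℂ L]
    {H : LieSubalgebra ℂ L} [FiniteDimensional ℂ L] [IsKilling ℂ L] [H.IsCartanSubalgebra] {d : H}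
    {P : AddSubsemigroup ℂ} {z : ℂ} (hz : z ∈ P) {k : ℕ} {y : L}
    (hy : ((ad ℂ L (d : L) - algebraMap ℂ (Module.End ℂ L) z) ^ k) y = 0) :
    y ∈ wtSubalgebra H P d := by
  obtain ⟨ι, _, _, x, α, hx⟩ := exists_weight_basis H
  set T : Module.End ℂ L := ad ℂ L (d : L) - algebraMap ℂ (Module.End ℂ L) z with hT
  have hT1 : ∀ i, T (x i) = (α i d - z) • x i := fun i => by
    rw [hT, LinearMap.sub_apply, Module.algebraMap_end_apply, ad_apply, hx i d, sub_smul]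
  have h1 : ∀ (j : ℕ) i, (T ^ j) (x i) = (α i d - z) ^ j • x i := fun j i => by
    induction j with
    | zero => simp
    | succ j ih => rw [pow_succ, Module.End.mul_apply, hT1, map_smul, ih, smul_smul, pow_succ']
  rw [← x.sum_repr y] at hy ⊢
  simp only [map_sum, map_smul, h1, smul_smul] at hy
  refine sum_mem fun i _ => ?_
  by_cases hi : α i d = z
  · exact (wtSubalgebra H P d).smul_mem _ (mem_wtSubalgebra (hx i) (hi ▸ hz))
  · have := Fintype.linearIndependent_iff.1 x.linearIndependent _ hy i
    rw [(mul_eq_zero.1 this).resolve_right (pow_ne_zero _ (sub_ne_zero.2 hi)), zero_smul]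
    exact zero_mem _

variable [FiniteDimensional ℂ g] {h : LieSubalgebra ℂ g} [h.IsCartanSubalgebra]

/-- The Borel subalgebra of a system of positive roots. -/
def posSubmodule (ω : Module.Dual ℂ h →ₗ[ℝ] ℝ) : Submodule ℂ g :=
  h.toSubmodule ⊔ ⨆ (α : LieModule.Weight ℂ h g) (_ : 0 < ω α.toLinear),
        (LieAlgebra.rootSpace h α).toSubmodule

/-- A vector of weight zero centralizes `h`, so it lies in `h`; any other nonzero weight vector
belongs to a root, where `ω` does not vanish. -/
theorem mem_posSubmodule {ω : Module.Dual ℂ h →ₗ[ℝ] ℝ}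
    (hω : ∀ α : LieModule.Weight ℂ h g, α.IsNonZero → ω α.toLinear ≠ 0) {α : Module.Dual ℂ h} {x : g}
    (hx : ∀ y : h, ⁅(y : g), x⁆ = α y • x) (hα : 0 ≤ ω α) :
    x ∈ posSubmodule ω ∧ (ω α = 0 → x ∈ h) := by
  by_cases hα0 : α = 0
  · have hxh : x ∈ h := mem_of_lie_mem fun y hy => by
      rw [← lie_skew, hx ⟨y, hy⟩, hα0, LinearMap.zero_apply, zero_smul, neg_zero]
      exact zero_mem _
    exact ⟨Submodule.mem_sup_left hxh, fun _ => hxh⟩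
  by_cases hx0 : x = 0
  · rw [hx0]; exact ⟨zero_mem _, fun _ => zero_mem _⟩
  have hmem : x ∈ genWeightSpace g (α : h → ℂ) := by
    rw [mem_genWeightSpace]
    intro y
    refine ⟨1, ?_⟩
    have := hx y
    simpa [sub_eq_zero] using this
  let γ : Weight ℂ h g := ⟨α, fun h' => hx0 (by rw [h'] at hmem; simpa using hmem)⟩
  have hγ : γ.toLinear = α := LinearMap.ext fun _ => rfl
  have hγ0 : γ.IsNonZero := fun h' => hα0 (LinearMap.ext fun y => congrFun h' y)
  have hne := hω γ hγ0
  rw [hγ] at hne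
  refine ⟨Submodule.mem_sup_right (Submodule.mem_iSup_of_mem γ (Submodule.mem_iSup_of_mem ?_ hmem)),
    fun h' => absurd h' hne⟩
  rw [hγ]
  exact lt_of_le_of_ne hα hne.symm

/-- By equivariance, `σ` turns a vector of weight β into an `h`-weight vector of weight β ∘ π. -/
theorem isWt_section_mem {ω : Module.Dual ℂ h →ₗ[ℝ] ℝ}
    (hω : ∀ α : LieModule.Weight ℂ h g, α.IsNonZero → ω α.toLinear ≠ 0)
    (hequi : ∀ x y, ⁅x, σ y⁆ = σ ⁅π x, y⁆) (hh : ∀ x ∈ h, σ (π x) ∈ h) {d : h}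
    (hd : ∀ α : Module.Dual ℂ h, (α d).re = ω α) {β : Module.Dual ℂ (h.comap σ)} {y : L}
    (hy : IsWt (h.comap σ) β y) (hβ : 0 ≤ (β ⟨π d, hh d d.2⟩).re) :
    σ y ∈ posSubmodule ω ∧ ((β ⟨π d, hh d d.2⟩).re = 0 → σ y ∈ h) := by
  let α : Module.Dual ℂ h := β ∘ₗ
    ((π : g →ₗ[ℂ] L).restrict (p := h.toSubmodule) (q := (h.comap σ).toSubmodule) hh)
  have hα : (α d).re = (β ⟨π d, hh d d.2⟩).re := rfl
  rw [← hα, hd] at hβ ⊢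
  refine mem_posSubmodule hω (α := α) (fun x => ?_) hβ
  rw [hequi, ← map_smul]
  exact congrArg σ (hy ⟨π x, hh x x.2⟩)

/-- Root spaces are defined as generalized eigenspaces, so their images are generalized eigenvectors
of ad (π d); `mem_wtSubalgebra_of_pow_eq_zero` decomposes these into weight vectors. -/
theorem map_mem_borel [FiniteDimensional ℂ L] [IsKilling ℂ L] {ω : Module.Dual ℂ h →ₗ[ℝ] ℝ}
    (hh : ∀ x ∈ h, σ (π x) ∈ h) [(h.comap σ).IsCartanSubalgebra] {d : h}
    (hd : ∀ α : Module.Dual ℂ h, (α d).re = ω α) {x : g} (hx : x ∈ posSubmodule ω) :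
    π x ∈ borel (H := h.comap σ) ⟨π d, hh d d.2⟩ := by
  suffices hle : posSubmodule ω ≤ ((borel (H := h.comap σ) ⟨π d, hh d d.2⟩).toSubmodule).comap
    (π : g →ₗ[ℂ] L) from hle hx
  refine sup_le (fun x hx => coe_mem_borel (H := h.comap σ) _ ⟨π x, hh x hx⟩)
    (iSup_le fun α => iSup_le fun hα x hx => ?_)
  obtain ⟨k, hk⟩ := (mem_genWeightSpace g α x).1 hx d
  refine mem_wtSubalgebra_of_pow_eq_zero (z := α d) (k := k) ?_ ?_
  · have := hd α.toLinear
    rw [← this] at hα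
    exact hα.le
  · have hpow : ∀ (j : ℕ) (u : g), ((ad ℂ L (π d) - algebraMap ℂ (Module.End ℂ L) (α d)) ^ j) (π u) =
        π (((toEnd ℂ h g d - α d • (1 : Module.End ℂ g)) ^ j) u) := by
      intro j
      induction j with
      | zero => intro u; rfl
      | succ j ih =>
        intro u
        rw [pow_succ, pow_succ, Module.End.mul_apply, Module.End.mul_apply, ← ih]
        congr 1
        rw [LinearMap.sub_apply, LinearMap.sub_apply, map_sub, Module.algebraMap_end_apply,
          ad_apply, LinearMap.smul_apply, map_smul, toEnd_apply_apply, LieSubalgebra.coe_bracket_of_module,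
          LieHom.map_lie]
        rfl
    exact (hpow k x).trans ((congrArg π hk).trans (map_zero π))

end Cartan

end Reductive

end

noncomputable section
set_option linter.unusedSectionVars false

/-! ### Verma modules of reductive Lie algebras. -/

namespace Reductive

open LieAlgebra LieModule UEnv Semisimple

universe u v w

/-- The properties of the Verma module of a character of a Borel subalgebra. -/
structure IsVerma {g : Type u} [LieRing g] [LieAlgebra ℂ g] {b : LieSubalgebra ℂ g} (χ : b →ₗ[ℂ] ℂ)
    {M : Type v} [AddCommGroup M] [Module ℂ M] (ρ : g →ₗ[ℂ] Module.End ℂ M) (m₀ : M) : Prop where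
  map_lie : ∀ x y, ρ ⁅x, y⁆ = ρ x * ρ y - ρ y * ρ x
  apply_generator : ∀ x : b, ρ x m₀ = χ x • m₀
  eq_top : ∀ N : Submodule ℂ M, m₀ ∈ N → (∀ x, ∀ u ∈ N, ρ x u ∈ N) → N = ⊤
  exists_lift : ∀ (V : Type w) [AddCommGroup V] [Module ℂ V] (τ : g →ₗ[ℂ] Module.End ℂ V)
    (_ : ∀ x y, τ ⁅x, y⁆ = τ x * τ y - τ y * τ x) (v : V) (_ : ∀ x : b, τ x v = χ x • v),
    ∃ f : M →ₗ[ℂ] V, f m₀ = v ∧ ∀ x u, f (ρ x u) = τ x (f u)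
  exists_least : ∃ S : Submodule ℂ M, S ≠ ⊥ ∧ (∀ x, ∀ u ∈ S, ρ x u ∈ S) ∧
    ∀ N : Submodule ℂ M, N ≠ ⊥ → (∀ x, ∀ u ∈ N, ρ x u ∈ N) → S ≤ N

/-- Each x splits into σ(π x) and a central part x - σ(π x), which lies in the Borel subalgebra. The
Verma module of `L` for χ ∘ σ, with χ of the central part added as a scalar, has all the properties
required of the Verma module of `g`. -/
theorem exists_isVerma_of_section {g L : Type u} [LieRing g] [LieAlgebra ℂ g] [LieRing L]
    [LieAlgebra ℂ L] [FiniteDimensional ℂ g] [FiniteDimensional ℂ L] [IsKilling ℂ L]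
    {π : g →ₗ⁅ℂ⁆ L} {σ : L →ₗ⁅ℂ⁆ g} (hσ : ∀ y, π (σ y) = y)
    (hequi : ∀ x y, ⁅x, σ y⁆ = σ ⁅π x, y⁆) {h b : LieSubalgebra ℂ g} [h.IsCartanSubalgebra]
    (hh : ∀ x ∈ h, σ (π x) ∈ h) (hker : ∀ x, π x = 0 → x ∈ center ℂ g) {ω : Module.Dual ℂ h →ₗ[ℝ] ℝ}
    (hω : ∀ α : LieModule.Weight ℂ h g, α.IsNonZero → ω α.toLinear ≠ 0)
    (hb : b.toSubmodule = posSubmodule ω) (χ : b →ₗ[ℂ] ℂ) (hχ : ∀ x y : b, χ ⁅x, y⁆ = 0) :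
    ∃ (M : Type u) (_ : AddCommGroup M) (_ : Module ℂ M) (ρ : g →ₗ[ℂ] Module.End ℂ M) (m₀ : M),
      IsVerma.{u, u, w} χ ρ m₀ := by
  obtain ⟨d', hd⟩ := exists_re_apply_eq ω
  have := isCartanSubalgebra_comap hσ hequi h hh
  let d : h.comap σ := ⟨π d', hh d' d'.2⟩
  have hb' : ∀ x, x ∈ b ↔ x ∈ posSubmodule ω := fun x => by rw [← hb]; rfl
  have hσb : ∀ y ∈ borel d, σ y ∈ b := fun y hy =>
    wtSubalgebra_induction (N := (b.toSubmodule).comap (σ : L →ₗ[ℂ] g))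
      (fun β z hz hβ => (hb' _).2 (isWt_section_mem hω hequi hh hd hz hβ).1) hy
  have hπb : ∀ x ∈ b, π x ∈ borel d := fun x hx => map_mem_borel hh hd ((hb' x).1 hx)
  have hdL : ∀ (β : Module.Dual ℂ (h.comap σ)) (x : L), IsWt (h.comap σ) β x → (β d).re = 0 →
      x ∈ h.comap σ := fun β x hx h0 => (isWt_section_mem hω hequi hh hd hx h0.ge).2 h0
  have hhb : ∀ x ∈ h, x ∈ b := fun x hx => (hb' x).2 (Submodule.mem_sup_left hx)
  have hrem : ∀ x, x - σ (π x) ∈ b := fun x =>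
    hhb _ (mem_of_lie_mem fun y _ => by
      rw [← lie_skew, (LieModule.mem_maxTrivSubmodule ℂ g g _).1 (hker _ (by
        rw [map_sub, hσ, sub_self])), neg_zero]
      exact zero_mem _)
  let l : borel d →ₗ[ℂ] ℂ := χ ∘ₗ
    ((σ : L →ₗ[ℂ] g).restrict (p := (borel d).toSubmodule) (q := b.toSubmodule) hσb)
  have hl_apply : ∀ y (hy : y ∈ borel d), l ⟨y, hy⟩ = χ ⟨σ y, hσb y hy⟩ := fun _ _ => rfl
  have hl : ∀ x y : borel d, l ⁅x, y⁆ = 0 := fun x y => by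
    refine Eq.trans ?_ (hχ ⟨σ x, hσb x x.2⟩ ⟨σ y, hσb y y.2⟩)
    exact congrArg χ (Subtype.ext (LieHom.map_lie σ (x : L) (y : L)))
  let θ : g →ₗ[ℂ] ℂ := χ ∘ₗ LinearMap.codRestrict b.toSubmodule
    (LinearMap.id - (σ : L →ₗ[ℂ] g) ∘ₗ (π : g →ₗ[ℂ] L)) hrem
  have hθ_apply : ∀ x, θ x = χ ⟨x - σ (π x), hrem x⟩ := fun _ => rfl
  -- By equivariance, the central part of [x, y] is the bracket of x with the central part of y,
  -- hence zero; so θ is a character of all of `g`.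
  have hθ : ∀ x y : g, θ ⁅x, y⁆ = 0 := fun x y => by
    have : (⟨⁅x, y⁆ - σ (π ⁅x, y⁆), hrem ⁅x, y⁆⟩ : b) = 0 := by
      apply Subtype.ext
      change ⁅x, y⁆ - σ (π ⁅x, y⁆) = 0
      rw [LieHom.map_lie, ← hequi, ← lie_sub]
      exact (LieModule.mem_maxTrivSubmodule ℂ g g _).1 (hker _ (by rw [map_sub, hσ, sub_self])) x
    rw [hθ_apply, this, map_zero]
  have hθσ : ∀ z, θ (σ z) = 0 := fun z => by
    have : (⟨σ z - σ (π (σ z)), hrem (σ z)⟩ : b) = 0 :=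
      Subtype.ext (by change σ z - σ (π (σ z)) = 0; rw [hσ, sub_self])
    rw [hθ_apply, this, map_zero]
  let ρ : g →ₗ[ℂ] Module.End ℂ (U ℂ (nilNeg d)) :=
    vermaAct l ∘ₗ (π : g →ₗ[ℂ] L) + LinearMap.toSpanSingleton ℂ _ 1 ∘ₗ θ
  have hρ : ∀ x u, ρ x u = vermaAct l (π x) u + θ x • u := fun _ _ => rfl
  have hstable : ∀ N : Submodule ℂ (U ℂ (nilNeg d)), (∀ x, ∀ u ∈ N, ρ x u ∈ N) →
      ∀ y, ∀ u ∈ N, vermaAct l y u ∈ N := fun N hN y u hu => by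
    have := sub_mem (hN (σ y) u hu) (N.smul_mem (θ (σ y)) hu)
    rwa [hρ, add_sub_cancel_right, hσ] at this
  have hχsum : ∀ x (hx : x ∈ b), l ⟨π x, hπb x hx⟩ + θ x = χ ⟨x, hx⟩ := fun x hx => by
    rw [hl_apply, hθ_apply, ← map_add]
    congr 1
    exact Subtype.ext (add_sub_cancel _ _)
  refine ⟨U ℂ (nilNeg d), inferInstance, inferInstance, ρ, 1, fun x y => ?_, fun x => ?_,
    fun N h1 hN => ?_, fun V _ _ τ hτ v hv => ?_, ?_⟩
  · ext u
    simp only [LinearMap.sub_apply, Module.End.mul_apply, hρ, hθ, LieHom.map_lie,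
      vermaAct_lie hl, map_add, map_smul, zero_smul, add_zero, smul_add, smul_comm (θ y) (θ x)]
    abel
  · have := vermaAct_one (l := l) ⟨π x, hπb x x.2⟩
    rw [hρ, this, ← add_smul, hχsum x x.2]
  · refine submodule_eq_top h1 fun y u hu => ?_
    rw [← vermaAct_coe (l := l)]
    exact hstable N hN _ u hu
  · let f' : nilNeg d →ₗ[ℂ] Module.End ℂ V := τ ∘ₗ (σ : L →ₗ[ℂ] g) ∘ₗ (nilNeg d).toSubmodule.subtype
    have hf' : ∀ y, f' y = τ (σ y) := fun _ => rfl
    -- The lift is u ↦ u·v on U(𝔫⁻), with 𝔫⁻ acting through `σ`. It remains to verify equivariance,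
    -- by induction on u, for all of `g`.
    let F := UEnv.lift (A := Module.End ℂ V) f' fun x y => by
      rw [hf', hf', hf', ← hτ, LieSubalgebra.coe_bracket, LieHom.map_lie]
    let f : U ℂ (nilNeg d) →ₗ[ℂ] V := LinearMap.applyₗ v ∘ₗ F.toLinearMap
    have hf1 : f 1 = v := by
      change F 1 v = v
      rw [map_one]; rfl
    have hfmul : ∀ (y : nilNeg d) u, f (emb ℂ y * u) = τ (σ y) (f u) := fun y u => by
      change F (emb ℂ y * u) v = τ (σ y) (F u v)
      rw [map_mul, UEnv.lift_emb]; rfl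
    refine ⟨f, hf1, fun x u => ?_⟩
    induction u using UEnv.induction_left generalizing x with
    | h1 =>
      have hx : π x ∈ (nilNeg d).toSubmodule ⊔ (borel d).toSubmodule := by
        rw [(isCompl_nilNeg_borel d).codisjoint.eq_top]; trivial
      obtain ⟨y, hy, z, hz, hyz⟩ := Submodule.mem_sup.1 hx
      have h1 := vermaAct_coe (l := l) ⟨y, hy⟩ 1
      have h2 := vermaAct_one (l := l) ⟨z, hz⟩
      have h3 := hv ⟨σ z, hσb z hz⟩
      have h4 := hv ⟨x - σ (π x), hrem x⟩
      simp only at h1 h2 h3 h4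
      rw [hρ, ← hyz, map_add (vermaAct l), LinearMap.add_apply, h1, h2, map_add, map_add, hfmul, map_smul,
        map_smul, hf1, hl_apply, ← h3, hθ_apply, ← h4, ← LinearMap.add_apply, ← map_add,
        ← map_add, hyz, ← LinearMap.add_apply, ← map_add, add_sub_cancel]
    | hadd u w hu hw => simp only [map_add, hu, hw]
    | hsmul c u hu => simp only [map_smul, hu]
    | hmul y u hu =>
      have h1 := hu (σ ⁅π x, (y : L)⁆)
      have h2 := hu x
      have h3 := LinearMap.congr_fun (hτ x (σ y)) (f u)
      rw [hρ, hσ, hθσ, zero_smul, add_zero, ← hequi, h3, LinearMap.sub_apply,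
        Module.End.mul_apply, Module.End.mul_apply, ← h2, hρ, map_add, map_smul, map_add,
        map_smul] at h1
      rw [hρ, vermaAct_emb_mul, map_add, map_add, map_smul, hfmul, hfmul, h1]
      abel
  · obtain ⟨S, hS0, hS, hmin⟩ := exists_least_submodule hdL hl
    refine ⟨S, hS0, fun x u hu => ?_, fun N hN0 hN => hmin N hN0 (hstable N hN)⟩
    rw [hρ]
    exact add_mem (hS _ u hu) (S.smul_mem _ hu)

/-- Characters of Borel subalgebras of reductive Lie algebras have a Verma module. -/
theorem exists_isVerma {g : Type u} [LieRing g] [LieAlgebra ℂ g] [FiniteDimensional ℂ g]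
    [HasCentralRadical ℂ g] {b : LieSubalgebra ℂ g} (hb : LieSuperalgebra.IsBorel b)
    (χ : b →ₗ[ℂ] ℂ) (hχ : ∀ x y : b, χ ⁅x, y⁆ = 0) :
    ∃ (M : Type u) (_ : AddCommGroup M) (_ : Module ℂ M) (ρ : g →ₗ[ℂ] Module.End ℂ M) (m₀ : M),
      IsVerma.{u, u, w} χ ρ m₀ := by
  obtain ⟨h, _, ω, hω, hb⟩ := hb
  let π : g →ₗ⁅ℂ⁆ g ⧸ center ℂ g :=
    { (center ℂ g).toSubmodule.mkQ with
      map_lie' := fun {x y} => LieSubmodule.Quotient.mk_bracket (I := center ℂ g) x y }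
  have hπ : Function.Surjective π := (center ℂ g).toSubmodule.mkQ_surjective
  have hker : ∀ x, π x = 0 ↔ x ∈ center ℂ g := fun x =>
    Submodule.Quotient.mk_eq_zero (center ℂ g).toSubmodule
  have := hasTrivialRadical_of_ker_eq_center hπ hker
  obtain ⟨σ, hσ, hequi⟩ := exists_equivariant_section hπ fun x => (hker x).1
  have hcenter : ∀ x ∈ center ℂ g, x ∈ h := fun x hx => mem_of_lie_mem fun y _ => by
    rw [← lie_skew, (LieModule.mem_maxTrivSubmodule ℂ g g x).1 hx, neg_zero]
    exact zero_mem _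
  refine exists_isVerma_of_section hσ hequi (fun x hx => ?_) (fun x => (hker x).1) hω hb χ hχ
  rw [← sub_sub_cancel x (σ (π x))]
  exact sub_mem hx (hcenter _ ((hker _).1 (by rw [map_sub, hσ, sub_self])))

end Reductive

end

noncomputable section
set_option linter.unusedSectionVars false

/-! ### Vectors of Λ(W) ⊗ M annihilated by W. -/

namespace Exterior

open ExteriorAlgebra

variable {W : Type*} [AddCommGroup W] [Module ℂ W] {M : Type*} [AddCommGroup M] [Module ℂ M]

theorem induction_tensor {p : ExteriorAlgebra ℂ W ⊗[ℂ] M → Prop} (one : ∀ m, p (1 ⊗ₜ m))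
    (add : ∀ k k', p k → p k' → p (k + k')) (mul : ∀ (w : W) k, p k → p (ι ℂ w • k))
    (k : ExteriorAlgebra ℂ W ⊗[ℂ] M) : p k := by
  induction k using TensorProduct.induction_on with
  | zero => simpa using one 0
  | add k k' hk hk' => exact add k k' hk hk'
  | tmul a m =>
    induction a using CliffordAlgebra.left_induction generalizing m with
    | algebraMap r =>
      rw [Algebra.algebraMap_eq_smul_one, TensorProduct.smul_tmul]
      exact one _
    | add a b ha hb => rw [TensorProduct.add_tmul]; exact add _ _ (ha m) (hb m)
    | ι_mul a w ha =>
      have := mul w _ (ha m)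
      rwa [TensorProduct.smul_tmul', smul_eq_mul] at this

theorem ι_smul_ι_smul (w w' : W) (k : ExteriorAlgebra ℂ W ⊗[ℂ] M) :
    ι ℂ w • ι ℂ w' • k = -(ι ℂ w' • ι ℂ w • k) := by
  rw [smul_smul, smul_smul, ← neg_smul, eq_neg_of_add_eq_zero_left (ι_add_mul_swap w w')]

/-- Contraction with a functional. -/
def contract (d : Module.Dual ℂ W) : Module.End ℂ (ExteriorAlgebra ℂ W ⊗[ℂ] M) :=
  LinearMap.rTensor M (CliffordAlgebra.contractLeft (Q := (0 : QuadraticForm ℂ W)) d)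

theorem contract_ι_smul (d : Module.Dual ℂ W) (w : W) (k : ExteriorAlgebra ℂ W ⊗[ℂ] M) :
    contract d (ι ℂ w • k) = d w • k - ι ℂ w • contract d k := by
  induction k using TensorProduct.induction_on with
  | zero => simp
  | add k k' hk hk' => simp only [smul_add, map_add, hk, hk']; abel
  | tmul a m =>
    have := CliffordAlgebra.contractLeft_ι_mul (Q := (0 : QuadraticForm ℂ W)) (d := d) w a
    simp only [contract, TensorProduct.smul_tmul', smul_eq_mul, LinearMap.rTensor_tmul]
    rw [← TensorProduct.sub_tmul]
    exact congrArg (· ⊗ₜ[ℂ] m) this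

theorem exists_contract_prod_smul {d : Module.Dual ℂ W} {l : List W} (hl : ∀ w ∈ l, d w = 0)
    (k : ExteriorAlgebra ℂ W ⊗[ℂ] M) :
    ∃ k', contract d ((l.map (ι ℂ)).prod • k) = (l.map (ι ℂ)).prod • k' := by
  induction l with
  | nil => exact ⟨contract d k, by simp⟩
  | cons w l ih =>
    obtain ⟨k', hk'⟩ := ih fun w hw => hl w (List.mem_cons_of_mem _ hw)
    refine ⟨-k', ?_⟩
    rw [List.map_cons, List.prod_cons, mul_smul, contract_ι_smul, hl w List.mem_cons_self, zero_smul,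
      hk', mul_smul, smul_neg, smul_neg, zero_sub]

/-- Contracting b·k = 0 with the coordinate of b gives k = b·(contraction of k). Contraction passes,
up to sign, through the basis vectors already split off, so these factors accumulate. -/
theorem exists_eq_prod_smul {ι' : Type*} (b : Module.Basis ι' ℂ W) {l : List ι'} (hl : l.Nodup)
    {k : ExteriorAlgebra ℂ W ⊗[ℂ] M} (hk : ∀ w : W, ι ℂ w • k = 0) :
    ∃ k', k = ((l.map b).map (ι ℂ)).prod • k' := by
  classical
  induction l with
  | nil => exact ⟨k, by simp⟩
  | cons i l ih =>
    rw [List.nodup_cons] at hl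
    obtain ⟨k', hk'⟩ := ih hl.2
    have h1 : k = ι ℂ (b i) • contract (b.coord i) k := by
      have := contract_ι_smul (b.coord i) (b i) k
      rw [hk, map_zero, Module.Basis.coord_apply, Module.Basis.repr_self, Finsupp.single_eq_same,
        one_smul] at this
      exact sub_eq_zero.1 this.symm
    obtain ⟨k'', hk''⟩ := exists_contract_prod_smul (d := b.coord i) (l := l.map b) (fun w hw => by
      obtain ⟨j, hj, rfl⟩ := List.mem_map.1 hw
      rw [Module.Basis.coord_apply, Module.Basis.repr_self, Finsupp.single_eq_of_ne]
      rintro rfl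
      exact hl.1 hj) k'
    refine ⟨k'', ?_⟩
    rw [List.map_cons, List.map_cons, List.prod_cons, mul_smul, ← hk'', ← hk']
    exact h1

theorem exists_prod_mul_ι (l : List W) (w : W) : ∃ s : ℂ, s ≠ 0 ∧
    (l.map (ι ℂ)).prod * ι ℂ w = s • (ι ℂ w * (l.map (ι ℂ)).prod) := by
  induction l with
  | nil => exact ⟨1, one_ne_zero, by simp⟩
  | cons v l ih =>
    obtain ⟨s, hs, h⟩ := ih
    refine ⟨-s, neg_ne_zero.2 hs, ?_⟩
    rw [List.map_cons, List.prod_cons, mul_assoc, h, mul_smul_comm, ← mul_assoc, ← mul_assoc,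
      eq_neg_of_add_eq_zero_left (ι_add_mul_swap v w), neg_mul, smul_neg, neg_smul]

theorem prod_mul_ι_eq_zero {l : List W} {w : W} (hw : w ∈ l) :
    (l.map (ι ℂ)).prod * ι ℂ w = 0 := by
  induction l with
  | nil => simp at hw
  | cons v l ih =>
    rw [List.map_cons, List.prod_cons, mul_assoc]
    rcases List.mem_cons.1 hw with rfl | hw
    · obtain ⟨s, -, h⟩ := exists_prod_mul_ι l w
      rw [h, mul_smul_comm, ← mul_assoc, ι_sq_zero, zero_mul, smul_zero]
    · rw [ih hw, mul_zero]

variable (W) in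
/-- The vectors killed by the exterior algebra are the multiples of a top form. -/
theorem exists_top_form [FiniteDimensional ℂ W] : ∃ t : ExteriorAlgebra ℂ W, (∀ w : W, ι ℂ w * t = 0) ∧
    ∀ {M : Type*} [AddCommGroup M] [Module ℂ M] (k : ExteriorAlgebra ℂ W ⊗[ℂ] M),
      (∀ w : W, ι ℂ w • k = 0) → ∃ m, k = t ⊗ₜ m := by
  let b := Module.finBasis ℂ W
  let l := (List.finRange (Module.finrank ℂ W)).map b
  let t := (l.map (ι ℂ)).prod
  have hr : ∀ w : W, t * ι ℂ w = 0 := fun w => by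
    rw [← b.sum_repr w, map_sum, Finset.mul_sum]
    refine Finset.sum_eq_zero fun i _ => ?_
    rw [map_smul, mul_smul_comm, prod_mul_ι_eq_zero (List.mem_map_of_mem (List.mem_finRange i)),
      smul_zero]
  refine ⟨t, fun w => ?_, fun {M} _ _ k hk => ?_⟩
  · obtain ⟨s, hs, h⟩ := exists_prod_mul_ι l w
    exact (smul_eq_zero.1 (h.symm.trans (hr w))).resolve_left hs
  · obtain ⟨k', hk'⟩ := exists_eq_prod_smul b (List.nodup_finRange _) hk
    -- Since `t` kills W from the right as well, t • k' depends only on the component of k' of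
    -- degree zero in Λ(W).
    suffices h : ∀ k' : ExteriorAlgebra ℂ W ⊗[ℂ] M, ∃ m, t • k' = t ⊗ₜ m by
      obtain ⟨m, hm⟩ := h k'
      exact ⟨m, hk'.trans hm⟩
    intro k'
    induction k' using induction_tensor with
    | one m => exact ⟨m, by rw [TensorProduct.smul_tmul', smul_eq_mul, mul_one]⟩
    | add k k' hk hk' =>
      obtain ⟨m, hm⟩ := hk
      obtain ⟨m', hm'⟩ := hk'
      exact ⟨m + m', by rw [smul_add, hm, hm', TensorProduct.tmul_add]⟩
    | mul w k _ => exact ⟨0, by rw [smul_smul, hr, zero_smul, TensorProduct.tmul_zero]⟩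

/-- Run through a basis and multiply by each basis vector unless this gives zero; what was already
killed stays killed, by anticommutativity. -/
theorem exists_mem_forall_smul_eq_zero [FiniteDimensional ℂ W]
    {N : Submodule ℂ (ExteriorAlgebra ℂ W ⊗[ℂ] M)} (hN0 : N ≠ ⊥) (hN : ∀ w : W, ∀ k ∈ N, ι ℂ w • k ∈ N) :
    ∃ k ∈ N, k ≠ 0 ∧ ∀ w : W, ι ℂ w • k = 0 := by
  let b := Module.finBasis ℂ W
  have h : ∀ l : List (Fin (Module.finrank ℂ W)), ∃ k ∈ N, k ≠ 0 ∧ ∀ i ∈ l, ι ℂ (b i) • k = 0 := by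
    intro l
    induction l with
    | nil =>
      obtain ⟨k, hk, hk0⟩ := Submodule.exists_mem_ne_zero_of_ne_bot hN0
      exact ⟨k, hk, hk0, by simp⟩
    | cons i l ih =>
      obtain ⟨k, hk, hk0, hl⟩ := ih
      by_cases hi : ι ℂ (b i) • k = 0
      · refine ⟨k, hk, hk0, fun j hj => ?_⟩
        rcases List.mem_cons.1 hj with rfl | hj
        exacts [hi, hl j hj]
      · refine ⟨_, hN (b i) k hk, hi, fun j hj => ?_⟩
        rcases List.mem_cons.1 hj with rfl | hj
        · rw [smul_smul, ι_sq_zero, zero_smul]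
        · rw [ι_smul_ι_smul, hl j hj, smul_zero, neg_zero]
  obtain ⟨k, hk, hk0, hb⟩ := h (List.finRange _)
  refine ⟨k, hk, hk0, fun w => ?_⟩
  rw [← b.sum_repr w, map_sum, Finset.sum_smul]
  refine Finset.sum_eq_zero fun i _ => ?_
  rw [map_smul, smul_assoc, hb i (List.mem_finRange i), smul_zero]

end Exterior

end

noncomputable section
set_option linter.unusedSectionVars false

/-! ### The Kac module Λ(𝔤₋₁) ⊗ M as a representation of the Lie superalgebra. -/

namespace Kac

open ExteriorAlgebra LieSuperalgebra

variable {g V : Type*} [LieRing g] [LieAlgebra ℂ g] [AddCommGroup V] [Module ℂ V]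
  [LieRingModule g V] [LieModule ℂ g V] {G : LieSuperalgebra g V} (T : G.TypeI)
  {M : Type*} [AddCommGroup M] [Module ℂ M] (ρ : g →ₗ[ℂ] Module.End ℂ M)

variable (M) in
/-- The Kac module `Λ(𝔤₋₁) ⊗ M`. -/
abbrev Space : Type _ := ExteriorAlgebra ℂ T.minus ⊗[ℂ] M

variable (M) in
/-- A vector of the Kac module together with its images under the even and the positive part. -/
abbrev Jet : Type _ := Space T M × (g →ₗ[ℂ] Space T M) × (T.plus →ₗ[ℂ] Space T M)

/-- The bracket of the positive and the negative part. -/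
def pairing : T.plus →ₗ[ℂ] T.minus →ₗ[ℂ] g :=
  G.bracket.compl₁₂ T.plus.toSubmodule.subtype T.minus.toSubmodule.subtype

theorem pairing_apply (a : T.plus) (y : T.minus) : pairing T a y = G.bracket a y := rfl

theorem lie_pairing (x : g) (a : T.plus) (y : T.minus) :
    ⁅x, pairing T a y⁆ = pairing T ⁅x, a⁆ y + pairing T a ⁅x, y⁆ :=
  G.lie_bracket x a y

theorem pairing_lie_add (a : T.plus) (y z : T.minus) : ⁅pairing T a y, z⁆ + ⁅pairing T a z, y⁆ = 0 := by
  apply Subtype.ext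
  have h := G.jacobi (a : V) y z
  rw [T.bracket_minus y y.2 z z.2, zero_lie, add_zero, G.bracket_comm z a] at h
  exact h

theorem pairing_lie_self (a : T.plus) (y : T.minus) : ⁅pairing T a y, y⁆ = 0 := by
  have h := pairing_lie_add T a y y
  rw [← two_smul ℂ] at h
  exact (smul_eq_zero.1 h).resolve_left two_ne_zero

theorem pairing_lie_plus (a b : T.plus) (y : T.minus) : ⁅pairing T a y, b⁆ + ⁅pairing T b y, a⁆ = 0 := by
  apply Subtype.ext
  have h := G.jacobi (a : V) y b
  rw [T.bracket_plus b b.2 a a.2, zero_lie, add_zero, G.bracket_comm y b] at h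
  exact h

variable (M) in
/-- The action of the negative part on jets. -/
def jetMul : T.minus →ₗ[ℂ] Module.End ℂ (Jet T M) :=
  -- A jet (k, x ↦ x·k, a ↦ a·k) is transformed by the rules x·(yk) = [x, y]k + y(x·k) and a·(yk) =
  -- [a, y]·k - y(a·k).
  LinearMap.mk₂ ℂ (fun y q => (ι ℂ y • q.1,
      (LinearMap.toSpanSingleton (ExteriorAlgebra ℂ T.minus) _ q.1).restrictScalars ℂ ∘ₗ ι ℂ ∘ₗ
          (LieModule.toEnd ℂ g T.minus : g →ₗ[ℂ] Module.End ℂ T.minus).flip y + ι ℂ y • q.2.1,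
      q.2.1 ∘ₗ (pairing T).flip y - ι ℂ y • q.2.2))
    (fun y z q => by
      refine Prod.ext ?_ (Prod.ext (LinearMap.ext fun x => ?_) (LinearMap.ext fun a => ?_))
      · simp [add_smul]
      · simp [add_smul]; abel
      · simp [add_smul]; abel)
    (fun c y q => by
      refine Prod.ext ?_ (Prod.ext (LinearMap.ext fun x => ?_) (LinearMap.ext fun a => ?_))
      · simp
      · simp
      · simp [smul_sub])
    (fun y q r => by
      refine Prod.ext ?_ (Prod.ext (LinearMap.ext fun x => ?_) (LinearMap.ext fun a => ?_))
      · simp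
      · simp; abel
      · simp; abel)
    (fun c y q => by
      refine Prod.ext ?_ (Prod.ext (LinearMap.ext fun x => ?_) (LinearMap.ext fun a => ?_))
      · simp [smul_comm c]
      · simp [smul_comm c]
      · simp [smul_sub, smul_comm c])

theorem jetMul_fst (y : T.minus) (q : Jet T M) : (jetMul T M y q).1 = ι ℂ y • q.1 := rfl

theorem jetMul_even (y : T.minus) (q : Jet T M) (x : g) :
    (jetMul T M y q).2.1 x = ι ℂ ⁅x, y⁆ • q.1 + ι ℂ y • q.2.1 x := rfl

theorem jetMul_plus (y : T.minus) (q : Jet T M) (a : T.plus) :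
    (jetMul T M y q).2.2 a = q.2.1 (pairing T a y) - ι ℂ y • q.2.2 a := rfl

/-- This is what extends multiplication on jets to the exterior algebra. In the positive component
it rests on [[a, y], y] = 0, a case of the super Jacobi identity. -/
theorem jetMul_mul_self (y : T.minus) : jetMul T M y * jetMul T M y = 0 := by
  have h : ∀ k : Space T M, ι ℂ y • ι ℂ y • k = 0 := fun k => by
    rw [smul_smul, ι_sq_zero, zero_smul]
  refine LinearMap.ext fun q => Prod.ext ?_ (Prod.ext (LinearMap.ext fun x => ?_)
    (LinearMap.ext fun a => ?_))
  · exact h _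
  · change ι ℂ ⁅x, y⁆ • ι ℂ y • q.1 + ι ℂ y • (ι ℂ ⁅x, y⁆ • q.1 + ι ℂ y • q.2.1 x) = 0
    rw [smul_add, h, add_zero, Exterior.ι_smul_ι_smul, neg_add_cancel]
  · have h0 : ι ℂ ⁅pairing T a y, y⁆ • q.1 = 0 := by
      rw [pairing_lie_self, map_zero]; exact zero_smul _ q.1
    change (ι ℂ ⁅pairing T a y, y⁆ • q.1 + ι ℂ y • q.2.1 (pairing T a y)) -
      ι ℂ y • (q.2.1 (pairing T a y) - ι ℂ y • q.2.2 a) = 0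
    rw [h0, smul_sub, h, sub_zero, zero_add, sub_self]

/-- The jet of an element of the Kac module. -/
def jet : Space T M →ₗ[ℂ] Jet T M :=
  -- The jet of 1 ⊗ m prescribes the action on M: 𝔤₀ acts through `ρ` and 𝔤₁ acts by zero.
  TensorProduct.lift (LinearMap.lcomp ℂ _ (LinearMap.prod (TensorProduct.mk ℂ _ M 1)
      (LinearMap.prod ((LinearMap.compRight ℂ (TensorProduct.mk ℂ _ M 1)) ∘ₗ ρ.flip) 0)) ∘ₗ
    (ExteriorAlgebra.lift ℂ ⟨jetMul T M, jetMul_mul_self T⟩).toLinearMap)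

theorem jet_one (m : M) : jet T ρ (1 ⊗ₜ m) =
    (1 ⊗ₜ m, TensorProduct.mk ℂ _ M 1 ∘ₗ ρ.flip m, 0) := by
  simp [jet]

theorem jet_mul (y : T.minus) (k : Space T M) : jet T ρ (ι ℂ y • k) = jetMul T M y (jet T ρ k) := by
  induction k using TensorProduct.induction_on with
  | zero => simp
  | add k k' hk hk' => simp only [smul_add, map_add, hk, hk']
  | tmul a m =>
    rw [TensorProduct.smul_tmul', smul_eq_mul]
    simp [jet]

/-- The action of the even part. -/
def evenAct : g →ₗ[ℂ] Module.End ℂ (Space T M) :=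
  (LinearMap.fst ℂ _ _ ∘ₗ LinearMap.snd ℂ _ _ ∘ₗ jet T ρ).flip

/-- The action of the positive part. -/
def plusAct : T.plus →ₗ[ℂ] Module.End ℂ (Space T M) :=
  (LinearMap.snd ℂ _ _ ∘ₗ LinearMap.snd ℂ _ _ ∘ₗ jet T ρ).flip

variable (M) in
/-- The action of the negative part. -/
def minusAct : T.minus →ₗ[ℂ] Module.End ℂ (Space T M) :=
  (Algebra.lsmul ℂ ℂ (Space T M)).toLinearMap ∘ₗ ι ℂ

theorem minusAct_apply (y : T.minus) (k : Space T M) : minusAct T M y k = ι ℂ y • k := rfl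

theorem jet_fst (k : Space T M) : (jet T ρ k).1 = k := by
  induction k using Exterior.induction_tensor with
  | one m => rw [jet_one]
  | add k k' hk hk' => rw [map_add, Prod.fst_add, hk, hk']
  | mul y k hk => rw [jet_mul, jetMul_fst, hk]

theorem evenAct_one (x : g) (m : M) : evenAct T ρ x (1 ⊗ₜ m) = 1 ⊗ₜ ρ x m := by
  change (jet T ρ (1 ⊗ₜ m)).2.1 x = _
  rw [jet_one]; rfl

theorem evenAct_mul (x : g) (y : T.minus) (k : Space T M) :
    evenAct T ρ x (ι ℂ y • k) = ι ℂ ⁅x, y⁆ • k + ι ℂ y • evenAct T ρ x k := by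
  change (jet T ρ (ι ℂ y • k)).2.1 x = _
  rw [jet_mul, jetMul_even, jet_fst]; rfl

theorem plusAct_one (a : T.plus) (m : M) : plusAct T ρ a (1 ⊗ₜ m) = 0 := by
  change (jet T ρ (1 ⊗ₜ m)).2.2 a = _
  rw [jet_one]; rfl

theorem plusAct_mul (a : T.plus) (y : T.minus) (k : Space T M) :
    plusAct T ρ a (ι ℂ y • k) = evenAct T ρ (pairing T a y) k - ι ℂ y • plusAct T ρ a k := by
  change (jet T ρ (ι ℂ y • k)).2.2 a = _
  rw [jet_mul, jetMul_plus]; rfl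

variable {ρ}

theorem evenAct_lie (hρ : ∀ x y, ρ ⁅x, y⁆ = ρ x * ρ y - ρ y * ρ x) (x x' : g) (k : Space T M) :
    evenAct T ρ ⁅x, x'⁆ k = evenAct T ρ x (evenAct T ρ x' k) - evenAct T ρ x' (evenAct T ρ x k) := by
  induction k using Exterior.induction_tensor with
  | one m =>
    simp only [evenAct_one, hρ, LinearMap.sub_apply, Module.End.mul_apply, TensorProduct.tmul_sub]
  | add k k' hk hk' => simp only [map_add, hk, hk']; abel
  | mul y k hk =>
    have h1 : ι ℂ ⁅⁅x, x'⁆, y⁆ • k = ι ℂ ⁅x, ⁅x', y⁆⁆ • k - ι ℂ ⁅x', ⁅x, y⁆⁆ • k := by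
      rw [lie_lie, map_sub]
      exact sub_smul _ _ k
    simp only [evenAct_mul, map_add, hk, h1, smul_sub]
    abel

theorem plusAct_lie (hρ : ∀ x y, ρ ⁅x, y⁆ = ρ x * ρ y - ρ y * ρ x) (x : g) (a : T.plus)
    (k : Space T M) : plusAct T ρ ⁅x, a⁆ k =
      evenAct T ρ x (plusAct T ρ a k) - plusAct T ρ a (evenAct T ρ x k) := by
  induction k using Exterior.induction_tensor with
  | one m => simp only [plusAct_one, evenAct_one, map_zero, sub_zero]
  | add k k' hk hk' => simp only [map_add, hk, hk']; abel
  | mul y k hk =>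
    have h1 : pairing T ⁅x, a⁆ y = ⁅x, pairing T a y⁆ - pairing T a ⁅x, y⁆ := by
      rw [lie_pairing, add_sub_cancel_right]
    simp only [evenAct_mul, plusAct_mul, map_add, map_sub, hk, h1, LinearMap.sub_apply, smul_sub,
      evenAct_lie T hρ]
    abel

/-- Moving both operators past `y` leaves the action of [[a, y], b] + [[b, y], a], which is zero by
the Jacobi identity since 𝔤₁ has zero bracket with itself. -/
theorem plusAct_anticomm (hρ : ∀ x y, ρ ⁅x, y⁆ = ρ x * ρ y - ρ y * ρ x) (a b : T.plus)
    (k : Space T M) : plusAct T ρ a (plusAct T ρ b k) + plusAct T ρ b (plusAct T ρ a k) = 0 := by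
  induction k using Exterior.induction_tensor with
  | one m => simp only [plusAct_one, map_zero, add_zero]
  | add k k' hk hk' =>
    simp only [map_add]
    rw [add_add_add_comm, hk, hk', add_zero]
  | mul y k hk =>
    have h1 := plusAct_lie T hρ (pairing T a y) b k
    have h2 := plusAct_lie T hρ (pairing T b y) a k
    have h3 : plusAct T ρ ⁅pairing T a y, b⁆ k + plusAct T ρ ⁅pairing T b y, a⁆ k = 0 := by
      rw [← LinearMap.add_apply, ← map_add, pairing_lie_plus, map_zero, LinearMap.zero_apply]
    have h4 : ι ℂ y • plusAct T ρ a (plusAct T ρ b k) + ι ℂ y • plusAct T ρ b (plusAct T ρ a k) = 0 := by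
      rw [← smul_add, hk, smul_zero]
    rw [h1, h2] at h3
    simp only [plusAct_mul, map_sub]
    rw [← sub_eq_zero] at h3 h4 ⊢
    rw [← neg_eq_zero]
    refine Eq.trans ?_ ((congrArg₂ (· - ·) h3 h4).trans (sub_zero 0))
    abel

/-- The action of the odd part. -/
def oddAct (ρ : g →ₗ[ℂ] Module.End ℂ M) : V →ₗ[ℂ] Module.End ℂ (Space T M) :=
  minusAct T M ∘ₗ T.minus.toSubmodule.projectionOnto T.plus.toSubmodule
      (LieSubmodule.isCompl_toSubmodule.2 T.isCompl) +
    plusAct T ρ ∘ₗ T.plus.toSubmodule.projectionOnto T.minus.toSubmodule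
      (LieSubmodule.isCompl_toSubmodule.2 T.isCompl).symm

theorem oddAct_minus (y : T.minus) : oddAct T ρ y = minusAct T M y := by
  have hc := LieSubmodule.isCompl_toSubmodule.2 T.isCompl
  have h1 : T.minus.toSubmodule.projectionOnto T.plus.toSubmodule hc (y : V) = y :=
    Submodule.projectionOnto_apply_left hc y
  have h2 : T.plus.toSubmodule.projectionOnto T.minus.toSubmodule hc.symm (y : V) = 0 :=
    Submodule.projectionOnto_apply_right hc.symm y
  rw [oddAct, LinearMap.add_apply, LinearMap.comp_apply, LinearMap.comp_apply, h1, h2, map_zero,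
    add_zero]

theorem oddAct_plus (a : T.plus) : oddAct T ρ a = plusAct T ρ a := by
  have hc := LieSubmodule.isCompl_toSubmodule.2 T.isCompl
  have h1 : T.minus.toSubmodule.projectionOnto T.plus.toSubmodule hc (a : V) = 0 :=
    Submodule.projectionOnto_apply_right hc a
  have h2 : T.plus.toSubmodule.projectionOnto T.minus.toSubmodule hc.symm (a : V) = a :=
    Submodule.projectionOnto_apply_left hc.symm a
  rw [oddAct, LinearMap.add_apply, LinearMap.comp_apply, LinearMap.comp_apply, h1, h2, map_zero,
    zero_add]

theorem exists_eq_add (v : V) : ∃ (y : T.minus) (a : T.plus), v = y + a := by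
  have hv : v ∈ T.minus ⊔ T.plus := by rw [T.isCompl.sup_eq_top]; trivial
  obtain ⟨y, hy, a, ha, rfl⟩ := (LieSubmodule.mem_sup _ _ _).1 hv
  exact ⟨⟨y, hy⟩, ⟨a, ha⟩, rfl⟩

/-- The representation of the enveloping algebra on the Kac module. -/
def kacRep (hρ : ∀ x y, ρ ⁅x, y⁆ = ρ x * ρ y - ρ y * ρ x) :
    G.Enveloping →ₐ[ℂ] Module.End ℂ (Space T M) :=
  G.liftEnveloping (A := Module.End ℂ (Space T M)) (evenAct T ρ) (oddAct T ρ)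
    (fun x y => LinearMap.ext fun k => (evenAct_lie T hρ x y k).symm)
    (fun x v => by
      obtain ⟨y, a, rfl⟩ := exists_eq_add T v
      refine LinearMap.ext fun k => ?_
      have h1 := evenAct_mul T ρ x y k
      have h2 := plusAct_lie T hρ x a k
      rw [lie_add, ← LieSubmodule.coe_bracket, ← LieSubmodule.coe_bracket]
      simp only [map_add, oddAct_minus, oddAct_plus, LinearMap.sub_apply, Module.End.mul_apply,
        LinearMap.add_apply, minusAct_apply, h1, h2]
      abel)
    (fun v w => by
      obtain ⟨y, a, rfl⟩ := exists_eq_add T v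
      obtain ⟨z, b, rfl⟩ := exists_eq_add T w
      refine LinearMap.ext fun k => ?_
      have h1 := plusAct_mul T ρ a z k
      have h2 := plusAct_mul T ρ b y k
      have h3 := Exterior.ι_smul_ι_smul y z k
      have h4 := plusAct_anticomm T hρ a b k
      have h5 : G.bracket ((y : V) + a) (z + b) = pairing T a z + pairing T b y := by
        simp only [map_add, LinearMap.add_apply, pairing_apply]
        rw [T.bracket_minus y y.2 z z.2, T.bracket_plus a a.2 b b.2, G.bracket_comm y b]
        abel
      rw [h5]
      simp only [map_add, oddAct_minus, oddAct_plus, Module.End.mul_apply,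
        LinearMap.add_apply, minusAct_apply, h1, h2, h3]
      rw [← sub_eq_zero]
      refine Eq.trans ?_ h4
      abel)

theorem kacRep_even (hρ : ∀ x y, ρ ⁅x, y⁆ = ρ x * ρ y - ρ y * ρ x) (x : g) :
    kacRep T hρ (G.ιEven x) = evenAct T ρ x :=
  liftEnveloping_ιEven (A := Module.End ℂ (Space T M)) ..

theorem kacRep_odd (hρ : ∀ x y, ρ ⁅x, y⁆ = ρ x * ρ y - ρ y * ρ x) (v : V) :
    kacRep T hρ (G.ιOdd v) = oddAct T ρ v :=
  liftEnveloping_ιOdd (A := Module.End ℂ (Space T M)) ..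

end Kac

end

noncomputable section
set_option linter.unusedSectionVars false

/-! ### Smallest submodules pass from M to the Kac module. -/

namespace Kac

open ExteriorAlgebra LieSuperalgebra

theorem tmul_ne_zero {E M : Type*} [AddCommGroup E] [Module ℂ E] [AddCommGroup M] [Module ℂ M]
    {t : E} {m : M} (ht : t ≠ 0) (hm : m ≠ 0) : t ⊗ₜ[ℂ] m ≠ 0 := by
  intro h
  obtain ⟨f, hf⟩ : ∃ f : Module.Dual ℂ E, f t ≠ 0 := by
    by_contra! h'
    exact ht ((Module.forall_dual_apply_eq_zero_iff ℂ t).1 h')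
  have h1 := congrArg ((TensorProduct.lid ℂ M).toLinearMap ∘ₗ LinearMap.rTensor M f) h
  rw [map_zero, LinearMap.comp_apply, LinearMap.rTensor_tmul, LinearEquiv.coe_coe,
    TensorProduct.lid_tmul] at h1
  exact (smul_eq_zero.1 h1).elim hf hm

variable {g V : Type*} [LieRing g] [LieAlgebra ℂ g] [AddCommGroup V] [Module ℂ V]
  [LieRingModule g V] [LieModule ℂ g V] {G : LieSuperalgebra g V} (T : G.TypeI)
  {M : Type*} [AddCommGroup M] [Module ℂ M] {ρ : g →ₗ[ℂ] Module.End ℂ M}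

/-- The even part acts diagonally on the tensor product. It matters that `a'` does not depend on
`m`. -/
theorem exists_evenAct_tmul (x : g) (a : ExteriorAlgebra ℂ T.minus) :
    ∃ a', ∀ m, evenAct T ρ x (a ⊗ₜ m) = a' ⊗ₜ m + a ⊗ₜ ρ x m := by
  induction a using CliffordAlgebra.left_induction with
  | algebraMap r =>
    refine ⟨0, fun m => ?_⟩
    rw [Algebra.algebraMap_eq_smul_one, TensorProduct.smul_tmul, evenAct_one, map_smul,
      TensorProduct.zero_tmul, zero_add, TensorProduct.smul_tmul]
  | add a b ha hb =>
    obtain ⟨a', ha⟩ := ha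
    obtain ⟨b', hb⟩ := hb
    refine ⟨a' + b', fun m => ?_⟩
    rw [TensorProduct.add_tmul, map_add, ha, hb, TensorProduct.add_tmul, TensorProduct.add_tmul]
    abel
  | ι_mul a y ha =>
    obtain ⟨a', ha⟩ := ha
    refine ⟨ι ℂ ⁅x, y⁆ * a + ι ℂ y * a', fun m => ?_⟩
    have := evenAct_mul T ρ x y (a ⊗ₜ m)
    rw [ha, smul_add] at this
    simp only [TensorProduct.smul_tmul', smul_eq_mul] at this
    rw [TensorProduct.add_tmul, add_assoc]
    exact this

/-- If `M` has a smallest nonzero submodule, then so does the Kac module of `M`. -/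
theorem exists_least_submodule [FiniteDimensional ℂ V]
    (hρ : ∀ x y, ρ ⁅x, y⁆ = ρ x * ρ y - ρ y * ρ x) {S : Submodule ℂ M} (hS0 : S ≠ ⊥)
    (hS : ∀ N : Submodule ℂ M, N ≠ ⊥ → (∀ x, ∀ u ∈ N, ρ x u ∈ N) → S ≤ N) :
    ∃ S' : Submodule ℂ (Space T M), S' ≠ ⊥ ∧ (∀ u, ∀ k ∈ S', kacRep T hρ u k ∈ S') ∧
      ∀ N : Submodule ℂ (Space T M), N ≠ ⊥ → (∀ u, ∀ k ∈ N, kacRep T hρ u k ∈ N) → S' ≤ N := by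
  obtain ⟨s, hs, hs0⟩ := Submodule.exists_mem_ne_zero_of_ne_bot hS0
  obtain ⟨t, ht, htop⟩ := Exterior.exists_top_form T.minus
  have hι : ∀ {N : Submodule ℂ (Space T M)}, (∀ u, ∀ k ∈ N, kacRep T hρ u k ∈ N) →
      ∀ y : T.minus, ∀ k ∈ N, ι ℂ y • k ∈ N := fun hN y k hk => by
    have := hN (G.ιOdd y) k hk
    rwa [kacRep_odd, oddAct_minus, minusAct_apply] at this
  have hexists : ∀ N : Submodule ℂ (Space T M), N ≠ ⊥ → (∀ u, ∀ k ∈ N, kacRep T hρ u k ∈ N) →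
      ∃ m, t ⊗ₜ m ∈ N ∧ t ⊗ₜ[ℂ] m ≠ 0 := fun N hN0 hN => by
    obtain ⟨k, hk, hk0, hk'⟩ := Exterior.exists_mem_forall_smul_eq_zero hN0 (hι hN)
    obtain ⟨m, rfl⟩ := htop k hk'
    exact ⟨m, hk, hk0⟩
  -- The whole module is nonzero, so it contains a nonzero vector of the form t ⊗ m.
  have ht0 : t ≠ 0 := by
    have h1 : (⊤ : Submodule ℂ (Space T M)) ≠ ⊥ := fun h =>
      tmul_ne_zero (one_ne_zero (α := ExteriorAlgebra ℂ T.minus)) hs0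
        ((Submodule.mem_bot ℂ).1 (h ▸ Submodule.mem_top))
    obtain ⟨m, -, hm⟩ := hexists ⊤ h1 fun _ _ _ => Submodule.mem_top
    rintro rfl
    exact hm (TensorProduct.zero_tmul _ m)
  -- Applying x to y(t ⊗ s) = 0 shows that a' ⊗ s is killed by 𝔤₋₁. So it equals t ⊗ m' for some m',
  -- and applying a functional nonzero at `s` makes a' a multiple of `t`.
  have heven : ∀ x, ∃ c : ℂ, ∀ m, evenAct T ρ x (t ⊗ₜ m) = t ⊗ₜ (c • m + ρ x m) := fun x => by
    obtain ⟨a', ha'⟩ := exists_evenAct_tmul (ρ := ρ) T x t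
    have hιt : ∀ (y : T.minus) (m : M), ι ℂ y • (t ⊗ₜ[ℂ] m) = 0 := fun y m => by
      rw [TensorProduct.smul_tmul', smul_eq_mul, ht, TensorProduct.zero_tmul]
    obtain ⟨m', hm'⟩ := htop (a' ⊗ₜ s) fun y => by
      have h := evenAct_mul T ρ x y (t ⊗ₜ s)
      rw [hιt, hιt, map_zero, ha', smul_add, hιt, zero_add, add_zero] at h
      exact h.symm
    obtain ⟨f, hf⟩ : ∃ f : Module.Dual ℂ M, f s ≠ 0 := by
      by_contra! h'
      exact hs0 ((Module.forall_dual_apply_eq_zero_iff ℂ s).1 h')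
    have h1 := congrArg ((TensorProduct.rid ℂ (ExteriorAlgebra ℂ T.minus)).toLinearMap ∘ₗ
      LinearMap.lTensor _ f) hm'
    rw [LinearMap.comp_apply, LinearMap.comp_apply, LinearMap.lTensor_tmul, LinearMap.lTensor_tmul,
      LinearEquiv.coe_coe, TensorProduct.rid_tmul, TensorProduct.rid_tmul] at h1
    have h2 : a' = ((f s)⁻¹ * f m') • t := by rw [mul_smul, ← h1, inv_smul_smul₀ hf]
    refine ⟨(f s)⁻¹ * f m', fun m => ?_⟩
    rw [ha', TensorProduct.tmul_add, h2, TensorProduct.smul_tmul]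
  have hmem : ∀ N : Submodule ℂ (Space T M), N ≠ ⊥ → (∀ u, ∀ k ∈ N, kacRep T hρ u k ∈ N) →
      t ⊗ₜ s ∈ N := fun N hN0 hN => by
    obtain ⟨m, hm, hm0⟩ := hexists N hN0 hN
    -- By `heven`, the vectors u with t ⊗ u ∈ N form a 𝔤₀-submodule of M: the action on t ⊗ M
    -- differs from that on M only by a scalar.
    refine hS (N.comap (TensorProduct.mk ℂ _ M t)) (fun h => ?_) (fun x u hu => ?_) hs
    · have : m ∈ N.comap (TensorProduct.mk ℂ _ M t) := hm
      rw [h, Submodule.mem_bot] at this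
      rw [this, TensorProduct.tmul_zero] at hm0
      exact hm0 rfl
    · obtain ⟨c, hc⟩ := heven x
      have h1 := hN (G.ιEven x) _ hu
      rw [kacRep_even] at h1
      have h3 := sub_mem h1 (N.smul_mem c hu)
      rw [TensorProduct.mk_apply, hc, TensorProduct.tmul_add, ← TensorProduct.tmul_smul,
        add_sub_cancel_left] at h3
      exact h3
  refine ⟨sInf {N | N ≠ ⊥ ∧ ∀ u, ∀ k ∈ N, kacRep T hρ u k ∈ N}, fun h => ?_, fun u k hk => ?_,
    fun N hN0 hN => sInf_le ⟨hN0, hN⟩⟩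
  · refine tmul_ne_zero ht0 hs0 ((Submodule.mem_bot ℂ).1 (h ▸ ?_))
    exact Submodule.mem_sInf.2 fun N hN => hmem N hN.1 hN.2
  · rw [Submodule.mem_sInf] at hk ⊢
    exact fun N hN => hN.2 u k (hk N hN)

end Kac

end

noncomputable section
set_option linter.unusedSectionVars false

namespace LieSuperalgebra

/-! ### The universal property of the Verma supermodule. -/

section VermaModules

variable {g V : Type*} [LieRing g] [LieAlgebra ℂ g] [AddCommGroup V] [Module ℂ V]
  [LieRingModule g V] [LieModule ℂ g V] {G : LieSuperalgebra g V} {B : G.Sub} (χ : B.Character)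

theorem envelopingMap_smul_toVerma (b : B.toLieSuperalgebra.Enveloping) :
    B.envelopingMap b • toVerma χ 1 = χ.rep b 1 • toVerma χ 1 := by
  rw [← toVerma_mul, mul_one, ← map_smul, ← sub_eq_zero]
  have h : (B.envelopingMap b) ⊗ₜ[ℂ] (1 : ℂ) - (1 : G.Enveloping) ⊗ₜ[ℂ] (χ.rep b 1) ∈
      inducedRelations B.envelopingMap χ.rep :=
    Submodule.subset_span ⟨1, b, 1, by rw [one_mul]⟩
  have h' := (Submodule.Quotient.mk_eq_zero (inducedRelations B.envelopingMap χ.rep)).2 h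
  refine Eq.trans ?_ h'
  have : (1 : G.Enveloping) ⊗ₜ[ℂ] (χ.rep b 1) = (χ.rep b 1 • (1 : G.Enveloping)) ⊗ₜ[ℂ] (1 : ℂ) := by
    rw [TensorProduct.smul_tmul, smul_eq_mul, mul_one]
  rw [this]
  rfl

/-- The universal property of the Verma supermodule. -/
theorem exists_verma_lift {E : Type*} [AddCommGroup E] [Module ℂ E]
    (R : G.Enveloping →ₐ[ℂ] Module.End ℂ E) {v : E}
    (hv : ∀ b, R (B.envelopingMap b) v = χ.rep b 1 • v) :
    ∃ Φ : Verma χ →ₗ[ℂ] E, Φ (toVerma χ 1) = v ∧ ∀ (a : G.Enveloping) m, Φ (a • m) = R a (Φ m) := by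
  let _ : Module G.Enveloping E := Module.compHom E R.toRingHom
  have hsmul : ∀ (a : G.Enveloping) (e : E), a • e = R a e := fun _ _ => rfl
  have _ : IsScalarTower ℂ G.Enveloping E := ⟨fun c a e => by
    rw [hsmul, hsmul, map_smul, LinearMap.smul_apply]⟩
  let F : G.Enveloping ⊗[ℂ] ℂ →ₗ[G.Enveloping] E :=
    LinearMap.toSpanSingleton G.Enveloping E v ∘ₗ
      (TensorProduct.AlgebraTensorModule.rid ℂ G.Enveloping G.Enveloping).toLinearMap
  have hF : ∀ a (z : ℂ), F (a ⊗ₜ z) = z • R a v := fun a z => by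
    change (z • a) • v = _
    rw [hsmul, map_smul, LinearMap.smul_apply]
  have hle : inducedRelations B.envelopingMap χ.rep ≤ LinearMap.ker F := by
    rw [inducedRelations, Submodule.span_le]
    rintro _ ⟨a, b, z, rfl⟩
    have hz : χ.rep b z = z * χ.rep b 1 := by
      rw [← smul_eq_mul, ← map_smul, smul_eq_mul, mul_one]
    rw [SetLike.mem_coe, LinearMap.mem_ker, map_sub, hF, hF, map_mul, Module.End.mul_apply, hv,
      map_smul, smul_smul, hz, sub_self]
  let Φ : Verma χ →ₗ[G.Enveloping] E := (inducedRelations B.envelopingMap χ.rep).liftQ F hle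
  refine ⟨Φ.restrictScalars ℂ, ?_, fun a m => map_smul Φ a m⟩
  change F (1 ⊗ₜ (1 : ℂ)) = v
  rw [hF, map_one, one_smul]
  rfl

end VermaModules

end LieSuperalgebra

/-! ### The Verma supermodule is a Kac module. -/

namespace Kac

open ExteriorAlgebra LieSuperalgebra

universe u₁ u₂ u₃

variable {g : Type u₁} {V : Type u₂} [LieRing g] [LieAlgebra ℂ g] [AddCommGroup V] [Module ℂ V]
  [LieRingModule g V] [LieModule ℂ g V] {G : LieSuperalgebra g V} (T : G.TypeI) {B : G.Sub}
  {χ : B.Character} {M : Type u₃} [AddCommGroup M] [Module ℂ M] {ρ : g →ₗ[ℂ] Module.End ℂ M} {m₀ : M}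

theorem kacRep_envelopingMap (hodd : B.odd = T.plus.toSubmodule)
    (hρ : ∀ x y, ρ ⁅x, y⁆ = ρ x * ρ y - ρ y * ρ x) (hm₀ : ∀ x : B.even, ρ x m₀ = χ.toFun x • m₀)
    (b : B.toLieSuperalgebra.Enveloping) :
    kacRep T hρ (B.envelopingMap b) (1 ⊗ₜ m₀) = χ.rep b 1 • 1 ⊗ₜ m₀ := by
  refine enveloping_induction _ (p := fun b => kacRep T hρ (B.envelopingMap b) (1 ⊗ₜ m₀) =
    χ.rep b 1 • 1 ⊗ₜ m₀) b (fun c => ?_) (fun x => ?_) (fun v => ?_) (fun a b ha hb => ?_)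
    (fun a b ha hb => ?_)
  · simp only [AlgHom.commutes, Module.algebraMap_end_apply, smul_eq_mul, mul_one]
  · rw [Sub.envelopingMap_ιEven, kacRep_even, evenAct_one, hm₀, Sub.Character.rep_ιEven,
      TensorProduct.tmul_smul]
    simp
  · have hv : (v : V) ∈ T.plus.toSubmodule := hodd ▸ v.2
    have h := oddAct_plus (ρ := ρ) T ⟨v, hv⟩
    rw [Sub.envelopingMap_ιOdd, kacRep_odd, h, plusAct_one, Sub.Character.rep_ιOdd,
      LinearMap.zero_apply, zero_smul]
  · have h : χ.rep a (χ.rep b 1) = χ.rep b 1 * χ.rep a 1 := by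
      rw [← smul_eq_mul, ← map_smul, smul_eq_mul, mul_one]
    rw [map_mul, map_mul, map_mul, Module.End.mul_apply, Module.End.mul_apply, hb, map_smul, ha,
      smul_smul, h]
  · simp only [map_add, LinearMap.add_apply, ha, hb, add_smul]

/-- The Verma supermodule is the Kac module of the Verma module of the even part. -/
theorem exists_verma_equiv (hodd : B.odd = T.plus.toSubmodule)
    (hM : Reductive.IsVerma.{u₁, u₃, max u₁ u₂} χ.toFun ρ m₀) :
    ∃ Φ : Verma χ ≃ₗ[ℂ] Space T M, ∀ (a : G.Enveloping) m, Φ (a • m) = kacRep T hM.map_lie a (Φ m) := by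
  obtain ⟨Φ, hΦ1, hΦ⟩ := exists_verma_lift χ (kacRep T hM.map_lie)
    (kacRep_envelopingMap T hodd hM.map_lie hM.apply_generator)
  let τ : g →ₗ[ℂ] Module.End ℂ (Verma χ) :=
    (Algebra.lsmul ℂ ℂ (Verma χ)).toLinearMap ∘ₗ G.ιEven
  obtain ⟨f, hf1, hf⟩ := hM.exists_lift (Verma χ) τ
    (fun x y => LinearMap.ext fun m => by
      change G.ιEven ⁅x, y⁆ • m = G.ιEven x • G.ιEven y • m - G.ιEven y • G.ιEven x • m
      rw [← G.ιEven_mul, sub_smul, mul_smul, mul_smul])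
    (toVerma χ 1) (fun x => by
      have := envelopingMap_smul_toVerma χ (B.toLieSuperalgebra.ιEven x)
      rw [Sub.envelopingMap_ιEven, Sub.Character.rep_ιEven] at this
      refine this.trans ?_
      simp)
  replace hf : ∀ x u, f (ρ x u) = G.ιEven x • f u := hf
  let j : ExteriorAlgebra ℂ T.minus →ₐ[ℂ] G.Enveloping := ExteriorAlgebra.lift ℂ
    ⟨G.ιOdd ∘ₗ T.minus.toSubmodule.subtype, fun y => by
      have h := G.ιOdd_mul y y
      rw [T.bracket_minus y y.2 y y.2, map_zero, ← two_smul ℂ] at h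
      exact (smul_eq_zero.1 h).resolve_left two_ne_zero⟩
  have hj : ∀ y : T.minus, j (ι ℂ y) = G.ιOdd y := fun y => ExteriorAlgebra.lift_ι_apply ..
  -- `Φ` comes from the universal property of the Verma supermodule, `Ψ` from those of M and of the
  -- exterior algebra. `Φ ∘ Ψ` is the identity by induction, so surjectivity of `Ψ` makes them
  -- inverse to each other.
  let Ψ : Space T M →ₗ[ℂ] Verma χ := TensorProduct.lift
    (LinearMap.lcomp ℂ _ f ∘ₗ (Algebra.lsmul ℂ ℂ (Verma χ)).toLinearMap ∘ₗ j.toLinearMap)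
  have hΨ : ∀ a m, Ψ (a ⊗ₜ m) = j a • f m := fun a m => rfl
  have hΨ1 : ∀ m, Ψ (1 ⊗ₜ m) = f m := fun m => by rw [hΨ, map_one, one_smul]
  have hΨι : ∀ (y : T.minus) k, Ψ (ι ℂ y • k) = G.ιOdd y • Ψ k := fun y k => by
    induction k using TensorProduct.induction_on with
    | zero => rw [smul_zero, map_zero, smul_zero]
    | add k k' hk hk' => rw [smul_add, map_add, map_add, hk, hk', smul_add]
    | tmul a m => rw [TensorProduct.smul_tmul', smul_eq_mul, hΨ, hΨ, map_mul, hj, mul_smul]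
  have hΦf : ∀ m, Φ (f m) = 1 ⊗ₜ m := fun m => by
    have : LinearMap.eqLocus (Φ ∘ₗ f) (TensorProduct.mk ℂ _ M 1) = ⊤ := by
      refine hM.eq_top _ ?_ fun x u hu => ?_
      · change Φ (f m₀) = 1 ⊗ₜ m₀
        rw [hf1, hΦ1]
      · change Φ (f u) = 1 ⊗ₜ u at hu
        change Φ (f (ρ x u)) = 1 ⊗ₜ ρ x u
        rw [hf, hΦ, hu, kacRep_even, evenAct_one]
    have hm : m ∈ LinearMap.eqLocus (Φ ∘ₗ f) (TensorProduct.mk ℂ _ M 1) := this ▸ Submodule.mem_top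
    exact hm
  have hΦΨ : ∀ k, Φ (Ψ k) = k := fun k => by
    induction k using Exterior.induction_tensor with
    | one m => rw [hΨ1, hΦf]
    | add k k' hk hk' => rw [map_add, map_add, hk, hk']
    | mul y k hk => rw [hΨι, hΦ, hk, kacRep_odd, oddAct_minus, minusAct_apply]
  have heven : ∀ x k, G.ιEven x • Ψ k = Ψ (evenAct T ρ x k) := fun x k => by
    induction k using Exterior.induction_tensor with
    | one m => rw [evenAct_one, hΨ1, hΨ1, hf]
    | add k k' hk hk' => rw [map_add, map_add, map_add, smul_add, hk, hk']
    | mul y k hk =>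
      have h := G.ιEven_mul_ιOdd x y
      rw [sub_eq_iff_eq_add] at h
      rw [evenAct_mul, map_add, hΨι, hΨι, hΨι, ← hk, smul_smul, smul_smul, ← add_smul, h]
      rfl
  -- The vectors whose image is killed by 𝔤₁ form a 𝔤₀-submodule of M, because 𝔤₁ is stable under
  -- 𝔤₀; it contains the generator.
  have hplusf : ∀ m, ∀ a : T.plus, G.ιOdd a • f m = 0 := by
    have : (⨅ a : T.plus, LinearMap.ker (Algebra.lsmul ℂ ℂ (Verma χ) (G.ιOdd a) ∘ₗ f)) = ⊤ := by
      refine hM.eq_top _ ?_ fun x u hu => ?_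
      · rw [Submodule.mem_iInf]
        intro a
        change G.ιOdd a • f m₀ = 0
        have ha : (a : V) ∈ B.odd := hodd ▸ a.2
        have := envelopingMap_smul_toVerma χ (B.toLieSuperalgebra.ιOdd ⟨a, ha⟩)
        rw [Sub.envelopingMap_ιOdd, Sub.Character.rep_ιOdd, LinearMap.zero_apply, zero_smul] at this
        rw [hf1]
        exact this
      · rw [Submodule.mem_iInf] at hu ⊢
        replace hu : ∀ a : T.plus, G.ιOdd a • f u = 0 := hu
        intro a
        change G.ιOdd a • f (ρ x u) = 0
        have h := congrArg (· • f u) (G.ιEven_mul_ιOdd x a)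
        have hxa : G.ιOdd ⁅x, (a : V)⁆ • f u = 0 := hu ⁅x, a⁆
        simp only [sub_smul, mul_smul] at h
        rw [hu a, smul_zero, hxa, zero_sub, neg_eq_zero] at h
        rw [hf, h]
    intro m a
    have hm : m ∈ ⨅ a : T.plus, LinearMap.ker (Algebra.lsmul ℂ ℂ (Verma χ) (G.ιOdd a) ∘ₗ f) :=
      this ▸ Submodule.mem_top
    exact (Submodule.mem_iInf _).1 hm a
  have hplus : ∀ (a : T.plus) k, G.ιOdd a • Ψ k = Ψ (plusAct T ρ a k) := fun a k => by
    induction k using Exterior.induction_tensor with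
    | one m => rw [plusAct_one, hΨ1, hplusf, map_zero]
    | add k k' hk hk' => rw [map_add, map_add, map_add, smul_add, hk, hk']
    | mul y k hk =>
      have h := G.ιOdd_mul a y
      rw [← eq_sub_iff_add_eq] at h
      rw [plusAct_mul, map_sub, hΨι, hΨι, ← hk, ← heven, smul_smul, smul_smul, ← sub_smul, h]
      rfl
  have hstable : ∀ (u : G.Enveloping), ∀ m ∈ LinearMap.range Ψ, u • m ∈ LinearMap.range Ψ := fun u =>
    enveloping_induction _ (p := fun u => ∀ m ∈ LinearMap.range Ψ, u • m ∈ LinearMap.range Ψ) u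
      (fun c m hm => by rw [algebraMap_smul]; exact Submodule.smul_mem _ c hm)
      (fun x m hm => by
        obtain ⟨k, rfl⟩ := hm
        exact ⟨_, (heven x k).symm⟩)
      (fun v m hm => by
        obtain ⟨k, rfl⟩ := hm
        obtain ⟨y, a, rfl⟩ := exists_eq_add T v
        rw [map_add, add_smul]
        exact add_mem ⟨_, hΨι y k⟩ ⟨_, (hplus a k).symm⟩)
      (fun a b ha hb m hm => by rw [mul_smul]; exact ha _ (hb m hm))
      (fun a b ha hb m hm => by rw [add_smul]; exact add_mem (ha m hm) (hb m hm))
  -- The range of `Ψ` is stable under the enveloping algebra and contains the generator.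
  have hsurj : Function.Surjective Ψ := fun m => by
    obtain ⟨u, rfl⟩ := toVerma_surjective χ m
    rw [← mul_one u, toVerma_mul]
    exact hstable u _ ⟨1 ⊗ₜ m₀, by rw [hΨ1, hf1]⟩
  have hΨΦ : ∀ m, Ψ (Φ m) = m := fun m => by
    obtain ⟨k, rfl⟩ := hsurj m
    rw [hΦΨ]
  exact ⟨{ Φ with invFun := Ψ, left_inv := hΨΦ, right_inv := hΦΨ }, hΦ⟩

end Kac

end

noncomputable section
set_option linter.unusedSectionVars false

/-! ### The smallest submodule of the Verma supermodule and its grading. -/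

namespace LieSuperalgebra

variable {g V : Type*} [LieRing g] [LieAlgebra ℂ g] [AddCommGroup V] [Module ℂ V]
  [LieRingModule g V] [LieModule ℂ g V] {G : LieSuperalgebra g V} {B : G.Sub}

theorem exists_least_verma_submodule [FiniteDimensional ℂ g] [FiniteDimensional ℂ V]
    [LieAlgebra.HasCentralRadical ℂ g] (T : G.TypeI) (hB : T.IsDistinguishedBorel B)
    (χ : B.Character) : ∃ S : Submodule G.Enveloping (Verma χ), S ≠ ⊥ ∧
      ∀ N : Submodule G.Enveloping (Verma χ), N ≠ ⊥ → S ≤ N := by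
  obtain ⟨M, _, _, ρ, m₀, hM⟩ := Reductive.exists_isVerma hB.1 χ.toFun χ.map_lie
  obtain ⟨S₀, hS₀, -, hmin₀⟩ := hM.exists_least
  obtain ⟨S, hS0, hS, hmin⟩ := Kac.exists_least_submodule T hM.map_lie hS₀ hmin₀
  obtain ⟨Φ, hΦ⟩ := Kac.exists_verma_equiv T hB.2 hM
  refine ⟨{ S.comap Φ.toLinearMap with
    smul_mem' := fun a m hm => ?_ }, fun h => ?_, fun N hN0 m hm => ?_⟩
  · change Φ (a • m) ∈ S
    rw [hΦ]
    exact hS a _ hm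
  · obtain ⟨k, hk, hk0⟩ := Submodule.exists_mem_ne_zero_of_ne_bot hS0
    have h1 := (Submodule.eq_bot_iff _).1 h (Φ.symm k)
      (show Φ (Φ.symm k) ∈ S by rwa [Φ.apply_symm_apply])
    exact hk0 (Φ.symm.map_eq_zero_iff.1 h1)
  · have hle := hmin ((N.restrictScalars ℂ).map Φ.toLinearMap) (fun h => ?_) ?_
    · obtain ⟨m', hm', h⟩ := hle hm
      rwa [Φ.injective h] at hm'
    · obtain ⟨n, hn, hn0⟩ := Submodule.exists_mem_ne_zero_of_ne_bot hN0
      have := (Submodule.eq_bot_iff _).1 h (Φ n) ⟨n, hn, rfl⟩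
      exact hn0 (Φ.map_eq_zero_iff.1 this)
    · rintro u _ ⟨n, hn, rfl⟩
      exact ⟨u • n, N.smul_mem u hn, hΦ u n⟩

/-- A smallest nonzero submodule of a Verma supermodule is graded. -/
theorem isSubsupermodule_of_least {χ : B.Character} (ε : ZMod 2)
    {S : Submodule G.Enveloping (Verma χ)} (hS0 : S ≠ ⊥)
    (hS : ∀ N : Submodule G.Enveloping (Verma χ), N ≠ ⊥ → S ≤ N) :
    (vermaGrading χ ε).IsSubsupermodule S := by
  -- The involution `vermaParity` is normalized for an even generator, so on the grading with
  -- generator of parity `ε` it is c = (-1)^ε times the parity sign.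
  obtain ⟨c, hc, h0, h1⟩ : ∃ c : ℂ, c * c = 1 ∧
      (∀ m ∈ vermaPart χ ε 0, vermaParity χ m = c • m) ∧
      ∀ m ∈ vermaPart χ ε 1, vermaParity χ m = -c • m := by
    have hε : ε = 0 ∨ ε = 1 := by revert ε; decide
    rcases hε with rfl | rfl
    · refine ⟨1, by norm_num, fun m hm => ?_, fun m hm => ?_⟩ <;> rw [vermaParity_of_mem χ hm]
      · simp
      · rw [show ((1 : ZMod 2) - 0).val = 1 from rfl, pow_one]
    · refine ⟨-1, by norm_num, fun m hm => ?_, fun m hm => ?_⟩ <;> rw [vermaParity_of_mem χ hm]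
      · rw [show ((0 : ZMod 2) - 1).val = 1 from rfl, pow_one]
      · simp
  have hsmul : ∀ (r : ℂ) m, vermaParity χ (r • m) = r • vermaParity χ m := fun r m => by
    rw [← algebraMap_smul G.Enveloping r m, map_smulₛₗ]
    change G.parityAut (algebraMap ℂ _ r) • _ = _
    rw [AlgHom.commutes, algebraMap_smul]
  have hdec : ∀ m : Verma χ, ∃ m₀ ∈ vermaPart χ ε 0, ∃ m₁ ∈ vermaPart χ ε 1, m₀ + m₁ = m :=
    fun m => Submodule.mem_sup.1 (by rw [(vermaPart_isCompl χ ε).sup_eq_top]; trivial)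
  have hinv : ∀ m, vermaParity χ (vermaParity χ m) = m := fun m => by
    obtain ⟨m₀, hm₀, m₁, hm₁, rfl⟩ := hdec m
    rw [map_add, h0 _ hm₀, h1 _ hm₁, map_add, hsmul, hsmul, h0 _ hm₀, h1 _ hm₁, smul_smul,
      smul_smul, neg_mul_neg, hc, one_smul, one_smul]
  -- The involution is semilinear for the parity automorphism, so the preimage of `S` is again a
  -- submodule.
  let N : Submodule G.Enveloping (Verma χ) :=
    { carrier := {m | vermaParity χ m ∈ S}
      add_mem' := fun {a b} ha hb => by
        change vermaParity χ (a + b) ∈ S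
        rw [map_add]; exact add_mem ha hb
      zero_mem' := by
        change vermaParity χ 0 ∈ S
        rw [map_zero]; exact zero_mem _
      smul_mem' := fun a m hm => by
        change vermaParity χ (a • m) ∈ S
        rw [map_smulₛₗ]; exact S.smul_mem _ hm }
  have hN : S ≤ N := hS N fun h => by
    obtain ⟨s, hs, hs0⟩ := Submodule.exists_mem_ne_zero_of_ne_bot hS0
    have h2 := (Submodule.eq_bot_iff N).1 h (vermaParity χ s)
      (show vermaParity χ (vermaParity χ s) ∈ S by rwa [hinv])
    exact hs0 (by rw [← hinv s, h2, map_zero])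
  have hSℂ : ∀ (r : ℂ), ∀ m ∈ S, r • m ∈ S := fun r m hm => by
    rw [← algebraMap_smul G.Enveloping r m]; exact S.smul_mem _ hm
  intro m hm
  obtain ⟨m₀, hm₀, m₁, hm₁, rfl⟩ := hdec m
  -- With P = `vermaParity`, the even component of m is (c P m + m) / 2.
  have hmem : m₀ ∈ S := by
    have h2 := hSℂ (c / 2) _ (hN hm)
    have h3 := add_mem h2 (hSℂ (1 / 2) _ hm)
    rw [map_add, h0 _ hm₀, h1 _ hm₁, smul_add, smul_add, smul_smul, smul_smul] at h3
    convert h3 using 1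
    rw [show c / 2 * c = 1 / 2 by linear_combination hc / 2,
      show c / 2 * -c = -(1 / 2) by linear_combination -hc / 2]
    module
  refine ⟨m₀, hm₀, m₁, hm₁, hmem, ?_, rfl⟩
  have := sub_mem hm hmem
  rwa [add_sub_cancel_left] at this

end LieSuperalgebra

end

theorem mainTheorem11 {𝔤₀ 𝔤₁ : Type*} [LieRing 𝔤₀] [LieAlgebra ℂ 𝔤₀] [FiniteDimensional ℂ 𝔤₀]
    [AddCommGroup 𝔤₁] [Module ℂ 𝔤₁] [FiniteDimensional ℂ 𝔤₁]
    [LieRingModule 𝔤₀ 𝔤₁] [LieModule ℂ 𝔤₀ 𝔤₁]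
    (G : LieSuperalgebra 𝔤₀ 𝔤₁) [LieAlgebra.HasCentralRadical ℂ 𝔤₀] (T : G.TypeI)
    (B : G.Sub) (hB : T.IsDistinguishedBorel B) (χ : B.Character) (ε : ZMod 2) :
    (LieSuperalgebra.vermaGrading χ ε).IsSimpleSub (LieSuperalgebra.vermaGrading χ ε).socle := by
  obtain ⟨S, hS0, hS⟩ := LieSuperalgebra.exists_least_verma_submodule T hB χ
  have hgr := LieSuperalgebra.isSubsupermodule_of_least ε hS0 hS
  have hsimple : (LieSuperalgebra.vermaGrading χ ε).IsSimpleSub S :=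
    ⟨hgr, hS0, fun K _ hK => or_iff_not_imp_left.2 fun hK0 => le_antisymm hK (hS K hK0)⟩
  have hsocle : (LieSuperalgebra.vermaGrading χ ε).socle = S := by
    refine le_antisymm (sSup_le fun N hN => ?_) (le_sSup hsimple)
    -- A simple `N` contains the graded nonzero submodule `S`, hence equals it.
    exact ((hN.2.2 S hgr (hS N hN.2.1)).resolve_left hS0).ge
  rw [hsocle]
  exact hsimple
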